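/- **Setting.** Let $(S_1(i),S_2(i))_{i\ge 0}$ be a stationary and ergodic process of nonnegative channel gains with finite means, such that $(S_1(i),S_2(i))$ has a joint probability density. Let $P_1,P_2,P_r>0$ be fixed powers, $0<\eta<1$, $C(x)=\log_2(1+x)$, and write (in each time slot $i$, which is omitted) $C_{1r}=C(P_1S_1)$, $C_{2r}=C(P_2S_2)$, $C_r=C(P_1S_1+P_2S_2)$, $C_{r1}=C(P_rS_1)$, $C_{r2}=C(P_rS_2)$, $$C_{12r}=tC(P_1S_1)+(1-t)C\Big(\tfrac{P_1S_1}{1+P_2S_2}\Big),\qquad C_{21r}=(1-t)C(P_2S_2)+tC\Big(\tfrac{P_2S_2}{1+P_1S_1}\Big).$$ The optimization problem, for a realization of the channel, is to maximize $\eta\bar R_{1r}+(1-\eta)\bar R_{2r}$ over all sequences $q_1(i),\dots,q_6(i),t(i)$, where $\bar R_{1r},\bar R_{2r},\bar R_{r1},\bar R_{r2}$ are the long-term time averages (assumed to exist) of $q_1C_{1r}+q_3C_{12r}$, $q_2C_{2r}+q_3C_{21r}$, $(q_4+q_6)C_{r1}$, $(q_5+q_6)C_{r2}$, subject to C1: $\bar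 R_{1r}=\bar R_{r2}$, C2: $\bar R_{2r}=\bar R_{r1}$, C3: $\sum_kq_k(i)=1$, C4: $0\le q_k(i)\le1$, C5: $0\le t(i)\le1$. For weights $\mu_1,\mu_2$ the selection metrics are $\Lambda_1=(\eta-\mu_1)C_{1r}$, $\Lambda_2=(1-\eta-\mu_2)C_{2r}$, $\Lambda_3=(\eta-\mu_1)C_{12r}+(1-\eta-\mu_2)C_{21r}$, $\Lambda_4=\mu_2C_{r1}$, $\Lambda_5=\mu_1C_{r2}$, $\Lambda_6=\mu_1C_{r2}+\mu_2C_{r1}$. The pair $(\mu_1,\mu_2)\in\mathbb R^2$ is *optimal* if it consists of optimal Lagrange multipliers of C1 and C2: for almost every channel realization there is a solution $(q,t)$ of the problem that in every slot maximizes the Lagrangian $\sum_kq_k\Lambda_k$ over all $q,t$ with C3, C4, C5. *The protocol.* Given $\mu_1,\mu_2$ and $p_1,\dots,p_6\in[0,1]$, flip in every slot six coins $\mathcal C_n$, independent of each other, of the other slots and of the channel, with $\Pr\{\mathcal C_n=1\}=p_n$. Put $[\mathcal I_1,\dots,\mathcal I_6]=[(1-\mathcal C_1)a,(1-\mathcal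 C_2)a,\mathcal C_1\mathcal C_2a,(1-\mathcal C_3)b,(1-\mathcal C_4)b,\mathcal C_3\mathcal C_4b]$, with $a=\mathcal C_5$, $b=1-\mathcal C_5$ if $(\mu_1,\mu_2)=(\eta,0)$, $P_2=P_r$, $\eta=\frac12$ or $(\mu_1,\mu_2)=(0,1-\eta)$, $P_1=P_r$, $\eta=\frac12$, and $a=b=1$ otherwise. Put $t=\mathcal C_6$, and $q_k=1$ for $k=\arg\max_k\mathcal I_k\Lambda_k$ (the smallest such $k$), $q_k=0$ otherwise. $E\{\cdot\}$ is the expectation in one slot under this protocol, and "C1 (C2, sum rate) is checked" means that, almost surely, the long-term rates of the protocol exist and satisfy C1 (C2, $\bar R_{1r}+\bar R_{2r}=\bar R_{r1}+\bar R_{r2}$). **Table of cases**, all with $0\le\mu_1\le\eta$ and $0\le\mu_2\le1-\eta$. "$\mu_1$ generic" means $\mu_1\ne0,\eta$, and "$\mu_2$ generic" means $\mu_2\ne0,1-\eta$. Of $p_1,\dots,p_4$, those not listed are $1$. All denominators have to be nonzero. Where $p_5$ is not listed it is arbitrary. *Region $\mathcal S_0$:* $\eta-\mu_1=1-\eta-\mu_2$.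 - Case 1: $\mu_1,\mu_2$ generic. $p_6=\frac{E\{q_3(C_r-C_{2r})\}-E\{q_6C_{r2}\}}{E\{q_3(C_r-C_{1r}-C_{2r})\}}$; the sum rate is checked. - Case 2a: $\mu_1=0$, $\mu_2=1-2\eta\neq0$. With $q=q_4+q_6$: $p_3=\frac{E\{q_3C_{12r}\}}{E\{qC_{r2}\}}$, $p_6=\frac{E\{qC_{r1}\}-E\{q_3C_{2r}\}}{E\{q_3(C_r-C_{1r}-C_{2r})\}}$; C2 is checked. - Case 2b: $\mu_1=2\eta-1\neq0$, $\mu_2=0$. With $q=q_5+q_6$: $p_4=\frac{E\{q_3C_{21r}\}}{E\{qC_{r1}\}}$, $p_6=\frac{E\{q_3(C_r-C_{2r})\}-E\{qC_{r2}\}}{E\{q_3(C_r-C_{1r}-C_{2r})\}}$; C1 is checked. *Region $\mathcal S_1$:* $\eta-\mu_1<1-\eta-\mu_2$, $p_6=0$. - Case 1: $\mu_1,\mu_2$ generic; C1 and C2 are checked. - Case 2a: $\mu_1=\eta$, $\mu_2$ generic. $p_2=\frac{E\{q_6C_{r2}\}}{E\{(q_2+q_3)(C_r-C_{2r})\}}$;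 C2 is checked. - Case 2b: $\mu_1$ generic, $\mu_2=0$. $p_4=\frac{E\{q_3C_{2r}\}}{E\{(q_5+q_6)C_{r1}\}}$; C1 is checked. - Case 2c, two coins: $\mu_1=\eta$, $\mu_2=0$, and $\eta\ne\frac12$ or $P_2\ne P_r$. With $q=q_2+q_3$: $p_2=\frac{E\{(1-q)C_{r2}\}}{E\{q(C_r-C_{2r})\}}$, $p_4=\frac{E\{qC_{2r}\}}{E\{(1-q)C_{r1}\}}$. - Case 2c, three coins: $\mu_1=\eta$, $\mu_2=0$, $\eta=\frac12$, $P_2=P_r$. With $\omega_l=\frac{E\{C_{r2}\}}{E\{C_r\}}$, $\omega_u=\frac{E\{C_{r1}\}}{E\{C_{r1}+C_{2r}\}}$: $\omega_l\le p_5\le\omega_u$, $p_2=\frac{1-p_5}{p_5}\frac{\omega_l}{1-\omega_l}$, $p_4=\frac{p_5}{1-p_5}\frac{1-\omega_u}{\omega_u}$. - Case 2d: $\mu_1=0$, $\mu_2$ generic. $p_3=\frac{E\{q_3(C_r-C_{2r})\}}{E\{(q_4+q_6)C_{r2}\}}$; C2 is checked. *Region $\mathcal S_2$:* $\eta-\mu_1>1-\eta-\mu_2$,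 $p_6=1$. - Case 1: $\mu_1,\mu_2$ generic; C1 and C2 are checked. - Case 2a: $\mu_1$ generic, $\mu_2=1-\eta$. $p_1=\frac{E\{q_6C_{r1}\}}{E\{(q_1+q_3)(C_r-C_{1r})\}}$; C1 is checked. - Case 2b: $\mu_1=0$, $\mu_2$ generic. $p_3=\frac{E\{q_3C_{1r}\}}{E\{(q_4+q_6)C_{r2}\}}$; C2 is checked. - Case 2c, two coins: $\mu_1=0$, $\mu_2=1-\eta$, and $\eta\ne\frac12$ or $P_1\ne P_r$. With $q=q_1+q_3$: $p_1=\frac{E\{(1-q)C_{r1}\}}{E\{q(C_r-C_{1r})\}}$, $p_3=\frac{E\{qC_{1r}\}}{E\{(1-q)C_{r2}\}}$. - Case 2c, three coins: $\mu_1=0$, $\mu_2=1-\eta$, $\eta=\frac12$, $P_1=P_r$. With $\omega_l=\frac{E\{C_{r1}\}}{E\{C_r\}}$, $\omega_u=\frac{E\{C_{r2}\}}{E\{C_{r2}+C_{1r}\}}$: $\omega_l\le p_5\le\omega_u$, $p_1=\frac{1-p_5}{p_5}\frac{\omega_l}{1-\omega_l}$, $p_3=\frac{p_5}{1-p_5}\frac{1-\omega_u}{\omega_u}$.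 - Case 2d: $\mu_1$ generic, $\mu_2=0$. $p_4=\frac{E\{q_3(C_r-C_{1r})\}}{E\{(q_5+q_6)C_{r1}\}}$; C1 is checked. A case *accepts* $(\mu_1,\mu_2,p_1,\dots,p_6)$, with $0\le p_n\le1$, if the weights belong to it and all its formulas and checked constraints hold. **Claims.** 1. Optimal weights $(\mu_1,\mu_2)$ exist. 2. All optimal weights lie in $[0,\eta]\times[0,1-\eta]$ and belong to exactly one case of the table (in particular, they are in exactly one selection region, and $(0,0)$ and $(\eta,1-\eta)$ in $\mathcal S_0$ and the remaining combinations of boundary values are never optimal). 3. If the weights belong to a case, then for every channel state the following metrics coincide. $\mathcal S_0$: 2a $\Lambda_4=\Lambda_6$; 2b $\Lambda_5=\Lambda_6$. $\mathcal S_1$ (with $t=0$): 2a $\Lambda_2=\Lambda_3$; 2b $\Lambda_5=\Lambda_6$; 2c $\Lambda_2=\Lambda_3$ and $\Lambda_5=\Lambda_6$, with three coins $\Lambda_2=\Lambda_3=\Lambda_5=\Lambda_6$; 2d $\Lambda_4=\Lambda_6$. $\mathcal S_2$ (with $t=1$): 2a $\Lambda_1=\Lambda_3$; 2b $\Lambda_4=\Lambda_6$;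 2c $\Lambda_1=\Lambda_3$ and $\Lambda_4=\Lambda_6$, with three coins $\Lambda_1=\Lambda_3=\Lambda_4=\Lambda_6$; 2d $\Lambda_5=\Lambda_6$. 4. If some case accepts $(\mu_1,\mu_2,p)$, then $(\mu_1,\mu_2)$ is optimal, and the protocol with $(\mu_1,\mu_2,p)$ almost surely solves the optimization problem. 5. Conversely, if $(\mu_1,\mu_2)$ is optimal and belongs to a case other than the two three-coin cases, then this case accepts $(\mu_1,\mu_2,p)$ for some $p$. 6. In each case the weights determine $p_1,\dots,p_4,p_6$ (in the three-coin cases: the weights and $p_5$ do). 7. If two cases accept $(\mu_1,\mu_2,p)$ and $(\mu_1',\mu_2',p')$, respectively, and all coins for which the accepting case prescribes no constant probability ($p_5$ counting only in the three-coin cases) have probabilities strictly between $0$ and $1$, then the two cases are the same. -/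

import Mathlib

open MeasureTheory Filter Topology Finset
open scoped unitInterval

noncomputable section

namespace BidirectionalRelay

/-! ### Channel, capacities, transmission modes -/

/-- The fixed transmit powers of user 1, user 2 and the relay, and the weight `η` of the
objective `η R₁ᵣ + (1 - η) R₂ᵣ`. -/
structure Params where
  P₁ : ℝ
  P₂ : ℝ
  Pᵣ : ℝ
  η : ℝ

/-- The channel state `(S₁, S₂)` of one time slot: the two squared channel gains. -/
abbrev State := ℝ × ℝ

/-- `C(x) = log₂ (1 + x)`. -/
def cap (x : ℝ) : ℝ := Real.logb 2 (1 + x)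

def C1r (θ : Params) (s : State) : ℝ := cap (θ.P₁ * s.1)
def C2r (θ : Params) (s : State) : ℝ := cap (θ.P₂ * s.2)
def Cr (θ : Params) (s : State) : ℝ := cap (θ.P₁ * s.1 + θ.P₂ * s.2)
def Cr1 (θ : Params) (s : State) : ℝ := cap (θ.Pᵣ * s.1)
def Cr2 (θ : Params) (s : State) : ℝ := cap (θ.Pᵣ * s.2)

/-- Rate of user 1 in the multiple-access mode, with decoding order variable `t`. -/
def C12r (θ : Params) (t : ℝ) (s : State) : ℝ :=
  t * cap (θ.P₁ * s.1) + (1 - t) * cap (θ.P₁ * s.1 / (1 + θ.P₂ * s.2))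

/-- Rate of user 2 in the multiple-access mode, with decoding order variable `t`. -/
def C21r (θ : Params) (t : ℝ) (s : State) : ℝ :=
  (1 - t) * cap (θ.P₂ * s.2) + t * cap (θ.P₂ * s.2 / (1 + θ.P₁ * s.1))

/-- The six transmission modes. -/
abbrev M1 : Fin 6 := 0
abbrev M2 : Fin 6 := 1
abbrev M3 : Fin 6 := 2
abbrev M4 : Fin 6 := 3
abbrev M5 : Fin 6 := 4
abbrev M6 : Fin 6 := 5

/-! ### The optimization problem

In the following `q k` is the share of mode `k` in a time slot. -/

def rate1r (θ : Params) (q : Fin 6 → ℝ) (t : ℝ) (s : State) : ℝ :=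
  q M1 * C1r θ s + q M3 * C12r θ t s
def rate2r (θ : Params) (q : Fin 6 → ℝ) (t : ℝ) (s : State) : ℝ :=
  q M2 * C2r θ s + q M3 * C21r θ t s
def rater1 (θ : Params) (q : Fin 6 → ℝ) (s : State) : ℝ := (q M4 + q M6) * Cr1 θ s
def rater2 (θ : Params) (q : Fin 6 → ℝ) (s : State) : ℝ := (q M5 + q M6) * Cr2 θ s

/-- `r` is the long-term average `lim_N (1/N) ∑_i x i`. -/
def HasAverage (x : ℕ → ℝ) (r : ℝ) : Prop :=
  Tendsto (fun N : ℕ => (∑ i ∈ range N, x i) / (N : ℝ)) atTop (𝓝 r)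

/-- The four long-term rates of the policy `(q, t)` on the channel realization `s`. -/
structure HasRates (θ : Params) (s : ℕ → State) (q : ℕ → Fin 6 → ℝ) (t : ℕ → ℝ)
    (R1r R2r Rr1 Rr2 : ℝ) : Prop where
  h1r : HasAverage (fun i => rate1r θ (q i) (t i) (s i)) R1r
  h2r : HasAverage (fun i => rate2r θ (q i) (t i) (s i)) R2r
  hr1 : HasAverage (fun i => rater1 θ (q i) (s i)) Rr1
  hr2 : HasAverage (fun i => rater2 θ (q i) (s i)) Rr2

/-- `(q, t)` is feasible on the realization `s`: its long-term rates exist and satisfy C1 and C2,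
and C3, C4, C5 hold in every slot (the powers are fixed). -/
structure Feasible (θ : Params) (s : ℕ → State) (q : ℕ → Fin 6 → ℝ) (t : ℕ → ℝ)
    (R1r R2r Rr1 Rr2 : ℝ) : Prop where
  rates : HasRates θ s q t R1r R2r Rr1 Rr2
  C1 : R1r = Rr2
  C2 : R2r = Rr1
  C3 : ∀ i, ∑ k, q i k = 1
  C4 : ∀ i k, 0 ≤ q i k ∧ q i k ≤ 1
  C5 : ∀ i, 0 ≤ t i ∧ t i ≤ 1

/-- `(q, t)` solves the problem `max η R₁ᵣ + (1 - η) R₂ᵣ` subject to C1 - C5 on the channel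
realization `s`; the competitors are arbitrary sequences `q', t'`. -/
def IsSolution (θ : Params) (s : ℕ → State) (q : ℕ → Fin 6 → ℝ) (t : ℕ → ℝ) : Prop :=
  ∃ R1r R2r Rr1 Rr2, Feasible θ s q t R1r R2r Rr1 Rr2 ∧
    ∀ q' t' R1r' R2r' Rr1' Rr2', Feasible θ s q' t' R1r' R2r' Rr1' Rr2' →
      θ.η * R1r' + (1 - θ.η) * R2r' ≤ θ.η * R1r + (1 - θ.η) * R2r

/-! ### Selection metrics and optimal selection weights -/

/-- The selection metrics `Λ₁, …, Λ₆` for selection weights `μ₁, μ₂` and decoding order `t`. -/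
def metric (θ : Params) (μ₁ μ₂ t : ℝ) (s : State) : Fin 6 → ℝ :=
  ![(θ.η - μ₁) * C1r θ s,
    (1 - θ.η - μ₂) * C2r θ s,
    (θ.η - μ₁) * C12r θ t s + (1 - θ.η - μ₂) * C21r θ t s,
    μ₂ * Cr1 θ s,
    μ₁ * Cr2 θ s,
    μ₁ * Cr2 θ s + μ₂ * Cr1 θ s]

/-- `(μ₁, μ₂)` are optimal selection weights, i.e. optimal Lagrange multipliers of C1 and C2:
for almost every channel realization there is a solution of the optimization problem that in every
slot maximizes the Lagrangian, so that it only uses modes of maximal selection metric. -/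
def OptimalWeights (ν : Measure (ℕ → State)) (θ : Params) (μ₁ μ₂ : ℝ) : Prop :=
  ∀ᵐ s ∂ν, ∃ q t, IsSolution θ s q t ∧
    ∀ i k t', 0 ≤ t' → t' ≤ 1 →
      metric θ μ₁ μ₂ t' (s i) k ≤ ∑ j, q i j * metric θ μ₁ μ₂ (t i) (s i) j

/-! ### The protocol with coin flips -/

/-- The six coins. -/
abbrev coin1 : Fin 6 := 0
abbrev coin2 : Fin 6 := 1
abbrev coin3 : Fin 6 := 2
abbrev coin4 : Fin 6 := 3
abbrev coin5 : Fin 6 := 4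
abbrev coin6 : Fin 6 := 5

/-- Outcome (0 or 1) of the `n`-th coin. -/
def flip (c : Fin 6 → Bool) (n : Fin 6) : ℝ := if c n then 1 else 0

/-- The situation in which the fifth coin decides between the user modes and the relay modes. -/
def UsesCoin5 (θ : Params) (μ₁ μ₂ : ℝ) : Prop :=
  (μ₁ = θ.η ∧ μ₂ = 0 ∧ θ.P₂ = θ.Pᵣ ∧ θ.η = 1 / 2) ∨
  (μ₁ = 0 ∧ μ₂ = 1 - θ.η ∧ θ.P₁ = θ.Pᵣ ∧ θ.η = 1 / 2)

open Classical in
/-- The candidate indicators `I₁, …, I₆`. -/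
def indicator (θ : Params) (μ₁ μ₂ : ℝ) (c : Fin 6 → Bool) : Fin 6 → ℝ :=
  let a : ℝ := if UsesCoin5 θ μ₁ μ₂ then flip c coin5 else 1
  let b : ℝ := if UsesCoin5 θ μ₁ μ₂ then 1 - flip c coin5 else 1
  ![(1 - flip c coin1) * a,
    (1 - flip c coin2) * a,
    flip c coin1 * flip c coin2 * a,
    (1 - flip c coin3) * b,
    (1 - flip c coin4) * b,
    flip c coin3 * flip c coin4 * b]

/-- The decoding order variable of the protocol. -/
def protoT (c : Fin 6 → Bool) : ℝ := flip c coin6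

/-- `I_k Λ_k`. -/
def weighted (θ : Params) (μ₁ μ₂ : ℝ) (c : Fin 6 → Bool) (s : State) (k : Fin 6) : ℝ :=
  indicator θ μ₁ μ₂ c k * metric θ μ₁ μ₂ (protoT c) s k

open Classical in
/-- Mode selection of the protocol: `q_k = 1` for `k = argmax I_k Λ_k` (the smallest index, if the
maximum is attained more than once), and `q_k = 0` otherwise. -/
def protoQ (θ : Params) (μ₁ μ₂ : ℝ) (c : Fin 6 → Bool) (s : State) (k : Fin 6) : ℝ :=
  if (∀ j, weighted θ μ₁ μ₂ c s j ≤ weighted θ μ₁ μ₂ c s k) ∧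
      ∀ j, j < k → weighted θ μ₁ μ₂ c s j < weighted θ μ₁ μ₂ c s k
  then 1 else 0

/-- Channel realization together with all coin flips. -/
abbrev Outcome := (ℕ → State) × (ℕ → Fin 6 → Bool)

/-- The joint law: channel process of law `ν`, and independent coin flips, where the `n`-th coin
shows 1 with probability `p n` in every slot. -/
def law (ν : Measure (ℕ → State)) (p : Fin 6 → I) : Measure Outcome :=
  ν.prod (Measure.infinitePi fun _ : ℕ =>
    Measure.pi fun n => ProbabilityTheory.bernoulliMeasure true false (p n))

/-- The expectation `E{f}` of a function of the channel state and coin flips of a slot. -/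
def expect (ν : Measure (ℕ → State)) (p : Fin 6 → I)
    (f : (Fin 6 → Bool) → State → ℝ) : ℝ :=
  ∫ ω, f (ω.2 0) (ω.1 0) ∂(law ν p)

/-- The protocol has long-term rates with `P R₁ᵣ R₂ᵣ Rᵣ₁ Rᵣ₂`, almost surely. -/
def ProtocolRates (ν : Measure (ℕ → State)) (θ : Params) (μ₁ μ₂ : ℝ) (p : Fin 6 → I)
    (P : ℝ → ℝ → ℝ → ℝ → Prop) : Prop :=
  ∀ᵐ ω ∂(law ν p), ∃ R1r R2r Rr1 Rr2,
    HasRates θ ω.1 (fun i => protoQ θ μ₁ μ₂ (ω.2 i) (ω.1 i)) (fun i => protoT (ω.2 i))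
      R1r R2r Rr1 Rr2 ∧ P R1r R2r Rr1 Rr2

/-- The protocol with weights `μ₁, μ₂` and coin flip probabilities `p` solves the optimization
problem, almost surely. -/
def ProtocolOptimal (ν : Measure (ℕ → State)) (θ : Params) (μ₁ μ₂ : ℝ) (p : Fin 6 → I) : Prop :=
  ∀ᵐ ω ∂(law ν p),
    IsSolution θ ω.1 (fun i => protoQ θ μ₁ μ₂ (ω.2 i) (ω.1 i)) (fun i => protoT (ω.2 i))

/-! ### The table of cases -/

/-- The cases of the three selection regions; `s1c2cEq` and `s2c2cEq` are the subcases of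
Case 2 c) in which three coins are flipped. -/
inductive TableCase
  | s0c1 | s0c2a | s0c2b
  | s1c1 | s1c2a | s1c2b | s1c2c | s1c2cEq | s1c2d
  | s2c1 | s2c2a | s2c2b | s2c2c | s2c2cEq | s2c2d

namespace TableCase

/-- The subcases with three coins. -/
def ThreeCoins (X : TableCase) : Prop := X = s1c2cEq ∨ X = s2c2cEq

/-- The weights in the search rectangle that belong to a case. -/
def Weights (θ : Params) (μ₁ μ₂ : ℝ) (X : TableCase) : Prop :=
  0 ≤ μ₁ ∧ μ₁ ≤ θ.η ∧ 0 ≤ μ₂ ∧ μ₂ ≤ 1 - θ.η ∧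
  match X with
  | s0c1 => θ.η - μ₁ = 1 - θ.η - μ₂ ∧ (μ₁ ≠ 0 ∧ μ₁ ≠ θ.η) ∧ (μ₂ ≠ 0 ∧ μ₂ ≠ 1 - θ.η)
  | s0c2a => θ.η - μ₁ = 1 - θ.η - μ₂ ∧ μ₁ = 0 ∧ μ₂ = 1 - 2 * θ.η ∧ μ₂ ≠ 0
  | s0c2b => θ.η - μ₁ = 1 - θ.η - μ₂ ∧ μ₁ = 2 * θ.η - 1 ∧ μ₁ ≠ 0 ∧ μ₂ = 0
  | s1c1 => θ.η - μ₁ < 1 - θ.η - μ₂ ∧ (μ₁ ≠ 0 ∧ μ₁ ≠ θ.η) ∧ (μ₂ ≠ 0 ∧ μ₂ ≠ 1 - θ.η)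
  | s1c2a => θ.η - μ₁ < 1 - θ.η - μ₂ ∧ μ₁ = θ.η ∧ (μ₂ ≠ 0 ∧ μ₂ ≠ 1 - θ.η)
  | s1c2b => θ.η - μ₁ < 1 - θ.η - μ₂ ∧ (μ₁ ≠ 0 ∧ μ₁ ≠ θ.η) ∧ μ₂ = 0
  | s1c2c => θ.η - μ₁ < 1 - θ.η - μ₂ ∧ μ₁ = θ.η ∧ μ₂ = 0 ∧ (θ.η ≠ 1 / 2 ∨ θ.P₂ ≠ θ.Pᵣ)
  | s1c2cEq => θ.η - μ₁ < 1 - θ.η - μ₂ ∧ μ₁ = θ.η ∧ μ₂ = 0 ∧ θ.η = 1 / 2 ∧ θ.P₂ = θ.Pᵣ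
  | s1c2d => θ.η - μ₁ < 1 - θ.η - μ₂ ∧ μ₁ = 0 ∧ (μ₂ ≠ 0 ∧ μ₂ ≠ 1 - θ.η)
  | s2c1 => 1 - θ.η - μ₂ < θ.η - μ₁ ∧ (μ₁ ≠ 0 ∧ μ₁ ≠ θ.η) ∧ (μ₂ ≠ 0 ∧ μ₂ ≠ 1 - θ.η)
  | s2c2a => 1 - θ.η - μ₂ < θ.η - μ₁ ∧ (μ₁ ≠ 0 ∧ μ₁ ≠ θ.η) ∧ μ₂ = 1 - θ.η
  | s2c2b => 1 - θ.η - μ₂ < θ.η - μ₁ ∧ μ₁ = 0 ∧ (μ₂ ≠ 0 ∧ μ₂ ≠ 1 - θ.η)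
  | s2c2c => 1 - θ.η - μ₂ < θ.η - μ₁ ∧ μ₁ = 0 ∧ μ₂ = 1 - θ.η ∧ (θ.η ≠ 1 / 2 ∨ θ.P₁ ≠ θ.Pᵣ)
  | s2c2cEq => 1 - θ.η - μ₂ < θ.η - μ₁ ∧ μ₁ = 0 ∧ μ₂ = 1 - θ.η ∧ θ.η = 1 / 2 ∧ θ.P₁ = θ.Pᵣ
  | s2c2d => 1 - θ.η - μ₂ < θ.η - μ₁ ∧ (μ₁ ≠ 0 ∧ μ₁ ≠ θ.η) ∧ μ₂ = 0

/-- The selection metrics that coincide for every channel state (with the decoding order variable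
0 in region 1 and 1 in region 2). -/
def Ties (θ : Params) (μ₁ μ₂ : ℝ) (X : TableCase) : Prop :=
  ∀ s : State,
  let L0 := metric θ μ₁ μ₂ 0 s
  let L1 := metric θ μ₁ μ₂ 1 s
  match X with
  | s0c1 => True
  | s0c2a => L0 M4 = L0 M6
  | s0c2b => L0 M5 = L0 M6
  | s1c1 => True
  | s1c2a => L0 M2 = L0 M3
  | s1c2b => L0 M5 = L0 M6
  | s1c2c => L0 M2 = L0 M3 ∧ L0 M5 = L0 M6
  | s1c2cEq => L0 M2 = L0 M3 ∧ L0 M3 = L0 M5 ∧ L0 M5 = L0 M6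
  | s1c2d => L0 M4 = L0 M6
  | s2c1 => True
  | s2c2a => L1 M1 = L1 M3
  | s2c2b => L1 M4 = L1 M6
  | s2c2c => L1 M1 = L1 M3 ∧ L1 M4 = L1 M6
  | s2c2cEq => L1 M1 = L1 M3 ∧ L1 M3 = L1 M4 ∧ L1 M4 = L1 M6
  | s2c2d => L1 M5 = L1 M6

/-- The coins that are really flipped in a case; in the table, the other ones have the constant
probability 0 or 1 (or `-`, for the fifth coin). -/
def flipped : TableCase → Finset (Fin 6)
  | s0c1 => {coin6}
  | s0c2a => {coin3, coin6}
  | s0c2b => {coin4, coin6}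
  | s1c1 => ∅
  | s1c2a => {coin2}
  | s1c2b => {coin4}
  | s1c2c => {coin2, coin4}
  | s1c2cEq => {coin2, coin4, coin5}
  | s1c2d => {coin3}
  | s2c1 => ∅
  | s2c2a => {coin1}
  | s2c2b => {coin3}
  | s2c2c => {coin1, coin3}
  | s2c2cEq => {coin1, coin3, coin5}
  | s2c2d => {coin4}

/-- The constant decoding order in regions 1 and 2, which is the probability of the sixth coin. -/
def order : TableCase → I
  | s0c1 | s0c2a | s0c2b => 0
  | s1c1 | s1c2a | s1c2b | s1c2c | s1c2cEq | s1c2d => 0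
  | s2c1 | s2c2a | s2c2b | s2c2c | s2c2cEq | s2c2d => 1

/-- The constant entries of the row of the table. -/
def ConstantEntries (X : TableCase) (p : Fin 6 → I) : Prop :=
  (∀ n ∈ ({coin1, coin2, coin3, coin4} : Finset (Fin 6)), n ∉ X.flipped → p n = 1) ∧
  (coin6 ∉ X.flipped → p coin6 = X.order)

end TableCase

/-- `x = num / den`, where the quotient is meaningful. -/
def IsRatio (x num den : ℝ) : Prop := den ≠ 0 ∧ x = num / den

open TableCase in
/-- The conditions under which a case accepts the weights and coin flip probabilities: the
formulas for the coin flip probabilities (which have to lie in `[0, 1]`), and those of the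
constraints C1, C2 (or the sum rate constraint) that have to be checked. -/
def Conditions (ν : Measure (ℕ → State)) (θ : Params) (μ₁ μ₂ : ℝ) (p : Fin 6 → I)
    (X : TableCase) : Prop :=
  let E := expect ν p
  let q : Fin 6 → (Fin 6 → Bool) → State → ℝ := fun k c s => protoQ θ μ₁ μ₂ c s k
  let C1holds := ProtocolRates ν θ μ₁ μ₂ p fun R1r _ _ Rr2 => R1r = Rr2
  let C2holds := ProtocolRates ν θ μ₁ μ₂ p fun _ R2r Rr1 _ => R2r = Rr1
  let sumRate := ProtocolRates ν θ μ₁ μ₂ p fun R1r R2r Rr1 Rr2 => R1r + R2r = Rr1 + Rr2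
  match X with
  | s0c1 =>
      IsRatio (p coin6)
        (E (fun c s => q M3 c s * (Cr θ s - C2r θ s)) - E (fun c s => q M6 c s * Cr2 θ s))
        (E fun c s => q M3 c s * (Cr θ s - C1r θ s - C2r θ s)) ∧
      sumRate
  | s0c2a =>
      IsRatio (p coin3)
        (E fun c s => q M3 c s * C12r θ (protoT c) s)
        (E fun c s => (q M4 c s + q M6 c s) * Cr2 θ s) ∧
      IsRatio (p coin6)
        (E (fun c s => (q M4 c s + q M6 c s) * Cr1 θ s) - E (fun c s => q M3 c s * C2r θ s))
        (E fun c s => q M3 c s * (Cr θ s - C1r θ s - C2r θ s)) ∧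
      C2holds
  | s0c2b =>
      IsRatio (p coin4)
        (E fun c s => q M3 c s * C21r θ (protoT c) s)
        (E fun c s => (q M5 c s + q M6 c s) * Cr1 θ s) ∧
      IsRatio (p coin6)
        (E (fun c s => q M3 c s * (Cr θ s - C2r θ s))
          - E (fun c s => (q M5 c s + q M6 c s) * Cr2 θ s))
        (E fun c s => q M3 c s * (Cr θ s - C1r θ s - C2r θ s)) ∧
      C1holds
  | s1c1 => C1holds ∧ C2holds
  | s1c2a =>
      IsRatio (p coin2)
        (E fun c s => q M6 c s * Cr2 θ s)
        (E fun c s => (q M2 c s + q M3 c s) * (Cr θ s - C2r θ s)) ∧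
      C2holds
  | s1c2b =>
      IsRatio (p coin4)
        (E fun c s => q M3 c s * C2r θ s)
        (E fun c s => (q M5 c s + q M6 c s) * Cr1 θ s) ∧
      C1holds
  | s1c2c =>
      IsRatio (p coin2)
        (E fun c s => (1 - (q M2 c s + q M3 c s)) * Cr2 θ s)
        (E fun c s => (q M2 c s + q M3 c s) * (Cr θ s - C2r θ s)) ∧
      IsRatio (p coin4)
        (E fun c s => (q M2 c s + q M3 c s) * C2r θ s)
        (E fun c s => (1 - (q M2 c s + q M3 c s)) * Cr1 θ s)
  | s1c2cEq =>
      let ωl := E (fun _ s => Cr2 θ s) / E (fun _ s => Cr θ s)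
      let ωu := E (fun _ s => Cr1 θ s) / E (fun _ s => Cr1 θ s + C2r θ s)
      let p5 : ℝ := p coin5
      ωl ≤ p5 ∧ p5 ≤ ωu ∧
      (p coin2 : ℝ) = (1 - p5) / p5 * (ωl / (1 - ωl)) ∧
      (p coin4 : ℝ) = p5 / (1 - p5) * ((1 - ωu) / ωu)
  | s1c2d =>
      IsRatio (p coin3)
        (E fun c s => q M3 c s * (Cr θ s - C2r θ s))
        (E fun c s => (q M4 c s + q M6 c s) * Cr2 θ s) ∧
      C2holds
  | s2c1 => C1holds ∧ C2holds
  | s2c2a =>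
      IsRatio (p coin1)
        (E fun c s => q M6 c s * Cr1 θ s)
        (E fun c s => (q M1 c s + q M3 c s) * (Cr θ s - C1r θ s)) ∧
      C1holds
  | s2c2b =>
      IsRatio (p coin3)
        (E fun c s => q M3 c s * C1r θ s)
        (E fun c s => (q M4 c s + q M6 c s) * Cr2 θ s) ∧
      C2holds
  | s2c2c =>
      IsRatio (p coin1)
        (E fun c s => (1 - (q M1 c s + q M3 c s)) * Cr1 θ s)
        (E fun c s => (q M1 c s + q M3 c s) * (Cr θ s - C1r θ s)) ∧
      IsRatio (p coin3)
        (E fun c s => (q M1 c s + q M3 c s) * C1r θ s)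
        (E fun c s => (1 - (q M1 c s + q M3 c s)) * Cr2 θ s)
  | s2c2cEq =>
      let ωl := E (fun _ s => Cr1 θ s) / E (fun _ s => Cr θ s)
      let ωu := E (fun _ s => Cr2 θ s) / E (fun _ s => Cr2 θ s + C1r θ s)
      let p5 : ℝ := p coin5
      ωl ≤ p5 ∧ p5 ≤ ωu ∧
      (p coin1 : ℝ) = (1 - p5) / p5 * (ωl / (1 - ωl)) ∧
      (p coin3 : ℝ) = p5 / (1 - p5) * ((1 - ωu) / ωu)
  | s2c2d =>
      IsRatio (p coin4)
        (E fun c s => q M3 c s * (Cr θ s - C1r θ s))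
        (E fun c s => (q M5 c s + q M6 c s) * Cr1 θ s) ∧
      C1holds

/-- The weights and coin flip probabilities are accepted by case `X` of the search. -/
def Accepts (ν : Measure (ℕ → State)) (θ : Params) (μ₁ μ₂ : ℝ) (p : Fin 6 → I)
    (X : TableCase) : Prop :=
  X.Weights θ μ₁ μ₂ ∧ X.ConstantEntries p ∧ Conditions ν θ μ₁ μ₂ p X

/-- All coins that are flipped in case `X` have both outcomes with positive probability. -/
def Nondegenerate (p : Fin 6 → I) (X : TableCase) : Prop :=
  ∀ n ∈ X.flipped, 0 < p n ∧ p n < 1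

/-- The channel: `(S₁, S₂)` is a stationary and ergodic process of nonnegative channel gains with
finite means, and `(S₁(i), S₂(i))` has a probability density. -/
structure IsChannel (ν : Measure (ℕ → State)) : Prop where
  prob : IsProbabilityMeasure ν
  ergodic : Ergodic (fun (s : ℕ → State) (i : ℕ) => s (i + 1)) ν
  nonneg : ∀ᵐ s ∂ν, 0 ≤ (s 0).1 ∧ 0 ≤ (s 0).2
  mean₁ : Integrable (fun s : ℕ → State => (s 0).1) ν
  mean₂ : Integrable (fun s : ℕ → State => (s 0).2) ν
  density : ν.map (fun s => s 0) ≪ (volume : Measure State)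

end BidirectionalRelay

end

/-! The problem is reduced to stationary randomized policies. In a slot, a policy is a mixture of
seven pure options: the six modes, with mode 3 counted once for each decoding order, because its
rates are affine in `t`. The Lagrangian of a slot is linear in this mixture, so its optimum is the
largest option metric.

The central objects are the policies `w` that are `Balanced` (their mean rates satisfy C1 and C2)
and `Maximizes` (in almost every state they only use options of maximal metric). On balanced
policies the Lagrangian equals the objective, whatever the weights. Birkhoff's theorem turns means
into time averages, and the slotwise maximum of the metrics bounds every feasible sequence on a
realization. So weights that possess a balanced maximizing policy are optimal
(`optimalWeights_of_balanced`). Conversely, optimal weights possess such a policy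
(`exists_balanced_of_optimalWeights`): the achievable mean rates form a convex compact set, and if
none of them met the requirements, a separating functional would be contradicted by the time
averages on a single realization. Existence of weights is a Lagrange multiplier theorem
(`exists_lagrange_multipliers`), obtained from Sion's minimax theorem on the same compact set.

Weights outside the rectangle, and its two bad corners, let some options be strictly dominated in
every state; C1 and C2 then force all options of the users, or all options of the relay, to be
unused, which is impossible (`admissible_of_maximizes`).

For admissible weights the options split into those of the users and those of the relay. Which
options are best inside a group depends on the weights alone, not on the state (`Allowed`). The best
user metric and the best relay metric differ almost surely, because the channel has a density and
the level sets of the logarithmic expressions are null (`ae_ne_userBest`); the exceptions are the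
two three-coin situations, where these metrics agree identically and the fifth coin decides.

The mode choice is a product of functions each affine in one coin, so averaging over the independent
coins replaces outcomes by probabilities and the protocol behaves like the stationary policy
`protoPolicy`. This policy always maximizes the Lagrangian. The formulas and checks of a row are C1
and C2 solved for the coin probabilities (`conditions_iff_balanced`); with three coins they at least
imply balance. Conversely, in any balanced maximizing policy the ties inside a group affect the mean
rates through one number only, and one coin per group can reproduce it (`exists_user_coins`,
`exists_relay_coins`). The same linear equations determine the coin probabilities.

Finally, a balanced policy that maximizes the Lagrangian for one accepted pair of weights does so
for every other one. The options used by nondegenerate coins are therefore tied for the other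
weights as well, which forces the same row. -/

noncomputable section

/-! ### The pointwise ergodic theorem -/

namespace ErgodicAverage

variable {Ω : Type*} {T : Ω → Ω}

/-- The running maximum `max (0, S₁, …, Sₙ)` of the Birkhoff sums. -/
def runMax (T : Ω → Ω) (f : Ω → ℝ) : ℕ → Ω → ℝ
  | 0 => fun _ => 0
  | n + 1 => fun x => max 0 (f x + runMax T f n (T x))

lemma runMax_nonneg (f : Ω → ℝ) (n : ℕ) (x : Ω) : 0 ≤ runMax T f n x := by
  cases n with
  | zero => exact le_rfl
  | succ n => exact le_max_left _ _

lemma runMax_le_succ (f : Ω → ℝ) (n : ℕ) : ∀ x, runMax T f n x ≤ runMax T f (n + 1) x := by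
  induction n with
  | zero => exact fun x => runMax_nonneg f 1 x
  | succ n ih =>
    intro x
    exact max_le_max le_rfl (by simpa using ih (T x))

lemma birkhoffSum_le_runMax (f : Ω → ℝ) (n : ℕ) : ∀ x, birkhoffSum T f n x ≤ runMax T f n x := by
  induction n with
  | zero => intro x; simp [runMax]
  | succ n ih =>
    intro x
    rw [birkhoffSum_succ']
    exact le_max_of_le_right (by simpa using ih (T x))

/-- The recursion for the running maximum makes boundedness along an orbit a `T`-invariant property,
so that ergodicity yields a zero-one alternative for it. -/
lemma bddAbove_runMax_iff (f : Ω → ℝ) (x : Ω) :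
    BddAbove (Set.range fun n => runMax T f n (T x)) ↔
      BddAbove (Set.range fun n => runMax T f n x) := by
  constructor
  · rintro ⟨b, hb⟩
    refine ⟨max 0 (f x + b), ?_⟩
    rintro _ ⟨n, rfl⟩
    cases n with
    | zero => exact le_max_left _ _
    | succ n => exact max_le_max le_rfl (by simpa using hb ⟨n, rfl⟩)
  · rintro ⟨b, hb⟩
    refine ⟨b - f x, ?_⟩
    rintro _ ⟨n, rfl⟩
    have := hb ⟨n + 1, rfl⟩
    have h2 : f x + runMax T f n (T x) ≤ runMax T f (n + 1) x := le_max_right _ _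
    simp only at this ⊢
    linarith

variable [MeasurableSpace Ω] {ν : Measure Ω}

lemma measurable_runMax (hT : Measurable T) {f : Ω → ℝ} (hf : Measurable f) (n : ℕ) :
    Measurable (runMax T f n) := by
  induction n with
  | zero => exact measurable_const
  | succ n ih => exact measurable_const.max (hf.add (ih.comp hT))

lemma integrable_runMax [IsFiniteMeasure ν] (hT : MeasurePreserving T ν ν) {f : Ω → ℝ}
    (hfi : Integrable f ν) (n : ℕ) : Integrable (runMax T f n) ν := by
  induction n with
  | zero => exact integrable_const _
  | succ n ih =>
    exact (integrable_const (0 : ℝ)).sup (hfi.add (hT.integrable_comp_of_integrable ih))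

/-- This is the maximal ergodic argument. By ergodicity, failure would mean that the running maxima
`M n` tend to infinity almost everywhere. Then `M (n + 1) - M n ∘ T` converges to `f` and is
dominated by `|f|`, while its integral is nonnegative, since `T` preserves the measure and `M`
increases. So `f` would have a nonnegative mean. -/
lemma ae_bddAbove_runMax [IsProbabilityMeasure ν] (hT : Ergodic T ν) {f : Ω → ℝ}
    (hf : Measurable f) (hfi : Integrable f ν) (hneg : ∫ x, f x ∂ν < 0) :
    ∀ᵐ x ∂ν, BddAbove (Set.range fun n => runMax T f n x) := by
  have hmeas : MeasurableSet {x | BddAbove (Set.range fun n => runMax T f n x)} :=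
    measurableSet_bddAbove_range fun n => measurable_runMax hT.measurable hf n
  rcases hT.toPreErgodic.ae_mem_or_ae_notMem hmeas
    (Set.ext fun x => bddAbove_runMax_iff f x) with h | h
  · exact h
  exfalso
  have htop : ∀ᵐ x ∂ν, Tendsto (fun n => runMax T f n (T x)) atTop atTop := by
    filter_upwards [h] with x hx
    refine (tendsto_atTop_atTop_of_monotone
      (monotone_nat_of_le_succ fun n => runMax_le_succ f n (T x)) fun b => ?_)
    by_contra! hb
    exact hx ((bddAbove_runMax_iff f x).1 ⟨b, by rintro _ ⟨n, rfl⟩; exact (hb n).le⟩)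
  have hlim : Tendsto (fun n => ∫ x, (runMax T f (n + 1) x - runMax T f n (T x)) ∂ν) atTop
      (𝓝 (∫ x, f x ∂ν)) := by
    refine tendsto_integral_of_dominated_convergence (fun x => |f x|) (fun n => ?_)
      hfi.abs (fun n => ?_) ?_
    · exact ((measurable_runMax hT.measurable hf _).sub
        ((measurable_runMax hT.measurable hf _).comp hT.measurable)).aestronglyMeasurable
    · refine Eventually.of_forall fun x => ?_
      have h0 := runMax_nonneg (T := T) f n (T x)
      simp only [runMax, Real.norm_eq_abs, abs_le]
      have h1 := neg_abs_le (f x)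
      have h2 := le_abs_self (f x)
      have h3 := abs_nonneg (f x)
      constructor
      · have := le_max_right 0 (f x + runMax T f n (T x))
        linarith
      · have : max 0 (f x + runMax T f n (T x)) ≤ |f x| + runMax T f n (T x) :=
          max_le (by linarith) (by linarith)
        linarith
    · filter_upwards [htop] with x hx
      refine tendsto_const_nhds.congr' ?_
      filter_upwards [hx.eventually_ge_atTop (-f x)] with n hn
      simp only [runMax]
      rw [max_eq_right (by linarith)]
      ring
  have hnn : ∀ n, 0 ≤ ∫ x, (runMax T f (n + 1) x - runMax T f n (T x)) ∂ν := fun n => by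
    have hi := integrable_runMax hT.toMeasurePreserving hfi n
    have hi' : Integrable (fun x => runMax T f n (T x)) ν :=
      hT.toMeasurePreserving.integrable_comp_of_integrable hi
    rw [integral_sub (integrable_runMax hT.toMeasurePreserving hfi _) hi']
    have h2 : ∫ x, runMax T f n (T x) ∂ν = ∫ x, runMax T f n x ∂ν := by
      rw [← integral_map (f := runMax T f n) hT.measurable.aemeasurable
        (by rw [hT.map_eq]; exact hi.aestronglyMeasurable), hT.map_eq]
    rw [h2, sub_nonneg]
    exact integral_mono hi (integrable_runMax hT.toMeasurePreserving hfi _)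
      fun x => runMax_le_succ f n x
  exact absurd (ge_of_tendsto' hlim hnn) (not_le.2 hneg)

/-- After subtracting the mean plus `ε / 2` the mean is negative, so the Birkhoff sums are bounded
above by some `b`, and `b / n` eventually drops below `ε / 2`. -/
lemma ae_eventually_birkhoffAverage_lt [IsProbabilityMeasure ν] (hT : Ergodic T ν) {f : Ω → ℝ}
    (hf : Measurable f) (hfi : Integrable f ν) {ε : ℝ} (hε : 0 < ε) :
    ∀ᵐ x ∂ν, ∀ᶠ n : ℕ in atTop, birkhoffSum T f n x / n < ∫ x, f x ∂ν + ε := by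
  set J := ∫ x, f x ∂ν
  have hg : Integrable (fun x => f x - (J + ε / 2)) ν := hfi.sub (integrable_const _)
  have hneg : ∫ x, (f x - (J + ε / 2)) ∂ν < 0 := by
    rw [integral_sub hfi (integrable_const _)]
    simp only [integral_const, probReal_univ, one_smul]
    linarith
  filter_upwards [ae_bddAbove_runMax hT (hf.sub_const _) hg hneg] with x ⟨b, hb⟩
  have hlt : ∀ᶠ n : ℕ in atTop, b / n < ε / 2 :=
    (tendsto_const_div_atTop_nhds_zero_nat b).eventually_lt_const (by linarith)
  filter_upwards [hlt, eventually_gt_atTop 0] with n hn hn0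
  have hn' : (0 : ℝ) < n := by exact_mod_cast hn0
  have h1 := (birkhoffSum_le_runMax (T := T) (fun x => f x - (J + ε / 2)) n x).trans (hb ⟨n, rfl⟩)
  have h2 : birkhoffSum T (fun x => f x - (J + ε / 2)) n x
      = birkhoffSum T f n x - n * (J + ε / 2) := by
    simp only [birkhoffSum, Finset.sum_sub_distrib, Finset.sum_const, Finset.card_range,
      nsmul_eq_mul]
  rw [div_lt_iff₀ hn'] at hn ⊢
  rw [h2] at h1
  nlinarith

/-- **Birkhoff's pointwise ergodic theorem** for ergodic transformations. -/
theorem ae_tendsto_birkhoffSum_div [IsProbabilityMeasure ν] (hT : Ergodic T ν) {f : Ω → ℝ}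
    (hf : Measurable f) (hfi : Integrable f ν) :
    ∀ᵐ x ∂ν, Tendsto (fun n : ℕ => birkhoffSum T f n x / n) atTop (𝓝 (∫ x, f x ∂ν)) := by
  have h1 : ∀ᵐ x ∂ν, ∀ k : ℕ, ∀ᶠ n : ℕ in atTop,
      birkhoffSum T f n x / n < ∫ x, f x ∂ν + 1 / ((k : ℝ) + 1) :=
    ae_all_iff.2 fun k => ae_eventually_birkhoffAverage_lt hT hf hfi Nat.one_div_pos_of_nat
  have h2 : ∀ᵐ x ∂ν, ∀ k : ℕ, ∀ᶠ n : ℕ in atTop,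
      birkhoffSum T (-f) n x / n < ∫ x, (-f) x ∂ν + 1 / ((k : ℝ) + 1) :=
    ae_all_iff.2 fun k => ae_eventually_birkhoffAverage_lt hT hf.neg hfi.neg
      Nat.one_div_pos_of_nat
  filter_upwards [h1, h2] with x hx1 hx2
  rw [Metric.tendsto_nhds]
  intro ε hε
  obtain ⟨k, hk⟩ := exists_nat_one_div_lt hε
  filter_upwards [hx1 k, hx2 k] with n hn1 hn2
  have h3 : birkhoffSum T (-f) n x = - birkhoffSum T f n x := by
    simp [birkhoffSum]
  have h4 : ∫ x, (-f) x ∂ν = - ∫ x, f x ∂ν := by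
    simp [integral_neg]
  rw [h3, h4, neg_div] at hn2
  rw [Real.dist_eq, abs_lt]
  constructor <;> linarith

/-! ### The product of an ergodic transformation and a Bernoulli shift -/

variable {X : Type*}

/-- The one-sided shift. -/
def shift (c : ℕ → X) : ℕ → X := fun i => c (i + 1)

lemma shift_iterate (n : ℕ) (c : ℕ → X) : shift^[n] c = fun i => c (i + n) := by
  induction n generalizing c with
  | zero => rfl
  | succ n ih =>
    rw [Function.iterate_succ_apply, ih]
    funext i
    simp only [shift]
    congr 1

variable [MeasurableSpace X]

lemma measurable_shift : Measurable (shift : (ℕ → X) → ℕ → X) :=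
  measurable_pi_lambda _ fun i => measurable_pi_apply (i + 1)

lemma measurePreserving_shift (π : Measure X) [IsProbabilityMeasure π] :
    MeasurePreserving shift (Measure.infinitePi fun _ : ℕ => π)
      (Measure.infinitePi fun _ : ℕ => π) :=
  ⟨measurable_shift, Measure.map_infinitePi_infinitePi_of_inj (P := fun _ : ℕ => π)
    (add_left_injective 1)⟩

/-- The shifted sequence reads no coordinate before `n`, so preimages under it are events of the
`n`-th tail. -/
lemma measurable_iterate_shift_tail (n : ℕ) :
    Measurable[⨆ i ≥ n, MeasurableSpace.comap (fun c : ℕ → X => c i) inferInstance]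
      (shift^[n] : (ℕ → X) → ℕ → X) := by
  rw [@measurable_pi_iff]
  intro i
  have : (fun c : ℕ → X => shift^[n] c i) = fun c => c (i + n) := by
    funext c; rw [shift_iterate]
  rw [this]
  have h1 : MeasurableSpace.comap (fun c : ℕ → X => c (i + n)) inferInstance ≤
      ⨆ i ≥ n, MeasurableSpace.comap (fun c : ℕ → X => c i) inferInstance :=
    le_iSup₂_of_le (i + n) (Nat.le_add_left n i) le_rfl
  exact fun s hs => h1 _ ⟨s, hs, rfl⟩

/-- The product of an ergodic transformation and a Bernoulli shift is ergodic. -/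
theorem ergodic_prod_shift [IsProbabilityMeasure ν] (hT : Ergodic T ν) (π : Measure X)
    [IsProbabilityMeasure π] :
    Ergodic (Prod.map T (shift (X := X))) (ν.prod (Measure.infinitePi fun _ : ℕ => π)) := by
  set Q := Measure.infinitePi fun _ : ℕ => π
  have hmp : MeasurePreserving (Prod.map T (shift (X := X))) (ν.prod Q) (ν.prod Q) :=
    hT.toMeasurePreserving.prod (measurePreserving_shift π)
  refine ⟨hmp, ⟨fun A hA hinv => ?_⟩⟩
  have hsec : ∀ x, Prod.mk x ⁻¹' A = shift ⁻¹' (Prod.mk (T x) ⁻¹' A) := fun x => by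
    conv_lhs => rw [← hinv]
    rfl
  have hmeas : ∀ x, MeasurableSet (Prod.mk x ⁻¹' A) := fun x => measurable_prodMk_left hA
  -- Every section of an invariant set is a preimage under every iterate of the shift, hence a tail
  -- event of independent coordinates; Kolmogorov's law then gives it measure 0 or 1.
  have hiter : ∀ n x, Prod.mk x ⁻¹' A = shift^[n] ⁻¹' (Prod.mk (T^[n] x) ⁻¹' A) := by
    intro n
    induction n with
    | zero => intro x; rfl
    | succ n ih =>
      intro x
      rw [hsec x, ih (T x), ← Set.preimage_comp, ← Function.iterate_succ,
        ← Function.iterate_succ_apply]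
  have h01 : ∀ x, Q (Prod.mk x ⁻¹' A) = 0 ∨ Q (Prod.mk x ⁻¹' A) = 1 := by
    intro x
    refine ProbabilityTheory.measure_zero_or_one_of_measurableSet_limsup_atTop
      (s := fun i => MeasurableSpace.comap (fun c : ℕ → X => c i) inferInstance)
      (fun n => (measurable_pi_apply n).comap_le) ?_ ?_
    · exact ProbabilityTheory.iIndepFun_infinitePi (P := fun _ : ℕ => π) (X := fun _ x => x)
        fun _ => measurable_id
    · rw [limsup_eq_iInf_iSup_of_nat, MeasurableSpace.measurableSet_iInf]
      intro n
      rw [hiter n x]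
      exact measurable_iterate_shift_tail n (hmeas _)
  have hPm : Measurable fun x => Q (Prod.mk x ⁻¹' A) := measurable_measure_prodMk_left hA
  have hPinv : ∀ x, Q (Prod.mk (T x) ⁻¹' A) = Q (Prod.mk x ⁻¹' A) := fun x => by
    rw [hsec x, (measurePreserving_shift π).measure_preimage (hmeas _).nullMeasurableSet]
  -- The states whose section is null form a `T`-invariant set, so either almost all sections are
  -- null or almost all are full.
  have hB := hT.toPreErgodic.ae_mem_or_ae_notMem (s := {x | Q (Prod.mk x ⁻¹' A) = 0})
    (hPm (measurableSet_singleton 0)) (Set.ext fun x => by simp [hPinv])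
  rw [eventuallyConst_set']
  rcases hB with h | h
  · left
    rw [ae_eq_empty, Measure.measure_prod_null hA]
    exact h
  · right
    rw [ae_eq_univ, Measure.measure_prod_null hA.compl]
    filter_upwards [h] with x hx
    have h1 : Q (Prod.mk x ⁻¹' A) = 1 := (h01 x).resolve_left hx
    rw [Set.preimage_compl]
    simpa [prob_compl_eq_zero_iff (hmeas x)] using h1

end ErgodicAverage

/-! ### Randomized policies on a probability space -/

namespace RandomizedPolicy

variable {α : Type*} [MeasurableSpace α] {ι κ : Type*} [Fintype ι]

/-- A randomized choice among the options `ι`, depending measurably on the state. -/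
structure IsPolicy (w : ι → α → ℝ) : Prop where
  measurable : ∀ k, Measurable (w k)
  nonneg : ∀ k s, 0 ≤ w k s
  sum_eq : ∀ s, ∑ k, w k s = 1

lemma IsPolicy.le_one {w : ι → α → ℝ} (h : IsPolicy w) (k : ι) (s : α) : w k s ≤ 1 := by
  rw [← h.sum_eq s]
  exact single_le_sum (f := fun k => w k s) (fun k _ => h.nonneg k s) (mem_univ k)

/-- The expected rewards that can be achieved with randomized policies, if option `k` in state `s`
has the vector of rewards `F k · s`. -/
def achievable (m : Measure α) (F : ι → κ → α → ℝ) : Set (κ → ℝ) :=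
  {r | ∃ w : ι → α → ℝ, IsPolicy w ∧ ∀ j, r j = ∫ s, ∑ k, w k s * F k j s ∂m}

lemma IsPolicy.integrable_mul {m : Measure α} {w : ι → α → ℝ} (h : IsPolicy w) (k : ι)
    {f : α → ℝ} (hf : Integrable f m) : Integrable (fun s => w k s * f s) m :=
  hf.bdd_mul (h.measurable k).aestronglyMeasurable
    (Eventually.of_forall fun s => by
      rw [Real.norm_eq_abs, abs_of_nonneg (h.nonneg k s)]; exact h.le_one k s)

lemma IsPolicy.integrable_sum {m : Measure α} {w : ι → α → ℝ} (h : IsPolicy w)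
    {f : ι → α → ℝ} (hf : ∀ k, Integrable (f k) m) :
    Integrable (fun s => ∑ k, w k s * f k s) m :=
  integrable_finsetSum _ fun k _ => h.integrable_mul k (hf k)

lemma convex_achievable {m : Measure α} {F : ι → κ → α → ℝ}
    (hF : ∀ k j, Integrable (F k j) m) : Convex ℝ (achievable m F) := by
  rintro r ⟨w, hw, hr⟩ r' ⟨w', hw', hr'⟩ a b ha hb hab
  refine ⟨fun k s => a * w k s + b * w' k s, ⟨fun k => ?_, fun k s => ?_, fun s => ?_⟩,
    fun j => ?_⟩
  · exact ((hw.measurable k).const_mul a).add ((hw'.measurable k).const_mul b)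
  · have := hw.nonneg k s
    have := hw'.nonneg k s
    positivity
  · rw [sum_add_distrib, ← mul_sum, ← mul_sum, hw.sum_eq, hw'.sum_eq, mul_one, mul_one, hab]
  · rw [Pi.add_apply, Pi.smul_apply, Pi.smul_apply, hr j, hr' j, smul_eq_mul, smul_eq_mul,
      ← integral_const_mul, ← integral_const_mul,
      ← integral_add ((hw.integrable_sum fun k => hF k j).const_mul a)
        ((hw'.integrable_sum fun k => hF k j).const_mul b)]
    refine integral_congr_ae (Eventually.of_forall fun s => ?_)
    simp only [mul_sum, ← sum_add_distrib]
    exact sum_congr rfl fun k _ => by ring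

/-- Randomized policies, as tuples of functionals on `L²`. -/
def policyFunctionals (m : Measure α) [IsFiniteMeasure m] (ι : Type*) [Fintype ι] :
    Set (ι → WeakDual ℝ (Lp ℝ 2 m)) :=
  (Set.univ.pi fun _ => WeakDual.toStrongDual ⁻¹' Metric.closedBall 0 1) ∩
    {Φ | ∀ A (hA : MeasurableSet A),
      (∀ k, 0 ≤ Φ k (indicatorConstLp 2 hA (measure_ne_top m A) (1 : ℝ))) ∧
      ∑ k, Φ k (indicatorConstLp 2 hA (measure_ne_top m A) (1 : ℝ)) = m.real A}

/-- Banach–Alaoglu and Tychonoff give a compact product of balls. Nonnegativity and total mass are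
tested on indicators only, hence are conditions on single evaluations and weak-* closed. -/
lemma isCompact_policyFunctionals (m : Measure α) [IsFiniteMeasure m] :
    IsCompact (policyFunctionals m ι) := by
  refine (isCompact_univ_pi fun _ => WeakDual.isCompact_closedBall 0 1).inter_right ?_
  have he : ∀ (k : ι) (φ : Lp ℝ 2 m), Continuous fun Φ : ι → WeakDual ℝ (Lp ℝ 2 m) => Φ k φ :=
    fun k φ => (WeakDual.eval_continuous φ).comp (continuous_apply k)
  simp only [Set.ofPred_forall, Set.ofPred_and]
  refine isClosed_iInter fun A => isClosed_iInter fun hA => IsClosed.inter ?_ ?_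
  · exact isClosed_iInter fun k => isClosed_le continuous_const (he k _)
  · exact isClosed_eq (continuous_finsetSum _ fun k _ => he k _) continuous_const

/-- The Riesz representatives in `L²` of the functionals are densities. Testing on all measurable
sets makes them nonnegative with sum 1 almost everywhere. -/
lemma exists_policy_of_mem_policyFunctionals {m : Measure α} [IsProbabilityMeasure m]
    [Nonempty ι] {Φ : ι → WeakDual ℝ (Lp ℝ 2 m)} (hΦ : Φ ∈ policyFunctionals m ι) :
    ∃ w : ι → α → ℝ, IsPolicy w ∧ ∀ k (f : α → ℝ) (hf : MemLp f 2 m),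
      Φ k (hf.toLp f) = ∫ s, w k s * f s ∂m := by
  classical
  let ψ : ι → Lp ℝ 2 m := fun k =>
    (InnerProductSpace.toDual ℝ (Lp ℝ 2 m)).symm (WeakDual.toStrongDual (Φ k))
  have hψ : ∀ k φ, Φ k φ = ∫ s, ψ k s * φ s ∂m := fun k φ => by
    have h1 : inner ℝ (ψ k) φ = Φ k φ := InnerProductSpace.toDual_symm_apply
    rw [← h1, L2.inner_def]
    refine integral_congr_ae (Eventually.of_forall fun s => ?_)
    simp [mul_comm]
  have hind : ∀ k A (hA : MeasurableSet A),
      Φ k (indicatorConstLp 2 hA (measure_ne_top m A) (1 : ℝ)) = ∫ s in A, ψ k s ∂m :=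
    fun k A hA => by
      have h1 : inner ℝ (ψ k) (indicatorConstLp 2 hA (measure_ne_top m A) (1 : ℝ)) = Φ k _ :=
        InnerProductSpace.toDual_symm_apply
      rw [← h1, real_inner_comm, L2.inner_indicatorConstLp_one]
  have hint : ∀ k, Integrable (ψ k) m := fun k => (Lp.memLp (ψ k)).integrable (by norm_num)
  have hnn : ∀ k, 0 ≤ᵐ[m] ψ k := fun k =>
    ae_nonneg_of_forall_setIntegral_nonneg (hint k) fun A hA _ => by
      rw [← hind k A hA]
      exact (hΦ.2 A hA).1 k
  have hsum : (fun s => ∑ k, ψ k s) =ᵐ[m] fun _ => (1 : ℝ) := by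
    refine Integrable.ae_eq_of_forall_setIntegral_eq _ _
      (integrable_finsetSum _ fun k _ => hint k) (integrable_const _) fun A hA _ => ?_
    rw [integral_finsetSum _ fun k _ => (hint k).integrableOn]
    have := (hΦ.2 A hA).2
    simp only [hind] at this
    rw [this]
    simp
  have hmk : ∀ k, Measurable (ψ k) := fun k => (Lp.stronglyMeasurable (ψ k)).measurable
  let B : Set α := {s | (∀ k, 0 ≤ ψ k s) ∧ ∑ k, ψ k s = 1}
  have hB : MeasurableSet B := by
    have hBeq : B = (⋂ k, {s | 0 ≤ ψ k s}) ∩ {s | ∑ k, ψ k s = 1} := by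
      ext s; simp [B]
    rw [hBeq]
    refine MeasurableSet.inter ?_ ?_
    · exact MeasurableSet.iInter fun k => measurableSet_le measurable_const (hmk k)
    · exact measurableSet_eq_fun (Finset.measurable_sum _ fun k _ => hmk k) measurable_const
  have hBae : ∀ᵐ s ∂m, s ∈ B := by
    filter_upwards [ae_all_iff.2 hnn, hsum] with s h1 h2 using ⟨h1, h2⟩
  -- A policy has to be a probability vector in every state; on the exceptional null set all mass is
  -- put on an arbitrary option.
  let k₀ : ι := Classical.arbitrary ι
  refine ⟨fun k s => if s ∈ B then ψ k s else if k = k₀ then 1 else 0,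
    ⟨fun k => Measurable.ite hB (hmk k) measurable_const, fun k s => ?_, fun s => ?_⟩,
    fun k f hf => ?_⟩
  · by_cases hs : s ∈ B
    · simpa only [if_pos hs] using hs.1 k
    · simp only [if_neg hs]
      split_ifs <;> norm_num
  · by_cases hs : s ∈ B
    · simpa only [if_pos hs] using hs.2
    · simp [if_neg hs]
  · rw [hψ]
    refine integral_congr_ae ?_
    filter_upwards [hBae, hf.coeFn_toLp] with s hs hfs
    simp only [if_pos hs, hfs]

lemma exists_mem_policyFunctionals {m : Measure α} [IsProbabilityMeasure m]
    {w : ι → α → ℝ} (hw : IsPolicy w) :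
    ∃ Φ ∈ policyFunctionals m ι, ∀ k (f : α → ℝ) (hf : MemLp f 2 m),
      Φ k (hf.toLp f) = ∫ s, w k s * f s ∂m := by
  have hw1 : ∀ k s, ‖w k s‖ ≤ 1 := fun k s => by
    rw [Real.norm_eq_abs, abs_of_nonneg (hw.nonneg k s)]; exact hw.le_one k s
  have hwp : ∀ k, MemLp (w k) 2 m := fun k =>
    MemLp.of_bound (hw.measurable k).aestronglyMeasurable 1 (Eventually.of_forall (hw1 k))
  let Φ : ι → WeakDual ℝ (Lp ℝ 2 m) := fun k =>
    StrongDual.toWeakDual (InnerProductSpace.toDual ℝ (Lp ℝ 2 m) ((hwp k).toLp (w k)))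
  have hΦ : ∀ k φ, Φ k φ = inner ℝ ((hwp k).toLp (w k)) φ := fun k φ =>
    InnerProductSpace.toDual_apply_apply
  have hind : ∀ k A (hA : MeasurableSet A),
      Φ k (indicatorConstLp 2 hA (measure_ne_top m A) (1 : ℝ)) = ∫ s in A, w k s ∂m :=
    fun k A hA => by
      rw [hΦ, real_inner_comm, L2.inner_indicatorConstLp_one]
      exact integral_congr_ae (ae_restrict_of_ae (hwp k).coeFn_toLp)
  refine ⟨Φ, ⟨fun k _ => ?_, fun A hA => ⟨fun k => ?_, ?_⟩⟩, fun k f hf => ?_⟩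
  · rw [Set.mem_preimage, mem_closedBall_zero_iff]
    have h1 : ‖WeakDual.toStrongDual (Φ k)‖ = ‖(hwp k).toLp (w k)‖ :=
      (InnerProductSpace.toDual ℝ (Lp ℝ 2 m)).norm_map _
    rw [h1]
    refine (Lp.norm_le_of_ae_bound zero_le_one ?_).trans ?_
    · filter_upwards [(hwp k).coeFn_toLp] with s hs
      rw [hs]; exact hw1 k s
    · simp [measureUnivNNReal]
  · rw [hind]
    exact integral_nonneg fun s => hw.nonneg k s
  · simp only [hind]
    rw [← integral_finsetSum _ fun k _ => ((hwp k).integrable (by norm_num)).integrableOn]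
    simp [hw.sum_eq]
  · rw [hΦ, L2.inner_def]
    refine integral_congr_ae ?_
    filter_upwards [(hwp k).coeFn_toLp, hf.coeFn_toLp] with s h1 h2
    simp [h1, h2, mul_comm]

/-- The achievable set is compact, by weak compactness in `L²`. -/
lemma isCompact_achievable {m : Measure α} [IsProbabilityMeasure m] [Nonempty ι]
    {F : ι → κ → α → ℝ} (hF : ∀ k j, MemLp (F k j) 2 m) : IsCompact (achievable m F) := by
  have hc : Continuous fun (Φ : ι → WeakDual ℝ (Lp ℝ 2 m)) (j : κ) =>
      ∑ k, Φ k ((hF k j).toLp (F k j)) :=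
    continuous_pi fun j => continuous_finsetSum _ fun k _ =>
      (WeakDual.eval_continuous _).comp (continuous_apply k)
  convert (isCompact_policyFunctionals (ι := ι) m).image hc using 1
  have hi : ∀ k j, Integrable (F k j) m := fun k j => (hF k j).integrable (by norm_num)
  ext r
  constructor
  · rintro ⟨w, hw, hr⟩
    obtain ⟨Φ, hΦ, h⟩ := exists_mem_policyFunctionals (m := m) hw
    refine ⟨Φ, hΦ, funext fun j => ?_⟩
    simp only [h]
    rw [hr j, integral_finsetSum _ fun k _ => hw.integrable_mul k (hi k j)]
  · rintro ⟨Φ, hΦ, rfl⟩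
    obtain ⟨w, hw, h⟩ := exists_policy_of_mem_policyFunctionals hΦ
    refine ⟨w, hw, fun j => ?_⟩
    simp only [h]
    rw [integral_finsetSum _ fun k _ => hw.integrable_mul k (hi k j)]

/-! ### Pointwise maximization -/

section Max

variable [Nonempty ι]

/-- The maximal value over the options. -/
def maxVal (G : ι → ℝ) : ℝ := univ.sup' univ_nonempty G

lemma le_maxVal (G : ι → ℝ) (k : ι) : G k ≤ maxVal G := le_sup' G (mem_univ k)

lemma exists_eq_maxVal (G : ι → ℝ) : ∃ k, G k = maxVal G := by
  obtain ⟨k, -, hk⟩ := exists_mem_eq_sup' (s := (univ : Finset ι)) univ_nonempty G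
  exact ⟨k, hk.symm⟩

lemma sum_mul_le_maxVal {w G : ι → ℝ} (hw : ∀ k, 0 ≤ w k) (h1 : ∑ k, w k = 1) :
    ∑ k, w k * G k ≤ maxVal G :=
  calc ∑ k, w k * G k ≤ ∑ k, w k * maxVal G :=
        sum_le_sum fun k _ => mul_le_mul_of_nonneg_left (le_maxVal G k) (hw k)
    _ = maxVal G := by rw [← sum_mul, h1, one_mul]

lemma integrable_maxVal {m : Measure α} {G : ι → α → ℝ} (hG : ∀ k, Integrable (G k) m) :
    Integrable (fun s => maxVal fun k => G k s) m := by
  have : (fun s => maxVal fun k => G k s) = univ.sup' univ_nonempty G := by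
    funext s
    simp [maxVal, Finset.sup'_apply]
  rw [this]
  exact Finset.sup'_induction univ_nonempty G (p := fun f => Integrable f m)
    (fun _ h1 _ h2 => h1.sup h2) fun k _ => hG k

lemma measurable_maxVal {G : ι → α → ℝ} (hG : ∀ k, Measurable (G k)) :
    Measurable (fun s => maxVal fun k => G k s) := by
  have : (fun s => maxVal fun k => G k s) = univ.sup' univ_nonempty G := by
    funext s
    simp [maxVal, Finset.sup'_apply]
  rw [this]
  exact Finset.measurable_sup' univ_nonempty fun k _ => hG k

/-- The uniform distribution on the maximizing options. -/
lemma exists_policy_sum_eq_maxVal {G : ι → α → ℝ} (hG : ∀ k, Measurable (G k)) :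
    ∃ w : ι → α → ℝ, IsPolicy w ∧ ∀ s, ∑ k, w k s * G k s = maxVal fun k => G k s := by
  classical
  let χ : ι → α → ℝ := fun k s => if G k s = maxVal (fun k => G k s) then 1 else 0
  have hχ0 : ∀ k s, 0 ≤ χ k s := fun k s => by
    simp only [χ]; split_ifs <;> norm_num
  have hχm : ∀ k, Measurable (χ k) := fun k =>
    Measurable.ite (measurableSet_eq_fun (hG k) (measurable_maxVal hG)) measurable_const
      measurable_const
  have hpos : ∀ s, 0 < ∑ k, χ k s := fun s => by
    obtain ⟨k, hk⟩ := exists_eq_maxVal fun k => G k s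
    exact sum_pos' (fun k _ => hχ0 k s) ⟨k, mem_univ k, by simp [χ, hk]⟩
  have hsum : ∀ s, ∑ k, χ k s / ∑ k, χ k s = 1 := fun s => by
    rw [← sum_div, div_self (hpos s).ne']
  refine ⟨fun k s => χ k s / ∑ k, χ k s, ⟨fun k => ?_, fun k s => ?_, hsum⟩, fun s => ?_⟩
  · exact (hχm k).div (Finset.measurable_sum _ fun k _ => hχm k)
  · exact div_nonneg (hχ0 k s) (hpos s).le
  · calc ∑ k, χ k s / (∑ k, χ k s) * G k s
        = ∑ k, χ k s / (∑ k, χ k s) * maxVal (fun k => G k s) := by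
          refine sum_congr rfl fun k _ => ?_
          by_cases h : G k s = maxVal (fun k => G k s)
          · rw [h]
          · simp [χ, h]
      _ = maxVal fun k => G k s := by rw [← sum_mul, hsum, one_mul]

end Max

/-! ### Lagrange multipliers -/

/-- Two linear equality constraints on a compact convex set admit Lagrange multipliers, if the
constraint values take both signs along both axes. -/
theorem exists_lagrange_multipliers {E : Type*} [AddCommGroup E] [Module ℝ E] [TopologicalSpace E]
    [IsTopologicalAddGroup E] [ContinuousSMul ℝ E] {V : Set E} (hconv : Convex ℝ V)
    (hcomp : IsCompact V) (f g₁ g₂ : E →L[ℝ] ℝ) {x₁ x₂ x₃ x₄ : E}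
    (hx₁ : x₁ ∈ V) (hx₂ : x₂ ∈ V) (hx₃ : x₃ ∈ V) (hx₄ : x₄ ∈ V)
    (h₁ : 0 < g₁ x₁ ∧ g₂ x₁ = 0) (h₂ : g₁ x₂ < 0 ∧ g₂ x₂ = 0)
    (h₃ : g₁ x₃ = 0 ∧ 0 < g₂ x₃) (h₄ : g₁ x₄ = 0 ∧ g₂ x₄ < 0) :
    ∃ μ₁ μ₂ : ℝ, ∃ r ∈ V, g₁ r = 0 ∧ g₂ r = 0 ∧
      ∀ x ∈ V, f x - μ₁ * g₁ x - μ₂ * g₂ x ≤ f r := by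
  obtain ⟨M, hM⟩ := hcomp.bddAbove_image f.continuous.continuousOn
  have hM' : ∀ x ∈ V, f x ≤ M := fun x hx => hM ⟨x, hx, rfl⟩
  -- The box for the multipliers is taken so large that a multiplier on its boundary would give one
  -- of the four test points a Lagrangian value above the maximum of `f`.
  obtain ⟨B, hB0, hB⟩ : ∃ B : ℝ, 0 < B ∧ (M < f x₁ + B * g₁ x₁ ∧ M < f x₂ - B * g₁ x₂ ∧
      M < f x₃ + B * g₂ x₃ ∧ M < f x₄ - B * g₂ x₄) := by
    have key : ∀ a b : ℝ, 0 < b → ∀ᶠ B : ℝ in atTop, M < a + B * b := fun a b hb =>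
      (tendsto_atTop_add_const_left _ a (tendsto_id.atTop_mul_const hb)).eventually_gt_atTop M
    have := ((eventually_gt_atTop (0 : ℝ)).and ((key (f x₁) _ h₁.1).and
      ((key (f x₂) _ (neg_pos.2 h₂.1)).and
      ((key (f x₃) _ h₃.2).and (key (f x₄) _ (neg_pos.2 h₄.2)))))).exists
    obtain ⟨B, hB0, b1, b2, b3, b4⟩ := this
    exact ⟨B, hB0, b1, by linarith, b3, by linarith⟩
  let Y : Set (ℝ × ℝ) := Set.Icc (-B) B ×ˢ Set.Icc (-B) B
  have hYc : Convex ℝ Y := (convex_Icc _ _).prod (convex_Icc _ _)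
  let φ : E → ℝ × ℝ → ℝ := fun x μ => μ.1 * g₁ x + μ.2 * g₂ x - f x
  obtain ⟨r, hr, μ, hμ, hsad⟩ : ∃ r ∈ V, ∃ μ ∈ Y, IsSaddlePointOn V Y φ r μ := by
    refine Sion.exists_isSaddlePointOn ⟨x₁, hx₁⟩ hconv hcomp (fun y _ => ?_) (fun y _ => ?_) hYc
      ⟨(0, 0), by simp [Y, hB0.le]⟩ (isCompact_Icc.prod isCompact_Icc) (fun x _ => ?_)
      (fun x _ => ?_)
    · refine Continuous.lowerSemicontinuous ?_ |>.lowerSemicontinuousOn _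
      fun_prop
    · refine ConvexOn.quasiconvexOn ⟨hconv, fun a _ b _ s t _ _ _ => le_of_eq ?_⟩
      simp only [φ, map_add, map_smul, smul_eq_mul]
      ring
    · refine Continuous.upperSemicontinuous ?_ |>.upperSemicontinuousOn _
      fun_prop
    · refine ConcaveOn.quasiconcaveOn ⟨hYc, fun a _ b _ s t _ _ hst => le_of_eq ?_⟩
      obtain rfl : t = 1 - s := by linarith
      simp only [φ, Prod.fst_add, Prod.snd_add, Prod.smul_fst, Prod.smul_snd, smul_eq_mul]
      ring
  have h0 : ∀ x ∈ V, f x - μ.1 * g₁ x - μ.2 * g₂ x ≤ f r := fun x hx => by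
    have := hsad x hx (0, 0) (by simp [Y, hB0.le])
    simp only [φ] at this
    linarith
  have hrM := hM' r hr
  have e1 := h0 x₁ hx₁
  have e2 := h0 x₂ hx₂
  have e3 := h0 x₃ hx₃
  have e4 := h0 x₄ hx₄
  rw [h₁.2] at e1; rw [h₂.2] at e2; rw [h₃.1] at e3; rw [h₄.1] at e4
  -- The saddle point's multiplier is interior to the box. Since `r` makes a linear function of the
  -- multiplier attain its maximum there, both constraint values at `r` vanish.
  have b1 : -B < μ.1 := by nlinarith [h₁.1]
  have b2 : μ.1 < B := by nlinarith [h₂.1]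
  have b3 : -B < μ.2 := by nlinarith [h₃.2]
  have b4 : μ.2 < B := by nlinarith [h₄.2]
  have hμ1 := hμ.1
  have hμ2 := hμ.2
  have hend : ∀ y ∈ Y, y.1 * g₁ r + y.2 * g₂ r ≤ μ.1 * g₁ r + μ.2 * g₂ r := fun y hy => by
    have := hsad r hr y hy
    simp only [φ] at this
    linarith
  have hBB : -B ≤ B := by linarith
  have c1 := hend (B, μ.2) ⟨Set.right_mem_Icc.2 hBB, hμ2⟩
  have c2 := hend (-B, μ.2) ⟨Set.left_mem_Icc.2 hBB, hμ2⟩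
  have c3 := hend (μ.1, B) ⟨hμ1, Set.right_mem_Icc.2 hBB⟩
  have c4 := hend (μ.1, -B) ⟨hμ1, Set.left_mem_Icc.2 hBB⟩
  simp only at c1 c2 c3 c4
  refine ⟨μ.1, μ.2, r, hr, ?_, ?_, h0⟩
  · apply le_antisymm <;> nlinarith
  · apply le_antisymm <;> nlinarith

end RandomizedPolicy

/-! ### Level sets of logarithmic expressions -/

namespace LogLevelSet

/-- With denominators cleared, the equation for a critical point is affine in the variable. It
degenerates only for the excluded parameters, for which the function vanishes identically. -/
lemma critical_point_unique {α β a b : ℝ} (ha : 0 < a) (hb : 0 < b)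
    (h : ¬(α = β ∧ (α = 0 ∨ a = b))) {x y : ℝ} (hx : 0 < x) (hy : 0 < y)
    (hx0 : α * (a / (1 + a * x)) - β * (b / (1 + b * x)) = 0)
    (hy0 : α * (a / (1 + a * y)) - β * (b / (1 + b * y)) = 0) : x = y := by
  have key : ∀ z : ℝ, 0 < z → α * (a / (1 + a * z)) - β * (b / (1 + b * z)) = 0 →
      α * a - β * b = a * b * (β - α) * z := fun z hz h0 => by
    have h1 : 0 < 1 + a * z := by positivity
    have h2 : 0 < 1 + b * z := by positivity
    field_simp at h0
    linarith
  have kx := key x hx hx0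
  have ky := key y hy hy0
  have h3 : a * b * (β - α) * (x - y) = 0 := by linear_combination ky - kx
  rcases mul_eq_zero.1 h3 with h4 | h4
  · have hab : α = β := by
      rcases mul_eq_zero.1 h4 with h5 | h5
      · exact absurd h5 (mul_pos ha hb).ne'
      · linarith
    subst hab
    have h6 : α * (a - b) = 0 := by linear_combination kx
    rcases mul_eq_zero.1 h6 with h7 | h7
    · exact absurd ⟨rfl, Or.inl h7⟩ h
    · exact absurd ⟨rfl, Or.inr (by linarith)⟩ h
  · linarith

lemma exists_critical_point {α β a b c : ℝ} (ha : 0 < a) (hb : 0 < b) {x y : ℝ} (hx : 0 < x)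
    (hxy : x < y) (h1 : α * Real.log (1 + a * x) - β * Real.log (1 + b * x) = c)
    (h2 : α * Real.log (1 + a * y) - β * Real.log (1 + b * y) = c) :
    ∃ z, x < z ∧ z < y ∧ α * (a / (1 + a * z)) - β * (b / (1 + b * z)) = 0 := by
  have hd : ∀ z, 0 < z → HasDerivAt (fun z => α * Real.log (1 + a * z) - β * Real.log (1 + b * z))
      (α * (a / (1 + a * z)) - β * (b / (1 + b * z))) z := fun z hz => by
    have k : ∀ d : ℝ, 0 < d → HasDerivAt (fun z => Real.log (1 + d * z)) (d / (1 + d * z)) z :=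
      fun d hd => by
        have : HasDerivAt (fun z : ℝ => 1 + d * z) d z := by
          simpa using ((hasDerivAt_id z).const_mul d).const_add 1
        exact this.log (by positivity)
    exact ((k a ha).const_mul α).sub ((k b hb).const_mul β)
  obtain ⟨z, hz, hz0⟩ := exists_hasDerivAt_eq_zero hxy
    (f := fun z => α * Real.log (1 + a * z) - β * Real.log (1 + b * z))
    (fun z hz => (hd z (hx.trans_le hz.1)).continuousAt.continuousWithinAt) (h1.trans h2.symm)
    (fun z hz => hd z (hx.trans hz.1))
  exact ⟨z, hz.1, hz.2, hz0⟩

/-- By Rolle, the unique critical point `z` lies strictly between any two points of the level set,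
so there is at most one point on each side of `z`. -/
lemma finite_levelSet {α β a b : ℝ} (ha : 0 < a) (hb : 0 < b)
    (h : ¬(α = β ∧ (α = 0 ∨ a = b))) (c : ℝ) :
    {x : ℝ | 0 < x ∧ α * Real.log (1 + a * x) - β * Real.log (1 + b * x) = c}.Finite := by
  set S := {x : ℝ | 0 < x ∧ α * Real.log (1 + a * x) - β * Real.log (1 + b * x) = c}
  by_cases hS : S.Subsingleton
  · exact hS.finite
  obtain ⟨x, hx, y, hy, hxy⟩ := Set.not_subsingleton_iff.1 hS |>.exists_lt
  obtain ⟨z, hz1, hz2, hz0⟩ := exists_critical_point ha hb hx.1 hxy hx.2 hy.2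
  have key : ∀ u ∈ S, ∀ v ∈ S, u < v → u < z ∧ z < v := fun u hu v hv huv => by
    obtain ⟨z', h1, h2, h0⟩ := exists_critical_point ha hb hu.1 huv hu.2 hv.2
    obtain rfl := critical_point_unique ha hb h (hx.1.trans hz1) (hu.1.trans h1) hz0 h0
    exact ⟨h1, h2⟩
  have hun : S = (S ∩ Set.Iic z) ∪ (S ∩ Set.Ioi z) := by
    rw [← Set.inter_union_distrib_left, Set.Iic_union_Ioi, Set.inter_univ]
  rw [hun]
  refine Set.Finite.union (Set.Subsingleton.finite ?_) (Set.Subsingleton.finite ?_)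
  · rintro u ⟨hu, hu'⟩ v ⟨hv, hv'⟩
    rcases lt_trichotomy u v with g | g | g
    · exact absurd (key u hu v hv g).2 (not_lt.2 hv')
    · exact g
    · exact absurd (key v hv u hu g).2 (not_lt.2 hu')
  · rintro u ⟨hu, hu'⟩ v ⟨hv, hv'⟩
    rcases lt_trichotomy u v with g | g | g
    · exact absurd (key u hu v hv g).1 (not_lt.2 (le_of_lt hu'))
    · exact g
    · exact absurd (key v hv u hu g).1 (not_lt.2 (le_of_lt hv'))

/-- The states in which two mixtures of capacities coincide. -/
def tieSet (P Q R α₁ α₂ β₁ β₂ : ℝ) : Set (ℝ × ℝ) :=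
  {s | (0 < s.1 ∧ 0 < s.2) ∧
    α₁ * (Real.log (1 + (P * s.1 + Q * s.2)) - Real.log (1 + Q * s.2))
      + α₂ * Real.log (1 + Q * s.2) = β₁ * Real.log (1 + R * s.2) + β₂ * Real.log (1 + R * s.1)}

lemma measurableSet_tieSet (P Q R α₁ α₂ β₁ β₂ : ℝ) :
    MeasurableSet (tieSet P Q R α₁ α₂ β₁ β₂) := by
  unfold tieSet
  refine MeasurableSet.inter (MeasurableSet.inter ?_ ?_) ?_
  · exact measurableSet_lt measurable_const measurable_fst
  · exact measurableSet_lt measurable_const measurable_snd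
  · refine measurableSet_eq_fun ?_ ?_ <;> fun_prop

/-- Fubini reduces this to finite level sets in one variable. If the equation involves `s.2` only,
the slices at fixed `s.1` are such sets. Otherwise `s.2` is fixed, and the difference of logarithms
becomes `log (1 + a * s.1)` with `a = P / (1 + Q * s.2)`. -/
lemma volume_tieSet {P Q R α₁ α₂ β₁ β₂ : ℝ} (hP : 0 < P) (hQ : 0 < Q) (hR : 0 < R)
    (h : α₁ = 0 → β₂ = 0 → ¬(α₂ = β₁ ∧ (α₂ = 0 ∨ Q = R))) :
    volume (tieSet P Q R α₁ α₂ β₁ β₂) = 0 := by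
  have hm := measurableSet_tieSet P Q R α₁ α₂ β₁ β₂
  by_cases h0 : α₁ = 0 ∧ β₂ = 0
  · rw [Measure.volume_eq_prod, Measure.measure_prod_null hm]
    refine Eventually.of_forall fun x => ?_
    refine measure_mono_null ?_ ((finite_levelSet hQ hR (h h0.1 h0.2) 0).measure_zero volume)
    rintro y ⟨⟨-, hy⟩, he⟩
    refine ⟨hy, ?_⟩
    simp only [h0.1, h0.2] at he
    linarith
  · rw [Measure.volume_eq_prod, Measure.prod_apply_symm hm, lintegral_eq_zero_iff
      (measurable_measure_prodMk_right hm)]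
    -- The slice can only degenerate if `a = R`, which happens for at most one value of `s.2`.
    have hcount : {y : ℝ | 0 < y ∧ P / (1 + Q * y) = R}.Subsingleton := by
      rintro y ⟨hy, hy'⟩ z ⟨hz, hz'⟩
      have h1 : 0 < 1 + Q * y := by positivity
      have h2 : 0 < 1 + Q * z := by positivity
      rw [div_eq_iff h1.ne'] at hy'
      rw [div_eq_iff h2.ne'] at hz'
      have h3 : R * Q * (y - z) = 0 := by linear_combination hz' - hy'
      rcases mul_eq_zero.1 h3 with h4 | h4
      · exact absurd h4 (mul_pos hR hQ).ne'
      · linarith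
    have hae : ∀ᵐ y : ℝ, y ∉ {y : ℝ | 0 < y ∧ P / (1 + Q * y) = R} :=
      measure_eq_zero_iff_ae_notMem.1 (hcount.finite.measure_zero _)
    filter_upwards [hae] with y hy
    by_cases hy0 : 0 < y
    · have h1 : 0 < 1 + Q * y := by positivity
      have hn : ¬(α₁ = β₂ ∧ (α₁ = 0 ∨ P / (1 + Q * y) = R)) := by
        rintro ⟨e1, e2 | e2⟩
        · exact h0 ⟨e2, by rw [← e1, e2]⟩
        · exact hy ⟨hy0, e2⟩
      refine measure_mono_null ?_ ((finite_levelSet (div_pos hP h1) hR hn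
        (β₁ * Real.log (1 + R * y) - α₂ * Real.log (1 + Q * y))).measure_zero volume)
      rintro x ⟨⟨hx, -⟩, he⟩
      refine ⟨hx, ?_⟩
      have hx' : (0 : ℝ) < x := hx
      have h2 : Real.log (1 + P / (1 + Q * y) * x)
          = Real.log (1 + (P * x + Q * y)) - Real.log (1 + Q * y) := by
        rw [← Real.log_div (by positivity) h1.ne']
        congr 1
        field_simp
        ring
      rw [h2]
      simp only at he
      linarith
    · refine measure_mono_null (t := ∅) ?_ measure_empty
      rintro x ⟨⟨-, hx⟩, -⟩
      exact hy0 hx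

lemma volume_tieSet_swap {P Q R α₁ α₂ β₁ β₂ : ℝ} (hP : 0 < P) (hQ : 0 < Q) (hR : 0 < R)
    (h : α₁ = 0 → β₂ = 0 → ¬(α₂ = β₁ ∧ (α₂ = 0 ∨ Q = R))) :
    volume (Prod.swap ⁻¹' tieSet P Q R α₁ α₂ β₁ β₂) = 0 :=
  (Measure.measurePreserving_swap (μ := (volume : Measure ℝ))
    (ν := (volume : Measure ℝ))).quasiMeasurePreserving.preimage_null (volume_tieSet hP hQ hR h)

end LogLevelSet

/-! ### Rates of the transmission options -/

namespace BidirectionalRelay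

open RandomizedPolicy ErgodicAverage

/-- Positive powers and a nondegenerate objective. -/
structure Params.Valid (θ : Params) : Prop where
  P₁ : 0 < θ.P₁
  P₂ : 0 < θ.P₂
  Pᵣ : 0 < θ.Pᵣ
  η₀ : 0 < θ.η
  η₁ : θ.η < 1

/-- The law of the channel state in one slot. -/
structure IsSlotLaw (m : Measure State) : Prop where
  prob : IsProbabilityMeasure m
  pos : ∀ᵐ s ∂m, 0 < s.1 ∧ 0 < s.2
  mean₁ : Integrable (fun s : State => s.1) m
  mean₂ : Integrable (fun s : State => s.2) m
  density : m ≪ (volume : Measure State)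

lemma cap_zero : cap 0 = 0 := by simp [cap]

lemma cap_lt {x y : ℝ} (hx : 0 ≤ x) (hxy : x < y) : cap x < cap y :=
  Real.logb_lt_logb one_lt_two (by linarith) (by linarith)

lemma cap_pos {x : ℝ} (hx : 0 < x) : 0 < cap x := cap_zero ▸ cap_lt le_rfl hx

/-- The logarithm grows more slowly than the square root. Thus finite means of the gains already put
the capacities in `L²`, where weak compactness is used. -/
lemma cap_sq_le {x : ℝ} (hx : 0 ≤ x) : cap x ^ 2 ≤ 4 / Real.log 2 ^ 2 * x := by
  have h2 : 0 < Real.log 2 := Real.log_pos one_lt_two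
  have h1 : Real.log (1 + x) ≤ 2 * √x := by
    have h3 : Real.log (1 + x) ≤ Real.log ((1 + √x) ^ 2) := by
      refine Real.log_le_log (by linarith) ?_
      nlinarith [Real.sq_sqrt hx, Real.sqrt_nonneg x]
    have h4 : Real.log (1 + √x) ≤ √x := by
      have := Real.log_le_sub_one_of_pos (show 0 < 1 + √x by positivity)
      linarith
    rw [Real.log_pow] at h3
    push_cast at h3
    linarith
  have h0 : 0 ≤ Real.log (1 + x) := Real.log_nonneg (by linarith)
  rw [cap, Real.logb, div_pow, div_mul_eq_mul_div]
  gcongr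
  calc Real.log (1 + x) ^ 2 ≤ (2 * √x) ^ 2 := by gcongr
    _ = 4 * x := by rw [mul_pow, Real.sq_sqrt hx]; ring

lemma measurable_cap : Measurable cap := by
  unfold cap Real.logb
  fun_prop

lemma measurable_C1r (θ : Params) : Measurable (C1r θ) :=
  measurable_cap.comp (measurable_fst.const_mul _)
lemma measurable_C2r (θ : Params) : Measurable (C2r θ) :=
  measurable_cap.comp (measurable_snd.const_mul _)
lemma measurable_Cr (θ : Params) : Measurable (Cr θ) :=
  measurable_cap.comp ((measurable_fst.const_mul _).add (measurable_snd.const_mul _))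
lemma measurable_Cr1 (θ : Params) : Measurable (Cr1 θ) :=
  measurable_cap.comp (measurable_fst.const_mul _)
lemma measurable_Cr2 (θ : Params) : Measurable (Cr2 θ) :=
  measurable_cap.comp (measurable_snd.const_mul _)
lemma measurable_C12r (θ : Params) (t : ℝ) : Measurable (C12r θ t) := by
  refine (Measurable.const_mul ?_ _).add (Measurable.const_mul ?_ _)
  · exact measurable_C1r θ
  · refine measurable_cap.comp (Measurable.div ?_ ?_) <;> fun_prop
lemma measurable_C21r (θ : Params) (t : ℝ) : Measurable (C21r θ t) := by
  refine (Measurable.const_mul ?_ _).add (Measurable.const_mul ?_ _)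
  · exact measurable_C2r θ
  · refine measurable_cap.comp (Measurable.div ?_ ?_) <;> fun_prop

/-! ### Capacities at a fixed channel state -/

section Pointwise

variable {θ : Params} (hθ : θ.Valid) {s : State}

lemma C12r_one (θ : Params) (s : State) : C12r θ 1 s = C1r θ s := by simp [C12r, C1r]
lemma C21r_zero (θ : Params) (s : State) : C21r θ 0 s = C2r θ s := by simp [C21r, C2r]

/-- Logarithm of `1 + x + y = (1 + y) * (1 + x / (1 + y))`: the rate of the user decoded first is
the sum capacity minus the capacity of the other user. -/
lemma cap_div_sub {x y : ℝ} (hx : 0 ≤ x) (hy : 0 ≤ y) :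
    cap (x / (1 + y)) = cap (x + y) - cap y := by
  have h1 : (0 : ℝ) < 1 + y := by linarith
  have h2 : (0 : ℝ) < 1 + (x + y) := by linarith
  unfold cap
  rw [← Real.logb_div h2.ne' h1.ne']
  congr 1
  field_simp
  ring

include hθ

lemma C12r_zero (hs : 0 < s.1 ∧ 0 < s.2) : C12r θ 0 s = Cr θ s - C2r θ s := by
  have h1 := hθ.P₁
  have h2 := hθ.P₂
  have h3 := hs.1
  have h4 := hs.2
  simp only [C12r, Cr, C2r, zero_mul, zero_add, sub_zero, one_mul]
  exact cap_div_sub (by positivity) (by positivity)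

lemma C21r_one (hs : 0 < s.1 ∧ 0 < s.2) : C21r θ 1 s = Cr θ s - C1r θ s := by
  have h1 := hθ.P₁
  have h2 := hθ.P₂
  have h3 := hs.1
  have h4 := hs.2
  simp only [C21r, Cr, C1r, one_mul, sub_self, zero_mul, zero_add]
  rw [cap_div_sub (by positivity) (by positivity), add_comm (θ.P₂ * s.2)]

lemma C1r_pos (hs : 0 < s.1 ∧ 0 < s.2) : 0 < C1r θ s := cap_pos (mul_pos hθ.P₁ hs.1)
lemma C2r_pos (hs : 0 < s.1 ∧ 0 < s.2) : 0 < C2r θ s := cap_pos (mul_pos hθ.P₂ hs.2)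
lemma Cr1_pos (hs : 0 < s.1 ∧ 0 < s.2) : 0 < Cr1 θ s := cap_pos (mul_pos hθ.Pᵣ hs.1)
lemma Cr2_pos (hs : 0 < s.1 ∧ 0 < s.2) : 0 < Cr2 θ s := cap_pos (mul_pos hθ.Pᵣ hs.2)
lemma C1r_lt_Cr (hs : 0 < s.1 ∧ 0 < s.2) : C1r θ s < Cr θ s := by
  have h1 := mul_pos hθ.P₁ hs.1
  have h2 := mul_pos hθ.P₂ hs.2
  exact cap_lt h1.le (by linarith)
lemma C2r_lt_Cr (hs : 0 < s.1 ∧ 0 < s.2) : C2r θ s < Cr θ s := by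
  have h1 := mul_pos hθ.P₁ hs.1
  have h2 := mul_pos hθ.P₂ hs.2
  exact cap_lt h2.le (by linarith)
lemma Cr_lt (hs : 0 < s.1 ∧ 0 < s.2) : Cr θ s < C1r θ s + C2r θ s := by
  have h1 := mul_pos hθ.P₁ hs.1
  have h2 := mul_pos hθ.P₂ hs.2
  have h3 := cap_div_sub h1.le h2.le
  have h4 : cap (θ.P₁ * s.1 / (1 + θ.P₂ * s.2)) < cap (θ.P₁ * s.1) := by
    refine cap_lt (by positivity) ?_
    rw [div_lt_iff₀ (by positivity)]
    nlinarith
  unfold Cr C1r C2r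
  linarith

end Pointwise

/-! ### Square integrability of the capacities -/

section Integrability

variable {θ : Params} {m : Measure State}

lemma memLp_of_le_cap {f x : State → ℝ} (hf : Measurable f) {c : ℝ} (hc : 0 ≤ c)
    (hx : Integrable x m) (hx0 : ∀ᵐ s ∂m, 0 ≤ x s)
    (hfx : ∀ᵐ s ∂m, 0 ≤ f s ∧ f s ≤ cap (c * x s)) : MemLp f 2 m := by
  rw [memLp_two_iff_integrable_sq hf.aestronglyMeasurable]
  refine (hx.const_mul (4 / Real.log 2 ^ 2 * c)).mono' (hf.pow_const 2).aestronglyMeasurable ?_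
  filter_upwards [hx0, hfx] with s h1 h2
  rw [Real.norm_eq_abs, abs_of_nonneg (sq_nonneg _)]
  calc f s ^ 2 ≤ cap (c * x s) ^ 2 := by gcongr; exacts [h2.1, h2.2]
    _ ≤ 4 / Real.log 2 ^ 2 * (c * x s) := cap_sq_le (mul_nonneg hc h1)
    _ = _ := by ring

variable (hθ : θ.Valid) (hm : IsSlotLaw m)
include hθ hm

lemma memLp_C1r : MemLp (C1r θ) 2 m :=
  memLp_of_le_cap (measurable_C1r θ) hθ.P₁.le hm.mean₁ (hm.pos.mono fun _ h => h.1.le)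
    (hm.pos.mono fun _ h => ⟨(C1r_pos hθ h).le, le_rfl⟩)
lemma memLp_C2r : MemLp (C2r θ) 2 m :=
  memLp_of_le_cap (measurable_C2r θ) hθ.P₂.le hm.mean₂ (hm.pos.mono fun _ h => h.2.le)
    (hm.pos.mono fun _ h => ⟨(C2r_pos hθ h).le, le_rfl⟩)
lemma memLp_Cr1 : MemLp (Cr1 θ) 2 m :=
  memLp_of_le_cap (measurable_Cr1 θ) hθ.Pᵣ.le hm.mean₁ (hm.pos.mono fun _ h => h.1.le)
    (hm.pos.mono fun _ h => ⟨(Cr1_pos hθ h).le, le_rfl⟩)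
lemma memLp_Cr2 : MemLp (Cr2 θ) 2 m :=
  memLp_of_le_cap (measurable_Cr2 θ) hθ.Pᵣ.le hm.mean₂ (hm.pos.mono fun _ h => h.2.le)
    (hm.pos.mono fun _ h => ⟨(Cr2_pos hθ h).le, le_rfl⟩)
lemma memLp_C12r_zero : MemLp (C12r θ 0) 2 m :=
  memLp_of_le_cap (measurable_C12r θ 0) hθ.P₁.le hm.mean₁ (hm.pos.mono fun _ h => h.1.le)
    (hm.pos.mono fun s h => by
      have h1 := C2r_lt_Cr hθ h
      have h2 := Cr_lt hθ h
      rw [C12r_zero hθ h]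
      change _ ∧ _ ≤ C1r θ s
      constructor <;> linarith)
lemma memLp_C21r_one : MemLp (C21r θ 1) 2 m :=
  memLp_of_le_cap (measurable_C21r θ 1) hθ.P₂.le hm.mean₂ (hm.pos.mono fun _ h => h.2.le)
    (hm.pos.mono fun s h => by
      have h1 := C1r_lt_Cr hθ h
      have h2 := Cr_lt hθ h
      rw [C21r_one hθ h]
      change _ ∧ _ ≤ C2r θ s
      constructor <;> linarith)
lemma integrable_C1r : Integrable (C1r θ) m :=
  have := hm.prob; (memLp_C1r hθ hm).integrable (by norm_num)
lemma integrable_C2r : Integrable (C2r θ) m :=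
  have := hm.prob; (memLp_C2r hθ hm).integrable (by norm_num)
lemma integrable_Cr1 : Integrable (Cr1 θ) m :=
  have := hm.prob; (memLp_Cr1 hθ hm).integrable (by norm_num)
lemma integrable_Cr2 : Integrable (Cr2 θ) m :=
  have := hm.prob; (memLp_Cr2 hθ hm).integrable (by norm_num)
lemma integrable_Cr : Integrable (Cr θ) m :=
  have := hm.prob
  (((memLp_C12r_zero hθ hm).add (memLp_C2r hθ hm)).integrable (by norm_num)).congr
    (hm.pos.mono fun s h => by simp [C12r_zero hθ h])

end Integrability

/-- The seven pure options: modes 1 and 2, mode 3 with the two decoding orders, modes 4, 5, 6. -/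
abbrev Opt := Fin 7

/-- The rates `R₁ᵣ, R₂ᵣ, Rᵣ₁, Rᵣ₂` of an option. -/
def optRate (θ : Params) (k : Opt) (j : Fin 4) (s : State) : ℝ :=
  ![![C1r θ s, 0, 0, 0], ![0, C2r θ s, 0, 0], ![C12r θ 0 s, C21r θ 0 s, 0, 0],
    ![C12r θ 1 s, C21r θ 1 s, 0, 0], ![0, 0, Cr1 θ s, 0], ![0, 0, 0, Cr2 θ s],
    ![0, 0, Cr1 θ s, Cr2 θ s]] k j

lemma C12r_one_eq (θ : Params) : C12r θ 1 = C1r θ := funext fun s => C12r_one θ s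
lemma C21r_zero_eq (θ : Params) : C21r θ 0 = C2r θ := funext fun s => C21r_zero θ s

/-- All 28 entries come from seven functions, because the user decoded last in mode 3 has its
interference-free capacity. -/
lemma optRate_induction {θ : Params} {p : (State → ℝ) → Prop} (h0 : p fun _ => 0)
    (h1 : p (C1r θ)) (h2 : p (C2r θ)) (h3 : p (C12r θ 0)) (h4 : p (C21r θ 1)) (h5 : p (Cr1 θ))
    (h6 : p (Cr2 θ)) (k : Opt) (j : Fin 4) : p (optRate θ k j) := by
  have h12 := (C12r_one_eq θ).symm ▸ h1
  have h21 := (C21r_zero_eq θ).symm ▸ h2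
  fin_cases k <;> fin_cases j
  exacts [h1, h0, h0, h0, h0, h2, h0, h0, h3, h21, h0, h0, h12, h4, h0, h0, h0, h0, h5, h0,
    h0, h0, h0, h6, h0, h0, h5, h6]

lemma measurable_optRate (θ : Params) (k : Opt) (j : Fin 4) : Measurable (optRate θ k j) :=
  optRate_induction measurable_const (measurable_C1r θ) (measurable_C2r θ) (measurable_C12r θ 0)
    (measurable_C21r θ 1) (measurable_Cr1 θ) (measurable_Cr2 θ) k j

lemma memLp_optRate {θ : Params} (hθ : θ.Valid) {m : Measure State} (hm : IsSlotLaw m)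
    (k : Opt) (j : Fin 4) : MemLp (optRate θ k j) 2 m :=
  optRate_induction (p := fun f => MemLp f 2 m) MemLp.zero' (memLp_C1r hθ hm) (memLp_C2r hθ hm)
    (memLp_C12r_zero hθ hm) (memLp_C21r_one hθ hm) (memLp_Cr1 hθ hm) (memLp_Cr2 hθ hm) k j

lemma integrable_optRate {θ : Params} (hθ : θ.Valid) {m : Measure State} (hm : IsSlotLaw m)
    (k : Opt) (j : Fin 4) : Integrable (optRate θ k j) m :=
  have := hm.prob
  (memLp_optRate hθ hm k j).integrable (by norm_num)

/-! ### Slots of a stationary ergodic channel -/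

/-- The law of the channel state in one slot. -/
def slotLaw (ν : Measure (ℕ → State)) : Measure State := ν.map fun s => s 0

section Channel

variable {ν : Measure (ℕ → State)} (hν : IsChannel ν)
include hν

lemma IsChannel.ergodic_shift : Ergodic (shift (X := State)) ν := hν.ergodic

lemma measurePreserving_slot (i : ℕ) :
    MeasurePreserving (fun s : ℕ → State => s i) ν (slotLaw ν) := by
  have h0 : MeasurePreserving (fun s : ℕ → State => s 0) ν (slotLaw ν) :=
    ⟨measurable_pi_apply 0, rfl⟩
  have h1 := h0.comp (hν.ergodic_shift.toMeasurePreserving.iterate i)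
  convert h1 using 1
  funext s
  simp [shift_iterate]

lemma isSlotLaw : IsSlotLaw (slotLaw ν) := by
  have hp := hν.prob
  have h0 := measurePreserving_slot hν 0
  have hac : slotLaw ν ≪ (volume : Measure State) := hν.density
  refine ⟨Measure.isProbabilityMeasure_map (measurable_pi_apply 0).aemeasurable, ?_, ?_, ?_, hac⟩
  · have hnn : ∀ᵐ s ∂(slotLaw ν), 0 ≤ s.1 ∧ 0 ≤ s.2 := by
      refine (ae_map_iff (measurable_pi_apply 0).aemeasurable ?_).2 hν.nonneg
      exact (measurableSet_le measurable_const measurable_fst).inter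
        (measurableSet_le measurable_const measurable_snd)
    -- The coordinate axes are Lebesgue null, so a channel with a density has strictly positive
    -- gains almost surely.
    have e1 : ∀ᵐ s : State, s.1 ≠ 0 := by
      have h : (volume : Measure State) (({0} : Set ℝ) ×ˢ Set.univ) = 0 := by
        rw [Measure.volume_eq_prod, Measure.prod_prod]; simp
      filter_upwards [measure_eq_zero_iff_ae_notMem.1 h] with s hs h0
      exact hs ⟨h0, trivial⟩
    have e2 : ∀ᵐ s : State, s.2 ≠ 0 := by
      have h : (volume : Measure State) ((Set.univ : Set ℝ) ×ˢ ({0} : Set ℝ)) = 0 := by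
        rw [Measure.volume_eq_prod, Measure.prod_prod]; simp
      filter_upwards [measure_eq_zero_iff_ae_notMem.1 h] with s hs h0
      exact hs ⟨trivial, h0⟩
    filter_upwards [hnn, hac.ae_le e1, hac.ae_le e2] with s h h1 h2
    exact ⟨lt_of_le_of_ne h.1 (Ne.symm h1), lt_of_le_of_ne h.2 (Ne.symm h2)⟩
  · exact (h0.integrable_comp measurable_fst.aestronglyMeasurable).1 hν.mean₁
  · exact (h0.integrable_comp measurable_snd.aestronglyMeasurable).1 hν.mean₂

lemma ae_forall_slot {p : State → Prop} (h : ∀ᵐ x ∂(slotLaw ν), p x) :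
    ∀ᵐ s ∂ν, ∀ i, p (s i) :=
  ae_all_iff.2 fun i => (measurePreserving_slot hν i).quasiMeasurePreserving.ae h

lemma ae_hasAverage_slot {f : State → ℝ} (hf : Measurable f) (hfi : Integrable f (slotLaw ν)) :
    ∀ᵐ s ∂ν, HasAverage (fun i => f (s i)) (∫ x, f x ∂(slotLaw ν)) := by
  have := hν.prob
  have h0 := measurePreserving_slot hν 0
  have h1 := ae_tendsto_birkhoffSum_div hν.ergodic_shift (hf.comp (measurable_pi_apply 0))
    (h0.integrable_comp_of_integrable hfi)
  have h2 : ∫ s, (f ∘ fun s : ℕ → State => s 0) s ∂ν = ∫ x, f x ∂(slotLaw ν) := by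
    rw [slotLaw, integral_map (measurable_pi_apply 0).aemeasurable hf.aestronglyMeasurable]
    rfl
  rw [h2] at h1
  filter_upwards [h1] with s hs
  refine hs.congr fun n => ?_
  simp [birkhoffSum, shift_iterate]

end Channel

/-! ### Time averages -/

lemma HasAverage.unique {x : ℕ → ℝ} {r r' : ℝ} (h : HasAverage x r) (h' : HasAverage x r') :
    r = r' := tendsto_nhds_unique h h'

lemma HasAverage.const_mul {x : ℕ → ℝ} {r : ℝ} (c : ℝ) (h : HasAverage x r) :
    HasAverage (fun i => c * x i) (c * r) := by
  refine (Tendsto.const_mul c h).congr fun n => ?_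
  rw [← mul_sum, mul_div_assoc]

lemma HasAverage.sum {ι : Type*} {J : Finset ι} {x : ι → ℕ → ℝ} {r : ι → ℝ}
    (h : ∀ j ∈ J, HasAverage (x j) (r j)) :
    HasAverage (fun i => ∑ j ∈ J, x j i) (∑ j ∈ J, r j) := by
  refine (tendsto_finsetSum J h).congr fun n => ?_
  rw [sum_comm, sum_div]

lemma HasAverage.mono {x y : ℕ → ℝ} {r r' : ℝ} (h : HasAverage x r) (h' : HasAverage y r')
    (hxy : ∀ i, x i ≤ y i) : r ≤ r' :=
  le_of_tendsto_of_tendsto' h h' fun n =>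
    div_le_div_of_nonneg_right (sum_le_sum fun i _ => hxy i) n.cast_nonneg

lemma HasAverage.congr {x y : ℕ → ℝ} {r : ℝ} (h : HasAverage x r) (hxy : ∀ i, x i = y i) :
    HasAverage y r := (funext hxy : x = y) ▸ h

/-! ### Slot policies as mixtures of the options -/

/-- The coefficients of the rates in the Lagrangian. -/
def coef (θ : Params) (μ₁ μ₂ : ℝ) : Fin 4 → ℝ := ![θ.η - μ₁, 1 - θ.η - μ₂, μ₂, μ₁]

/-- The selection metric of an option. -/
def optVal (θ : Params) (μ₁ μ₂ : ℝ) (k : Opt) (s : State) : ℝ :=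
  ∑ j, coef θ μ₁ μ₂ j * optRate θ k j s

/-- The weights of the options in a slot. -/
def share (q : Fin 6 → ℝ) (t : ℝ) : Opt → ℝ :=
  ![q M1, q M2, q M3 * (1 - t), q M3 * t, q M4, q M5, q M6]

/-- The mode shares that belong to a mixture of the options. -/
def modeShare (w : Opt → ℝ) : Fin 6 → ℝ := ![w 0, w 1, w 2 + w 3, w 4, w 5, w 6]

/-- The decoding order variable that belongs to a mixture of the options. -/
def modeOrder (w : Opt → ℝ) : ℝ := w 3 / (w 2 + w 3)

lemma share_nonneg {q : Fin 6 → ℝ} {t : ℝ} (hq : ∀ k, 0 ≤ q k) (ht : 0 ≤ t ∧ t ≤ 1) (k : Opt) :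
    0 ≤ share q t k := by
  have h1 : 0 ≤ q M3 * (1 - t) := mul_nonneg (hq _) (by linarith [ht.2])
  have h2 : 0 ≤ q M3 * t := mul_nonneg (hq _) ht.1
  fin_cases k
  exacts [hq _, hq _, h1, h2, hq _, hq _, hq _]

lemma sum_share (q : Fin 6 → ℝ) (t : ℝ) : ∑ k, share q t k = ∑ k, q k := by
  simp only [share, Fin.sum_univ_succ, Fin.sum_univ_zero]
  simp [Fin.succ]
  ring

lemma sum_modeShare (w : Opt → ℝ) : ∑ k, modeShare w k = ∑ k, w k := by
  simp only [modeShare, Fin.sum_univ_succ, Fin.sum_univ_zero]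
  simp [Fin.succ]
  ring

/-- If mode 3 is unused, the decoding order is the quotient 0 / 0 = 0, which is harmless as both
shares vanish. -/
lemma share_modeShare {w : Opt → ℝ} (hw : ∀ k, 0 ≤ w k) :
    share (modeShare w) (modeOrder w) = w := by
  have h2 := hw 2
  have h3 := hw 3
  have e1 : (w 2 + w 3) * (w 3 / (w 2 + w 3)) = w 3 := by
    by_cases h : w 2 + w 3 = 0
    · have : w 3 = 0 := by linarith
      rw [h, this]; simp
    · field_simp
  have e2 : (w 2 + w 3) * (1 - w 3 / (w 2 + w 3)) = w 2 := by
    rw [mul_sub, e1]; ring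
  funext k
  fin_cases k
  exacts [rfl, rfl, e2, e1, rfl, rfl, rfl]

lemma modeOrder_mem {w : Opt → ℝ} (hw : ∀ k, 0 ≤ w k) : 0 ≤ modeOrder w ∧ modeOrder w ≤ 1 := by
  have h2 := hw 2
  have h3 := hw 3
  exact ⟨div_nonneg h3 (by linarith), div_le_one_of_le₀ (by linarith) (by linarith)⟩

lemma modeShare_nonneg {w : Opt → ℝ} (hw : ∀ k, 0 ≤ w k) (k : Fin 6) : 0 ≤ modeShare w k := by
  fin_cases k
  exacts [hw _, hw _, add_nonneg (hw _) (hw _), hw _, hw _, hw _]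

lemma C12r_affine (θ : Params) (t : ℝ) (s : State) :
    C12r θ t s = (1 - t) * C12r θ 0 s + t * C12r θ 1 s := by
  simp only [C12r]; ring

lemma C21r_affine (θ : Params) (t : ℝ) (s : State) :
    C21r θ t s = (1 - t) * C21r θ 0 s + t * C21r θ 1 s := by
  simp only [C21r]; ring

lemma sum_opt (f : Opt → ℝ) : ∑ k, f k = f 0 + f 1 + f 2 + f 3 + f 4 + f 5 + f 6 :=
  Fin.sum_univ_seven f

/-- The four rates in a slot. -/
def slotRate (θ : Params) (q : Fin 6 → ℝ) (t : ℝ) (s : State) : Fin 4 → ℝ :=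
  ![rate1r θ q t s, rate2r θ q t s, rater1 θ q s, rater2 θ q s]

/-- Since the rates of mode 3 are affine in `t`, a fractional decoding order amounts to time sharing
between the two extreme ones. -/
lemma slotRate_eq (θ : Params) (q : Fin 6 → ℝ) (t : ℝ) (s : State) (j : Fin 4) :
    slotRate θ q t s j = ∑ k, share q t k * optRate θ k j s := by
  rw [sum_opt]
  fin_cases j <;> simp [slotRate, share, optRate, rate1r, rate2r, rater1, rater2]
  · rw [C12r_affine θ t s]; ring
  · rw [C21r_affine θ t s]; ring
  · ring
  · ring

lemma hasRates_iff {θ : Params} {s : ℕ → State} {q : ℕ → Fin 6 → ℝ} {t : ℕ → ℝ}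
    {R : Fin 4 → ℝ} : HasRates θ s q t (R 0) (R 1) (R 2) (R 3) ↔
      ∀ j, HasAverage (fun i => slotRate θ (q i) (t i) (s i) j) (R j) := by
  constructor
  · rintro ⟨h0, h1, h2, h3⟩ j
    fin_cases j
    exacts [h0, h1, h2, h3]
  · exact fun h => ⟨h 0, h 1, h 2, h 3⟩

section Metric

variable (θ : Params) (μ₁ μ₂ t : ℝ) (s : State)

lemma metric_M1 : metric θ μ₁ μ₂ t s M1 = (θ.η - μ₁) * C1r θ s := rfl
lemma metric_M2 : metric θ μ₁ μ₂ t s M2 = (1 - θ.η - μ₂) * C2r θ s := rfl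
lemma metric_M3 : metric θ μ₁ μ₂ t s M3 =
    (θ.η - μ₁) * C12r θ t s + (1 - θ.η - μ₂) * C21r θ t s := rfl
lemma metric_M4 : metric θ μ₁ μ₂ t s M4 = μ₂ * Cr1 θ s := rfl
lemma metric_M5 : metric θ μ₁ μ₂ t s M5 = μ₁ * Cr2 θ s := rfl
lemma metric_M6 : metric θ μ₁ μ₂ t s M6 = μ₁ * Cr2 θ s + μ₂ * Cr1 θ s := rfl

end Metric

lemma optVal_eq (θ : Params) (μ₁ μ₂ : ℝ) (k : Opt) (s : State) : optVal θ μ₁ μ₂ k s =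
    ![metric θ μ₁ μ₂ 0 s M1, metric θ μ₁ μ₂ 0 s M2, metric θ μ₁ μ₂ 0 s M3, metric θ μ₁ μ₂ 1 s M3,
      metric θ μ₁ μ₂ 0 s M4, metric θ μ₁ μ₂ 0 s M5, metric θ μ₁ μ₂ 0 s M6] k := by
  rw [metric_M1, metric_M2, metric_M3, metric_M3, metric_M4, metric_M5, metric_M6]
  fin_cases k <;> simp [optVal, coef, optRate, Fin.sum_univ_four, add_comm]

lemma sum_share_mul_optVal (θ : Params) (μ₁ μ₂ : ℝ) (q : Fin 6 → ℝ) (t : ℝ) (s : State) :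
    ∑ k, share q t k * optVal θ μ₁ μ₂ k s = ∑ j, q j * metric θ μ₁ μ₂ t s j := by
  simp only [optVal_eq]
  rw [sum_opt, Fin.sum_univ_six]
  have h12 := C12r_affine θ t s
  have h21 := C21r_affine θ t s
  simp only [metric_M1, metric_M2, metric_M3, metric_M4, metric_M5, metric_M6, h12, h21]
  simp only [share, Matrix.cons_val]
  ring

lemma metric_eq_sum (θ : Params) (μ₁ μ₂ t : ℝ) (s : State) (k : Fin 6) :
    metric θ μ₁ μ₂ t s k = ∑ l, share (Pi.single k 1) t l * optVal θ μ₁ μ₂ l s := by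
  rw [sum_share_mul_optVal]
  simp [Pi.single_apply]

/-- A single mode with decoding order `t` is itself a mixture of options, so fractional orders never
beat the pure options. -/
lemma metric_le_maxVal (θ : Params) (μ₁ μ₂ : ℝ) {t : ℝ} (ht : 0 ≤ t ∧ t ≤ 1) (s : State)
    (k : Fin 6) : metric θ μ₁ μ₂ t s k ≤ maxVal fun l => optVal θ μ₁ μ₂ l s := by
  rw [metric_eq_sum]
  refine sum_mul_le_maxVal (share_nonneg (fun j => ?_) ht) ?_
  · simp only [Pi.single_apply]; split_ifs <;> norm_num
  · rw [sum_share]; simp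

/-- The expected rates of a stationary policy. -/
def expRate (m : Measure State) (θ : Params) (w : Opt → State → ℝ) (j : Fin 4) : ℝ :=
  ∫ s, ∑ k, w k s * optRate θ k j s ∂m

/-- The optimal value of the Lagrangian. -/
def dualVal (m : Measure State) (θ : Params) (μ₁ μ₂ : ℝ) : ℝ :=
  ∫ s, maxVal (fun k => optVal θ μ₁ μ₂ k s) ∂m

/-- The stationary policy `w` satisfies C1 and C2 in the mean. -/
def Balanced (m : Measure State) (θ : Params) (w : Opt → State → ℝ) : Prop :=
  expRate m θ w 0 = expRate m θ w 3 ∧ expRate m θ w 1 = expRate m θ w 2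

/-- The stationary policy `w` maximizes the Lagrangian. -/
def Maximizes (m : Measure State) (θ : Params) (μ₁ μ₂ : ℝ) (w : Opt → State → ℝ) : Prop :=
  ∀ᵐ s ∂m, ∑ k, w k s * optVal θ μ₁ μ₂ k s = maxVal fun k => optVal θ μ₁ μ₂ k s

/-! ### Lagrangian duality for stationary policies -/

section Lagrangian

variable {θ : Params} (hθ : θ.Valid) {m : Measure State} (hm : IsSlotLaw m)

/-- The multiplier terms cancel under C1 and C2; hence balanced rate vectors have a Lagrangian value
independent of the weights. -/
lemma sum_coef_of_eq {R : Fin 4 → ℝ} (h1 : R 0 = R 3) (h2 : R 1 = R 2) (μ₁ μ₂ : ℝ) :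
    ∑ j, coef θ μ₁ μ₂ j * R j = θ.η * R 0 + (1 - θ.η) * R 1 := by
  rw [Fin.sum_univ_four]
  simp [coef, ← h1, ← h2]
  ring

lemma achievable_expRate {w : Opt → State → ℝ} (hw : IsPolicy w) :
    expRate m θ w ∈ achievable m (optRate θ) := ⟨w, hw, fun _ => rfl⟩

lemma measurable_combination (θ : Params) (c : Fin 4 → ℝ) (k : Opt) :
    Measurable fun s => ∑ j, c j * optRate θ k j s :=
  Finset.measurable_sum _ fun j _ => (measurable_optRate θ k j).const_mul (c j)

lemma measurable_optVal (θ : Params) (μ₁ μ₂ : ℝ) (k : Opt) : Measurable (optVal θ μ₁ μ₂ k) :=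
  measurable_combination θ _ k

include hθ hm

lemma integrable_combination (c : Fin 4 → ℝ) (k : Opt) :
    Integrable (fun s => ∑ j, c j * optRate θ k j s) m :=
  integrable_finsetSum _ fun j _ => (integrable_optRate hθ hm k j).const_mul (c j)

lemma integrable_optVal (μ₁ μ₂ : ℝ) (k : Opt) : Integrable (optVal θ μ₁ μ₂ k) m :=
  integrable_combination hθ hm _ k

lemma sum_coef_mul_expRate {w : Opt → State → ℝ} (hw : IsPolicy w) (c : Fin 4 → ℝ) :
    ∑ j, c j * expRate m θ w j = ∫ s, ∑ k, w k s * ∑ j, c j * optRate θ k j s ∂m := by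
  simp only [expRate, ← integral_const_mul]
  rw [← integral_finsetSum _ fun j _ =>
    (hw.integrable_sum fun k => integrable_optRate hθ hm k j).const_mul (c j)]
  refine integral_congr_ae (Eventually.of_forall fun s => ?_)
  simp only [mul_sum]
  rw [sum_comm]
  exact sum_congr rfl fun k _ => sum_congr rfl fun j _ => by ring

lemma sum_coef_mul_expRate_le {w : Opt → State → ℝ} (hw : IsPolicy w) (μ₁ μ₂ : ℝ) :
    ∑ j, coef θ μ₁ μ₂ j * expRate m θ w j ≤ dualVal m θ μ₁ μ₂ := by
  rw [sum_coef_mul_expRate hθ hm hw]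
  exact integral_mono (hw.integrable_sum (integrable_optVal hθ hm μ₁ μ₂))
    (integrable_maxVal (integrable_optVal hθ hm μ₁ μ₂))
    fun s => sum_mul_le_maxVal (fun k => hw.nonneg k s) (hw.sum_eq s)

/-- Equality in weak duality: the policy's Lagrangian is pointwise at most the maximum, so equal
integrals mean equality almost everywhere. -/
lemma maximizes_iff {w : Opt → State → ℝ} (hw : IsPolicy w) (μ₁ μ₂ : ℝ) :
    Maximizes m θ μ₁ μ₂ w ↔ ∑ j, coef θ μ₁ μ₂ j * expRate m θ w j = dualVal m θ μ₁ μ₂ := by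
  rw [sum_coef_mul_expRate hθ hm hw, dualVal]
  exact (integral_eq_iff_of_ae_le (hw.integrable_sum (integrable_optVal hθ hm μ₁ μ₂))
    (integrable_maxVal (integrable_optVal hθ hm μ₁ μ₂))
    (Eventually.of_forall fun s => sum_mul_le_maxVal (fun k => hw.nonneg k s)
      (hw.sum_eq s))).symm

/-- A balanced policy that maximizes the Lagrangian for some weights does so for all weights for
which there is such a policy. -/
lemma Balanced.maximizes {w w' : Opt → State → ℝ} {μ₁ μ₂ μ₁' μ₂' : ℝ} (hw : IsPolicy w)
    (hw' : IsPolicy w') (hb : Balanced m θ w) (hb' : Balanced m θ w')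
    (h : Maximizes m θ μ₁ μ₂ w) (h' : Maximizes m θ μ₁' μ₂' w') :
    Maximizes m θ μ₁' μ₂' w := by
  rw [maximizes_iff hθ hm hw] at h ⊢
  rw [maximizes_iff hθ hm hw'] at h'
  -- The bound attained by `w'` is its objective value, which is also its Lagrangian for the first
  -- weights and is therefore at most that of `w`; the latter is again just the objective value of
  -- `w`.
  refine le_antisymm (sum_coef_mul_expRate_le hθ hm hw _ _) ?_
  rw [← h', sum_coef_of_eq hb'.1 hb'.2, ← sum_coef_of_eq hb'.1 hb'.2 μ₁ μ₂,
    sum_coef_of_eq hb.1 hb.2, ← sum_coef_of_eq hb.1 hb.2 μ₁ μ₂, h]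
  exact sum_coef_mul_expRate_le hθ hm hw' _ _

/-- Balanced maximizing policies exist for suitable weights. -/
lemma exists_balanced_maximizes :
    ∃ (μ₁ μ₂ : ℝ) (w : Opt → State → ℝ), IsPolicy w ∧ Balanced m θ w ∧
      Maximizes m θ μ₁ μ₂ w := by
  have := hm.prob
  have hpure : ∀ k : Opt, IsPolicy (fun (l : Opt) (_ : State) => if l = k then (1 : ℝ) else 0) :=
    fun k => ⟨fun l => measurable_const, fun l s => by split_ifs <;> norm_num, fun s => by simp⟩
  have hmem : ∀ k : Opt, (fun j => ∫ s, optRate θ k j s ∂m) ∈ achievable m (optRate θ) :=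
    fun k => ⟨_, hpure k, fun j => by simp⟩
  have hpos : ∀ f : State → ℝ, Integrable f m → (∀ s : State, 0 < s.1 ∧ 0 < s.2 → 0 < f s) →
      0 < ∫ s, f s ∂m := fun f hf h => by
    rw [integral_pos_iff_support_of_nonneg_ae (hm.pos.mono fun s hs => (h s hs).le) hf]
    have : ∀ᵐ s ∂m, s ∈ Function.support f := hm.pos.mono fun s hs => (h s hs).ne'
    have h1 : m (Function.support f) = m Set.univ := measure_congr (eventuallyEq_univ.2 this)
    rw [h1]
    simp
  let e : Fin 4 → (Fin 4 → ℝ) →L[ℝ] ℝ := fun j => ContinuousLinearMap.proj j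
  have i1 := hpos _ (integrable_C1r hθ hm) fun s hs => C1r_pos hθ hs
  have i2 := hpos _ (integrable_C2r hθ hm) fun s hs => C2r_pos hθ hs
  have i3 := hpos _ (integrable_Cr1 hθ hm) fun s hs => Cr1_pos hθ hs
  have i4 := hpos _ (integrable_Cr2 hθ hm) fun s hs => Cr2_pos hθ hs
  -- Using only option 0, 5, 1 or 4 violates exactly one of C1, C2, in each of the two directions;
  -- these are the test points for the multipliers.
  obtain ⟨μ₁, μ₂, r, ⟨w, hw, hr⟩, hg1, hg2, hmax⟩ := exists_lagrange_multipliers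
    (convex_achievable fun k j => integrable_optRate hθ hm k j)
    (isCompact_achievable fun k j => memLp_optRate hθ hm k j)
    (θ.η • e 0 + (1 - θ.η) • e 1) (e 0 - e 3) (e 1 - e 2)
    (hmem 0) (hmem 5) (hmem 1) (hmem 4)
    (by simpa [e, optRate] using i1) (by simpa [e, optRate] using i4)
    (by simpa [e, optRate] using i2) (by simpa [e, optRate] using i3)
  have hre : r = expRate m θ w := funext hr
  subst hre
  have hb : Balanced m θ w := ⟨by simpa [e, sub_eq_zero] using hg1,
    by simpa [e, sub_eq_zero] using hg2⟩
  refine ⟨μ₁, μ₂, w, hw, hb, (maximizes_iff hθ hm hw _ _).2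
    (le_antisymm (sum_coef_mul_expRate_le hθ hm hw _ _) ?_)⟩
  obtain ⟨w', hw', hmax'⟩ := exists_policy_sum_eq_maxVal (measurable_optVal θ μ₁ μ₂)
  have h1 := (maximizes_iff hθ hm hw' μ₁ μ₂).1 (Eventually.of_forall hmax')
  have h2 := hmax _ (achievable_expRate hw')
  rw [← h1, sum_coef_of_eq hb.1 hb.2, Fin.sum_univ_four]
  simp [e, coef] at h2 ⊢
  linarith

end Lagrangian

/-! ### Optimal weights and stationary policies -/

section Realization

variable {θ : Params} {μ₁ μ₂ : ℝ} {s : ℕ → State} {q : ℕ → Fin 6 → ℝ} {t : ℕ → ℝ}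
  {R : Fin 4 → ℝ}

lemma hasAverage_share (h : HasRates θ s q t (R 0) (R 1) (R 2) (R 3)) (c : Fin 4 → ℝ) :
    HasAverage (fun i => ∑ k, share (q i) (t i) k * ∑ j, c j * optRate θ k j (s i))
      (∑ j, c j * R j) := by
  refine (HasAverage.sum (J := univ) fun j _ =>
    (hasRates_iff.1 h j).const_mul (c j)).congr fun i => ?_
  simp only [slotRate_eq, mul_sum]
  rw [sum_comm]
  exact sum_congr rfl fun k _ => sum_congr rfl fun j _ => by ring

/-- Weak duality along one realization. The bound holds slot by slot, so the sequences need no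
stationarity or measurability. -/
lemma rates_le_of_hasAverage {c : Fin 4 → ℝ} {D : ℝ}
    (hD : HasAverage (fun i => maxVal fun k => ∑ j, c j * optRate θ k j (s i)) D)
    (h : Feasible θ s q t (R 0) (R 1) (R 2) (R 3)) : ∑ j, c j * R j ≤ D :=
  (hasAverage_share h.rates c).mono hD fun i =>
    sum_mul_le_maxVal (share_nonneg (fun k => (h.C4 i k).1) (h.C5 i))
      ((sum_share _ _).trans (h.C3 i))

lemma isSolution_of_sum_coef_eq {D : ℝ}
    (hD : HasAverage (fun i => maxVal fun k => optVal θ μ₁ μ₂ k (s i)) D)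
    (h : Feasible θ s q t (R 0) (R 1) (R 2) (R 3)) (hR : ∑ j, coef θ μ₁ μ₂ j * R j = D) :
    IsSolution θ s q t := by
  refine ⟨R 0, R 1, R 2, R 3, h, fun q' t' a b c d h' => ?_⟩
  have h1 := rates_le_of_hasAverage (R := ![a, b, c, d]) hD h'
  rw [← hR, sum_coef_of_eq h.C1 h.C2, sum_coef_of_eq (by simpa using h'.C1)
    (by simpa using h'.C2)] at h1
  simpa using h1

end Realization

section Channel

variable {ν : Measure (ℕ → State)} (hν : IsChannel ν) {θ : Params} (hθ : θ.Valid)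
include hν hθ

lemma ae_hasAverage_maxVal (c : Fin 4 → ℝ) : ∀ᵐ s ∂ν,
    HasAverage (fun i => maxVal fun k => ∑ j, c j * optRate θ k j (s i))
      (∫ x, maxVal (fun k => ∑ j, c j * optRate θ k j x) ∂(slotLaw ν)) :=
  ae_hasAverage_slot hν (f := fun x => maxVal fun k => ∑ j, c j * optRate θ k j x)
    (measurable_maxVal (measurable_combination θ c))
    (integrable_maxVal (integrable_combination hθ (isSlotLaw hν) c))

/-- On almost every realization the ergodic theorem gives the stationary policy its mean rates, and
the slotwise maxima average to the dual value. As the two values agree, the policy attains the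
pathwise bound. -/
lemma optimalWeights_of_balanced {μ₁ μ₂ : ℝ} {w : Opt → State → ℝ} (hw : IsPolicy w)
    (hb : Balanced (slotLaw ν) θ w) (hmax : Maximizes (slotLaw ν) θ μ₁ μ₂ w) :
    OptimalWeights ν θ μ₁ μ₂ := by
  have hm := isSlotLaw hν
  have hR : ∀ j, ∀ᵐ s ∂ν, HasAverage (fun i => ∑ k, w k (s i) * optRate θ k j (s i))
      (expRate (slotLaw ν) θ w j) := fun j =>
    ae_hasAverage_slot hν
      (Finset.measurable_sum _ fun k _ => (hw.measurable k).mul (measurable_optRate θ k j))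
      (hw.integrable_sum fun k => integrable_optRate hθ hm k j)
  filter_upwards [ae_all_iff.2 hR, ae_hasAverage_maxVal hν hθ (coef θ μ₁ μ₂),
    ae_forall_slot hν hmax] with s hs hD hmx
  have hsh : ∀ i, share (modeShare fun k => w k (s i)) (modeOrder fun k => w k (s i))
      = fun k => w k (s i) := fun i => share_modeShare fun k => hw.nonneg k (s i)
  have hsum : ∀ i, ∑ k, modeShare (fun k => w k (s i)) k = 1 := fun i =>
    (sum_modeShare _).trans (hw.sum_eq _)
  have hnn : ∀ i k, 0 ≤ modeShare (fun k => w k (s i)) k := fun i k =>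
    modeShare_nonneg (fun k => hw.nonneg k (s i)) k
  refine ⟨fun i => modeShare fun k => w k (s i), fun i => modeOrder fun k => w k (s i),
    isSolution_of_sum_coef_eq (R := expRate (slotLaw ν) θ w) hD
      ⟨hasRates_iff.2 fun j => ?_, hb.1, hb.2, hsum, fun i k => ⟨hnn i k, ?_⟩,
        fun i => modeOrder_mem fun k => hw.nonneg k (s i)⟩
      ((maximizes_iff hθ hm hw _ _).1 hmax), fun i k t' h0 h1 => ?_⟩
  · simpa only [slotRate_eq, hsh] using hs j
  · rw [← hsum i]
    exact single_le_sum (fun k _ => hnn i k) (mem_univ k)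
  · rw [← sum_share_mul_optVal, hsh, hmx i]
    exact metric_le_maxVal θ μ₁ μ₂ ⟨h0, h1⟩ (s i) k

/-- The rates of an optimal realization are balanced and attain the dual value, but need not come
from a stationary policy. If no achievable vector had these properties, Hahn–Banach would give a
functional larger on such vectors than on all achievable ones. Along the realization, however, its
value is at most the mean of its slotwise maximum, and a stationary policy achieves that mean. -/
lemma exists_balanced_of_optimalWeights {μ₁ μ₂ : ℝ} (h : OptimalWeights ν θ μ₁ μ₂) :
    ∃ w : Opt → State → ℝ, IsPolicy w ∧ Balanced (slotLaw ν) θ w ∧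
      Maximizes (slotLaw ν) θ μ₁ μ₂ w := by
  have hm := isSlotLaw hν
  have := hm.prob
  have := hν.prob
  set m := slotLaw ν
  let T : Set (Fin 4 → ℝ) :=
    {r | r 0 = r 3 ∧ r 1 = r 2 ∧ ∑ j, coef θ μ₁ μ₂ j * r j = dualVal m θ μ₁ μ₂}
  suffices hne : (achievable m (optRate θ) ∩ T).Nonempty by
    obtain ⟨r, ⟨w, hw, hr⟩, h1, h2, h3⟩ := hne
    have hre : r = expRate m θ w := funext hr
    subst hre
    exact ⟨w, hw, ⟨h1, h2⟩, (maximizes_iff hθ hm hw _ _).2 h3⟩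
  by_contra hdis
  have hTc : Convex ℝ T := by
    rintro x ⟨h1, h2, h3⟩ y ⟨h4, h5, h6⟩ a b ha hb hab
    refine ⟨by simp [h1, h4], by simp [h2, h5], ?_⟩
    simp only [Pi.add_apply, Pi.smul_apply, smul_eq_mul, Fin.sum_univ_four] at h3 h6 ⊢
    linear_combination a * h3 + b * h6 + dualVal m θ μ₁ μ₂ * hab
  have hTcl : IsClosed T := by
    refine (isClosed_eq (by fun_prop) (by fun_prop)).inter
      ((isClosed_eq (by fun_prop) (by fun_prop)).inter (isClosed_eq (by fun_prop) continuous_const))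
  obtain ⟨f, u, v, hu, huv, hv⟩ := geometric_hahn_banach_compact_closed
    (convex_achievable fun k j => integrable_optRate hθ hm k j)
    (isCompact_achievable fun k j => memLp_optRate hθ hm k j) hTc hTcl
    (Set.disjoint_iff_inter_eq_empty.2 (Set.not_nonempty_iff_eq_empty.1 hdis))
  let c : Fin 4 → ℝ := fun j => f (Pi.single j 1)
  have hf : ∀ r, f r = ∑ j, c j * r j := fun r => by
    conv_lhs => rw [pi_eq_sum_univ' r]
    rw [map_sum]
    refine sum_congr rfl fun j _ => ?_
    rw [map_smul, smul_eq_mul, mul_comm]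
  -- The separating functional does not depend on the realization, so a single realization with all
  -- required averages suffices.
  obtain ⟨s, ⟨q, t, hsol, hlag⟩, hD, hc⟩ := (h.and ((ae_hasAverage_maxVal hν hθ
    (coef θ μ₁ μ₂)).and (ae_hasAverage_maxVal hν hθ c))).exists
  obtain ⟨a, b, c', d, hfeas, -⟩ := hsol
  have hfeas' : Feasible θ s q t (![a, b, c', d] 0) (![a, b, c', d] 1) (![a, b, c', d] 2)
    (![a, b, c', d] 3) := hfeas
  have hT : (![a, b, c', d] : Fin 4 → ℝ) ∈ T := by
    refine ⟨hfeas.C1, hfeas.C2, ?_⟩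
    refine HasAverage.unique (hasAverage_share hfeas'.rates _) (hD.congr fun i => ?_)
    refine le_antisymm ?_ (sum_mul_le_maxVal (share_nonneg (fun k => (hfeas.C4 i k).1)
      (hfeas.C5 i)) ((sum_share _ _).trans (hfeas.C3 i)))
    have hL := sum_share_mul_optVal θ μ₁ μ₂ (q i) (t i) (s i)
    obtain ⟨k, hk⟩ := exists_eq_maxVal fun k => optVal θ μ₁ μ₂ k (s i)
    change maxVal (fun k => optVal θ μ₁ μ₂ k (s i)) ≤ ∑ k, _ * optVal θ μ₁ μ₂ k (s i)
    rw [← hk, hL, optVal_eq]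
    have h01 : (0 : ℝ) ≤ 1 := zero_le_one
    fin_cases k
    exacts [hlag i M1 0 le_rfl h01, hlag i M2 0 le_rfl h01, hlag i M3 0 le_rfl h01,
      hlag i M3 1 h01 le_rfl, hlag i M4 0 le_rfl h01, hlag i M5 0 le_rfl h01,
      hlag i M6 0 le_rfl h01]
  have h1 := hv _ hT
  rw [hf] at h1
  have h2 := rates_le_of_hasAverage hc hfeas'
  obtain ⟨w, hw, hwm⟩ := exists_policy_sum_eq_maxVal (measurable_combination θ c)
  have h3 := hu _ (achievable_expRate hw)
  rw [hf, sum_coef_mul_expRate hθ hm hw] at h3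
  simp only [hwm] at h3
  linarith

end Channel

/-! ### Supports of balanced policies -/

/-- The options that contribute to a rate. -/
def rateSupport : Fin 4 → Finset Opt := ![{0, 2, 3}, {1, 2, 3}, {4, 6}, {5, 6}]

section Support

variable {θ : Params} (hθ : θ.Valid) {m : Measure State} (hm : IsSlotLaw m)

/-- Option `k` is almost never used. -/
def Unused (m : Measure State) (w : Opt → State → ℝ) (k : Opt) : Prop := ∀ᵐ s ∂m, w k s = 0

lemma optRate_eq_zero (θ : Params) {k : Opt} {j : Fin 4} (h : k ∉ rateSupport j) (s : State) :
    optRate θ k j s = 0 := by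
  fin_cases j <;> fin_cases k <;> first | rfl | exact absurd (by decide) h

include hθ in
lemma optRate_pos {k : Opt} {j : Fin 4} (h : k ∈ rateSupport j) {s : State}
    (hs : 0 < s.1 ∧ 0 < s.2) : 0 < optRate θ k j s := by
  have h1 := C1r_pos hθ hs
  have h2 := C2r_pos hθ hs
  have h3 : 0 < C12r θ 0 s := by rw [C12r_zero hθ hs]; linarith [C2r_lt_Cr hθ hs]
  have h4 : 0 < C21r θ 0 s := by rw [C21r_zero]; exact h2
  have h5 : 0 < C12r θ 1 s := by rw [C12r_one]; exact h1
  have h6 : 0 < C21r θ 1 s := by rw [C21r_one hθ hs]; linarith [C1r_lt_Cr hθ hs]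
  have h7 := Cr1_pos hθ hs
  have h8 := Cr2_pos hθ hs
  fin_cases j <;> fin_cases k <;> first | exact absurd h (by decide) | assumption

include hθ hm

lemma expRate_eq_zero_iff {w : Opt → State → ℝ} (hw : IsPolicy w) (j : Fin 4) :
    expRate m θ w j = 0 ↔ ∀ k ∈ rateSupport j, Unused m w k := by
  have hnn : ∀ s : State, 0 < s.1 ∧ 0 < s.2 → ∀ k, 0 ≤ w k s * optRate θ k j s :=
    fun s hs k => by
      refine mul_nonneg (hw.nonneg k s) ?_
      by_cases hk : k ∈ rateSupport j
      · exact (optRate_pos hθ hk hs).le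
      · exact (optRate_eq_zero θ hk s).ge
  rw [expRate, integral_eq_zero_iff_of_nonneg_ae
    (hm.pos.mono fun s hs => sum_nonneg fun k _ => hnn s hs k)
    (hw.integrable_sum fun k => integrable_optRate hθ hm k j)]
  constructor
  · intro h k hk
    filter_upwards [h, hm.pos] with s h0 hs
    have h1 := (sum_eq_zero_iff_of_nonneg fun k _ => hnn s hs k).1 h0 k (mem_univ k)
    exact (mul_eq_zero.1 h1).resolve_right (optRate_pos hθ hk hs).ne'
  · intro h
    have h' : ∀ᵐ s ∂m, ∀ k, k ∈ rateSupport j → w k s = 0 :=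
      ae_all_iff.2 fun k => by
        by_cases hk : k ∈ rateSupport j
        · exact (h k hk).mono fun s hs _ => hs
        · exact Eventually.of_forall fun s h1 => absurd h1 hk
    filter_upwards [h'] with s hs
    refine sum_eq_zero fun k _ => ?_
    by_cases hk : k ∈ rateSupport j
    · rw [hs k hk, zero_mul]
    · rw [optRate_eq_zero θ hk, mul_zero]

omit hθ in
lemma not_forall_unused {w : Opt → State → ℝ} (hw : IsPolicy w) : ¬∀ k, Unused m w k := by
  intro h
  have := hm.prob
  obtain ⟨s, hs⟩ := (ae_all_iff.2 h).exists
  have h1 := hw.sum_eq s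
  simp [hs] at h1

/-- Equal mean rates vanish together, and a mean rate vanishes exactly if no option contributing to
it is used. -/
lemma Balanced.unused_iff {w : Opt → State → ℝ} (hw : IsPolicy w) (hb : Balanced m θ w) :
    ((Unused m w 0 ∧ Unused m w 2 ∧ Unused m w 3) ↔ (Unused m w 5 ∧ Unused m w 6)) ∧
    ((Unused m w 1 ∧ Unused m w 2 ∧ Unused m w 3) ↔ (Unused m w 4 ∧ Unused m w 6)) := by
  have h0 := expRate_eq_zero_iff hθ hm hw 0
  have h1 := expRate_eq_zero_iff hθ hm hw 1
  have h2 := expRate_eq_zero_iff hθ hm hw 2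
  have h3 := expRate_eq_zero_iff hθ hm hw 3
  rw [hb.1] at h0
  rw [hb.2] at h1
  have e1 := h0.symm.trans h3
  have e2 := h1.symm.trans h2
  simpa [rateSupport] using And.intro e1 e2

/-- A balanced policy uses both the users and the relay. -/
lemma Balanced.not_unused {w : Opt → State → ℝ} (hw : IsPolicy w) (hb : Balanced m θ w) :
    ¬(Unused m w 0 ∧ Unused m w 1 ∧ Unused m w 2 ∧ Unused m w 3) ∧
    ¬(Unused m w 4 ∧ Unused m w 5 ∧ Unused m w 6) := by
  have hu := hb.unused_iff hθ hm hw
  have hn : ¬(Unused m w 0 ∧ Unused m w 1 ∧ Unused m w 2 ∧ Unused m w 3 ∧ Unused m w 4 ∧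
      Unused m w 5 ∧ Unused m w 6) := by
    rintro ⟨h0, h1, h2, h3, h4, h5, h6⟩
    refine not_forall_unused hm hw fun k => ?_
    fin_cases k <;> assumption
  tauto

end Support

/-! ### The metrics of the options -/

/-- The largest metric of the user modes. -/
def userBest (θ : Params) (μ₁ μ₂ : ℝ) (s : State) : ℝ :=
  max (optVal θ μ₁ μ₂ 2 s) (optVal θ μ₁ μ₂ 3 s)

lemma eq_maxVal_of_sum_eq {w G : Opt → ℝ} (hw : ∀ k, 0 ≤ w k) (h1 : ∑ k, w k = 1)
    (h : ∑ k, w k * G k = maxVal G) {k : Opt} (hk : w k ≠ 0) : G k = maxVal G := by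
  have h2 : ∑ k, w k * (maxVal G - G k) = 0 := by
    simp only [mul_sub, sum_sub_distrib]
    rw [← sum_mul, h1, h, one_mul, sub_self]
  have h3 := (sum_eq_zero_iff_of_nonneg fun k _ =>
    mul_nonneg (hw k) (sub_nonneg.2 (le_maxVal G k))).1 h2 k (mem_univ k)
  linarith [(mul_eq_zero.1 h3).resolve_left hk]

lemma sum_eq_maxVal_of_forall {w G : Opt → ℝ} (h1 : ∑ k, w k = 1)
    (h : ∀ k, w k ≠ 0 → G k = maxVal G) : ∑ k, w k * G k = maxVal G := by
  calc ∑ k, w k * G k = ∑ k, w k * maxVal G := sum_congr rfl fun k _ => by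
        by_cases hk : w k = 0
        · rw [hk, zero_mul, zero_mul]
        · rw [h k hk]
    _ = maxVal G := by rw [← sum_mul, h1, one_mul]

section Metrics

variable {θ : Params} (hθ : θ.Valid) {μ₁ μ₂ : ℝ} {s : State}

include hθ in
lemma optVal_of_pos (μ₁ μ₂ : ℝ) (hs : 0 < s.1 ∧ 0 < s.2) :
    optVal θ μ₁ μ₂ 0 s = (θ.η - μ₁) * C1r θ s ∧
    optVal θ μ₁ μ₂ 1 s = (1 - θ.η - μ₂) * C2r θ s ∧
    optVal θ μ₁ μ₂ 2 s = (θ.η - μ₁) * (Cr θ s - C2r θ s) + (1 - θ.η - μ₂) * C2r θ s ∧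
    optVal θ μ₁ μ₂ 3 s = (θ.η - μ₁) * C1r θ s + (1 - θ.η - μ₂) * (Cr θ s - C1r θ s) ∧
    optVal θ μ₁ μ₂ 4 s = μ₂ * Cr1 θ s ∧
    optVal θ μ₁ μ₂ 5 s = μ₁ * Cr2 θ s ∧
    optVal θ μ₁ μ₂ 6 s = μ₁ * Cr2 θ s + μ₂ * Cr1 θ s := by
  simp only [optVal_eq, metric_M1, metric_M2, metric_M3, metric_M4, metric_M5, metric_M6,
    C12r_zero hθ hs, C21r_one hθ hs, C12r_one, C21r_zero]
  exact ⟨rfl, rfl, rfl, rfl, rfl, rfl, rfl⟩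

lemma Maximizes.unused {m : Measure State} (hm : IsSlotLaw m) {w : Opt → State → ℝ}
    (hw : IsPolicy w) (h : Maximizes m θ μ₁ μ₂ w) {k : Opt}
    (hk : ∀ s : State, 0 < s.1 ∧ 0 < s.2 → ∃ l, optVal θ μ₁ μ₂ k s < optVal θ μ₁ μ₂ l s) :
    Unused m w k := by
  filter_upwards [h, hm.pos] with s h1 hs
  by_contra hne
  obtain ⟨l, hl⟩ := hk s hs
  have h2 := eq_maxVal_of_sum_eq (fun k => hw.nonneg k s) (hw.sum_eq s) h1 hne
  have h3 := le_maxVal (fun k => optVal θ μ₁ μ₂ k s) l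
  linarith

/-- The weights for which both the users and the relay have positive metrics. -/
structure Admissible (θ : Params) (μ₁ μ₂ : ℝ) : Prop where
  nonneg₁ : 0 ≤ μ₁
  le₁ : μ₁ ≤ θ.η
  nonneg₂ : 0 ≤ μ₂
  le₂ : μ₂ ≤ 1 - θ.η
  ne_zero : ¬(μ₁ = 0 ∧ μ₂ = 0)
  ne_top : ¬(μ₁ = θ.η ∧ μ₂ = 1 - θ.η)

include hθ in
-- If `μ₁ < 0`, sending to user 2 is strictly dominated; by C1 user 1 is then silent, and mode 2 is
-- dominated by mode 3, so the users are never active. If `μ₁ > η`, the options with data of user 1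
-- are dominated; C1 silences the relay towards user 2, and mode 4 is dominated by mode 6. The
-- bounds on `μ₂` are symmetric. At the two excluded corners all metrics of one group are zero while
-- the other group has a positive one.
lemma admissible_of_maximizes {m : Measure State} (hm : IsSlotLaw m) {w : Opt → State → ℝ}
    (hw : IsPolicy w) (hb : Balanced m θ w) (h : Maximizes m θ μ₁ μ₂ w) :
    Admissible θ μ₁ μ₂ := by
  have hu := hb.unused_iff hθ hm hw
  have hn := hb.not_unused hθ hm hw
  have e := fun k => h.unused (k := k) hm hw
  have hη₀ := hθ.η₀
  have hη₁ := hθ.η₁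
  refine ⟨?_, ?_, ?_, ?_, ?_, ?_⟩
  · by_contra! hc
    have p : 0 < -μ₁ := by linarith
    have q : 0 < θ.η - μ₁ := by linarith
    have u5 : Unused m w 5 := e 5 fun s hs => ⟨0, by
      obtain ⟨v0, v1, v2, v3, v4, v5, v6⟩ := optVal_of_pos hθ μ₁ μ₂ hs
      rw [v0, v5]
      linarith [mul_pos q (C1r_pos hθ hs), mul_pos p (Cr2_pos hθ hs)]⟩
    have u6 : Unused m w 6 := e 6 fun s hs => ⟨4, by
      obtain ⟨v0, v1, v2, v3, v4, v5, v6⟩ := optVal_of_pos hθ μ₁ μ₂ hs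
      rw [v4, v6]
      linarith [mul_pos p (Cr2_pos hθ hs)]⟩
    have u1 : Unused m w 1 := e 1 fun s hs => ⟨2, by
      obtain ⟨v0, v1, v2, v3, v4, v5, v6⟩ := optVal_of_pos hθ μ₁ μ₂ hs
      rw [v1, v2]
      linarith [mul_pos q (sub_pos.2 (C2r_lt_Cr hθ hs))]⟩
    obtain ⟨u0, u2, u3⟩ := hu.1.2 ⟨u5, u6⟩
    exact hn.1 ⟨u0, u1, u2, u3⟩
  · by_contra! hc
    have p : 0 < μ₁ := by linarith
    have q : 0 < μ₁ - θ.η := by linarith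
    have u0 : Unused m w 0 := e 0 fun s hs => ⟨5, by
      obtain ⟨v0, v1, v2, v3, v4, v5, v6⟩ := optVal_of_pos hθ μ₁ μ₂ hs
      rw [v0, v5]
      linarith [mul_pos q (C1r_pos hθ hs), mul_pos p (Cr2_pos hθ hs)]⟩
    have u2 : Unused m w 2 := e 2 fun s hs => ⟨1, by
      obtain ⟨v0, v1, v2, v3, v4, v5, v6⟩ := optVal_of_pos hθ μ₁ μ₂ hs
      rw [v1, v2]
      linarith [mul_pos q (sub_pos.2 (C2r_lt_Cr hθ hs))]⟩
    have u3 : Unused m w 3 := e 3 fun s hs => by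
      obtain ⟨v0, v1, v2, v3, v4, v5, v6⟩ := optVal_of_pos hθ μ₁ μ₂ hs
      rcases le_or_gt 0 (1 - θ.η - μ₂) with ha | ha
      · refine ⟨1, ?_⟩
        rw [v1, v3]
        linarith [mul_nonneg ha (sub_pos.2 (Cr_lt hθ hs)).le, mul_pos q (C1r_pos hθ hs)]
      · refine ⟨5, ?_⟩
        rw [v3, v5]
        linarith [mul_pos q (C1r_pos hθ hs), mul_pos (neg_pos.2 ha) (sub_pos.2 (C1r_lt_Cr hθ hs)), mul_pos p (Cr2_pos hθ hs)]
    have u4 : Unused m w 4 := e 4 fun s hs => ⟨6, by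
      obtain ⟨v0, v1, v2, v3, v4, v5, v6⟩ := optVal_of_pos hθ μ₁ μ₂ hs
      rw [v4, v6]
      linarith [mul_pos p (Cr2_pos hθ hs)]⟩
    obtain ⟨u5, u6⟩ := hu.1.1 ⟨u0, u2, u3⟩
    exact hn.2 ⟨u4, u5, u6⟩
  · by_contra! hc
    have p : 0 < -μ₂ := by linarith
    have q : 0 < 1 - θ.η - μ₂ := by linarith
    have u4 : Unused m w 4 := e 4 fun s hs => ⟨1, by
      obtain ⟨v0, v1, v2, v3, v4, v5, v6⟩ := optVal_of_pos hθ μ₁ μ₂ hs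
      rw [v1, v4]
      linarith [mul_pos q (C2r_pos hθ hs), mul_pos p (Cr1_pos hθ hs)]⟩
    have u6 : Unused m w 6 := e 6 fun s hs => ⟨5, by
      obtain ⟨v0, v1, v2, v3, v4, v5, v6⟩ := optVal_of_pos hθ μ₁ μ₂ hs
      rw [v5, v6]
      linarith [mul_pos p (Cr1_pos hθ hs)]⟩
    have u0 : Unused m w 0 := e 0 fun s hs => ⟨3, by
      obtain ⟨v0, v1, v2, v3, v4, v5, v6⟩ := optVal_of_pos hθ μ₁ μ₂ hs
      rw [v0, v3]
      linarith [mul_pos q (sub_pos.2 (C1r_lt_Cr hθ hs))]⟩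
    obtain ⟨u1, u2, u3⟩ := hu.2.2 ⟨u4, u6⟩
    exact hn.1 ⟨u0, u1, u2, u3⟩
  · by_contra! hc
    have p : 0 < μ₂ := by linarith
    have q : 0 < μ₂ - (1 - θ.η) := by linarith
    have u1 : Unused m w 1 := e 1 fun s hs => ⟨4, by
      obtain ⟨v0, v1, v2, v3, v4, v5, v6⟩ := optVal_of_pos hθ μ₁ μ₂ hs
      rw [v1, v4]
      linarith [mul_pos q (C2r_pos hθ hs), mul_pos p (Cr1_pos hθ hs)]⟩
    have u3 : Unused m w 3 := e 3 fun s hs => ⟨0, by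
      obtain ⟨v0, v1, v2, v3, v4, v5, v6⟩ := optVal_of_pos hθ μ₁ μ₂ hs
      rw [v0, v3]
      linarith [mul_pos q (sub_pos.2 (C1r_lt_Cr hθ hs))]⟩
    have u2 : Unused m w 2 := e 2 fun s hs => by
      obtain ⟨v0, v1, v2, v3, v4, v5, v6⟩ := optVal_of_pos hθ μ₁ μ₂ hs
      rcases le_or_gt 0 (θ.η - μ₁) with ha | ha
      · refine ⟨0, ?_⟩
        rw [v0, v2]
        linarith [mul_nonneg ha (sub_pos.2 (Cr_lt hθ hs)).le, mul_pos q (C2r_pos hθ hs)]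
      · refine ⟨4, ?_⟩
        rw [v2, v4]
        linarith [mul_pos q (C2r_pos hθ hs), mul_pos (neg_pos.2 ha) (sub_pos.2 (C2r_lt_Cr hθ hs)), mul_pos p (Cr1_pos hθ hs)]
    have u5 : Unused m w 5 := e 5 fun s hs => ⟨6, by
      obtain ⟨v0, v1, v2, v3, v4, v5, v6⟩ := optVal_of_pos hθ μ₁ μ₂ hs
      rw [v5, v6]
      linarith [mul_pos p (Cr1_pos hθ hs)]⟩
    obtain ⟨u4, u6⟩ := hu.2.1 ⟨u1, u2, u3⟩
    exact hn.2 ⟨u4, u5, u6⟩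
  · rintro ⟨rfl, rfl⟩
    have u : ∀ k : Opt, k = 4 ∨ k = 5 ∨ k = 6 → Unused m w k := fun k hk => e k fun s hs => ⟨0, by
      obtain ⟨v0, v1, v2, v3, v4, v5, v6⟩ := optVal_of_pos hθ 0 0 hs
      have := mul_pos hη₀ (C1r_pos hθ hs)
      rcases hk with rfl | rfl | rfl
      · rw [v0, v4]; linarith
      · rw [v0, v5]; linarith
      · rw [v0, v6]; linarith⟩
    exact hn.2 ⟨u 4 (by simp), u 5 (by simp), u 6 (by simp)⟩
  · rintro ⟨rfl, rfl⟩
    have u : ∀ k : Opt, k = 0 ∨ k = 1 ∨ k = 2 ∨ k = 3 → Unused m w k :=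
      fun k hk => e k fun s hs => ⟨6, by
      obtain ⟨v0, v1, v2, v3, v4, v5, v6⟩ := optVal_of_pos hθ θ.η (1 - θ.η) hs
      have h1 := mul_pos hη₀ (Cr2_pos hθ hs)
      have h2 := mul_pos (sub_pos.2 hη₁) (Cr1_pos hθ hs)
      rcases hk with rfl | rfl | rfl | rfl
      · rw [v0, v6]; linarith
      · rw [v1, v6]; linarith
      · rw [v2, v6]; linarith
      · rw [v3, v6]; linarith⟩
    exact hn.1 ⟨u 0 (by simp), u 1 (by simp), u 2 (by simp), u 3 (by simp)⟩

/-- The options that maximize the metric within their group (users or relay). -/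
def Allowed (θ : Params) (μ₁ μ₂ : ℝ) : Opt → Prop :=
  ![μ₂ = 1 - θ.η, μ₁ = θ.η, θ.η - μ₁ ≤ 1 - θ.η - μ₂, 1 - θ.η - μ₂ ≤ θ.η - μ₁, μ₁ = 0, μ₂ = 0,
    True]

/-! ### Order of the metrics inside and between the groups -/

section

variable (ha : Admissible θ μ₁ μ₂) (hs : 0 < s.1 ∧ 0 < s.2)
include hθ ha hs

/-- Positivity ensures that a candidate of the protocol beats all modes whose indicator is zero. -/
lemma userBest_pos : 0 < userBest θ μ₁ μ₂ s := by
  obtain ⟨v0, v1, v2, v3, v4, v5, v6⟩ := optVal_of_pos hθ μ₁ μ₂ hs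
  have c1 := C2r_pos hθ hs
  have c2 := C2r_lt_Cr hθ hs
  have h1 := ha.le₁
  have h2 := ha.le₂
  refine lt_of_lt_of_le ?_ (le_max_left _ _)
  rw [v2]
  rcases h1.lt_or_eq with h | h
  · have e1 := mul_pos (sub_pos.2 h) (sub_pos.2 c2)
    have e2 := mul_nonneg (sub_nonneg.2 h2) c1.le
    linarith
  · have h3 : μ₂ < 1 - θ.η := lt_of_le_of_ne h2 fun h3 => ha.ne_top ⟨h, h3⟩
    have e1 := mul_nonneg (sub_nonneg.2 h1) (sub_pos.2 c2).le
    have e2 := mul_pos (sub_pos.2 h3) c1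
    linarith

lemma relayBest_pos : 0 < optVal θ μ₁ μ₂ 6 s := by
  obtain ⟨v0, v1, v2, v3, v4, v5, v6⟩ := optVal_of_pos hθ μ₁ μ₂ hs
  have c1 := Cr1_pos hθ hs
  have c2 := Cr2_pos hθ hs
  have h1 := ha.nonneg₁
  have h2 := ha.nonneg₂
  rw [v6]
  rcases h1.lt_or_eq with h | h
  · have e1 := mul_pos h c2
    have e2 := mul_nonneg h2 c1.le
    linarith
  · have h3 : 0 < μ₂ := lt_of_le_of_ne h2 fun h3 => ha.ne_zero ⟨h.symm, h3.symm⟩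
    have e1 := mul_nonneg h1 c2.le
    have e2 := mul_pos h3 c1
    linarith

omit ha in
-- The last factor is positive, so the sign is that of the weights alone: this is what separates the
-- three selection regions.
lemma optVal_two_sub_three : optVal θ μ₁ μ₂ 2 s - optVal θ μ₁ μ₂ 3 s
    = ((1 - θ.η - μ₂) - (θ.η - μ₁)) * (C1r θ s + C2r θ s - Cr θ s) := by
  obtain ⟨v0, v1, v2, v3, v4, v5, v6⟩ := optVal_of_pos hθ μ₁ μ₂ hs
  rw [v2, v3]; ring

/-- Each gap to the better decoding order is a factor depending on the weights times a positive
capacity difference, so the ties among user options do not depend on the state. -/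
lemma user_le {k : Opt} (hk : k ≤ 3) :
    optVal θ μ₁ μ₂ k s ≤ userBest θ μ₁ μ₂ s ∧
      (optVal θ μ₁ μ₂ k s = userBest θ μ₁ μ₂ s ↔ Allowed θ μ₁ μ₂ k) := by
  have hsub := optVal_two_sub_three (μ₁ := μ₁) (μ₂ := μ₂) hθ hs
  obtain ⟨v0, v1, v2, v3, v4, v5, v6⟩ := optVal_of_pos hθ μ₁ μ₂ hs
  have c1 := C1r_pos hθ hs
  have c2 := C2r_pos hθ hs
  have c3 := C1r_lt_Cr hθ hs
  have c4 := C2r_lt_Cr hθ hs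
  have c5 := Cr_lt hθ hs
  have l1 := le_max_left (optVal θ μ₁ μ₂ 2 s) (optVal θ μ₁ μ₂ 3 s)
  have l2 := le_max_right (optVal θ μ₁ μ₂ 2 s) (optVal θ μ₁ μ₂ 3 s)
  have a1 := ha.le₁
  have a2 := ha.le₂
  have m1 : θ.η - μ₁ ≤ 1 - θ.η - μ₂ → userBest θ μ₁ μ₂ s = optVal θ μ₁ μ₂ 2 s := fun h =>
    max_eq_left (by nlinarith)
  have m2 : 1 - θ.η - μ₂ ≤ θ.η - μ₁ → userBest θ μ₁ μ₂ s = optVal θ μ₁ μ₂ 3 s := fun h =>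
    max_eq_right (by nlinarith)
  have hk' : k = 0 ∨ k = 1 ∨ k = 2 ∨ k = 3 := by
    revert hk k; decide
  rcases hk' with rfl | rfl | rfl | rfl
  · have e : optVal θ μ₁ μ₂ 3 s - optVal θ μ₁ μ₂ 0 s = (1 - θ.η - μ₂) * (Cr θ s - C1r θ s) := by
      rw [v0, v3]; ring
    have e0 := mul_nonneg (sub_nonneg.2 a2) (sub_pos.2 c3).le
    refine ⟨by unfold userBest; linarith, fun h => ?_, fun h => ?_⟩
    · change μ₂ = 1 - θ.η
      unfold userBest at h
      have h0 : (1 - θ.η - μ₂) * (Cr θ s - C1r θ s) = 0 := by linarith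
      rcases mul_eq_zero.1 h0 with h1 | h1 <;> linarith
    · change μ₂ = 1 - θ.η at h
      rw [m2 (by linarith)]
      have : 1 - θ.η - μ₂ = 0 := by linarith
      rw [this] at e
      linarith
  · have e : optVal θ μ₁ μ₂ 2 s - optVal θ μ₁ μ₂ 1 s = (θ.η - μ₁) * (Cr θ s - C2r θ s) := by
      rw [v1, v2]; ring
    have e0 := mul_nonneg (sub_nonneg.2 a1) (sub_pos.2 c4).le
    refine ⟨by unfold userBest; linarith, fun h => ?_, fun h => ?_⟩
    · change μ₁ = θ.η
      unfold userBest at h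
      have h0 : (θ.η - μ₁) * (Cr θ s - C2r θ s) = 0 := by linarith
      rcases mul_eq_zero.1 h0 with h1 | h1 <;> linarith
    · change μ₁ = θ.η at h
      rw [m1 (by linarith)]
      have : θ.η - μ₁ = 0 := by linarith
      rw [this] at e
      linarith
  · refine ⟨l1, fun h => ?_, fun h => (m1 h).symm⟩
    change θ.η - μ₁ ≤ 1 - θ.η - μ₂
    unfold userBest at h
    by_contra! hc
    nlinarith
  · refine ⟨l2, fun h => ?_, fun h => (m2 h).symm⟩
    change 1 - θ.η - μ₂ ≤ θ.η - μ₁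
    unfold userBest at h
    by_contra! hc
    nlinarith

lemma relay_le {k : Opt} (hk : 3 < k) :
    optVal θ μ₁ μ₂ k s ≤ optVal θ μ₁ μ₂ 6 s ∧
      (optVal θ μ₁ μ₂ k s = optVal θ μ₁ μ₂ 6 s ↔ Allowed θ μ₁ μ₂ k) := by
  obtain ⟨v0, v1, v2, v3, v4, v5, v6⟩ := optVal_of_pos hθ μ₁ μ₂ hs
  have c1 := Cr1_pos hθ hs
  have c2 := Cr2_pos hθ hs
  have e1 := mul_nonneg ha.nonneg₁ c2.le
  have e2 := mul_nonneg ha.nonneg₂ c1.le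
  have hk' : k = 4 ∨ k = 5 ∨ k = 6 := by
    revert hk k; decide
  rcases hk' with rfl | rfl | rfl
  · refine ⟨by linarith, fun h => ?_, fun h => ?_⟩
    · change μ₁ = 0
      rw [v4, v6] at h
      exact (mul_eq_zero.1 (show μ₁ * Cr2 θ s = 0 by linarith)).resolve_right c2.ne'
    · change μ₁ = 0 at h
      rw [v4, v6, h]; ring
  · refine ⟨by linarith, fun h => ?_, fun h => ?_⟩
    · change μ₂ = 0
      rw [v5, v6] at h
      exact (mul_eq_zero.1 (show μ₂ * Cr1 θ s = 0 by linarith)).resolve_right c1.ne'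
    · change μ₂ = 0 at h
      rw [v5, v6, h]; ring
  · exact ⟨le_rfl, fun _ => trivial, fun _ => rfl⟩

lemma maxVal_optVal : maxVal (fun k => optVal θ μ₁ μ₂ k s) =
    max (userBest θ μ₁ μ₂ s) (optVal θ μ₁ μ₂ 6 s) := by
  refine le_antisymm ?_ (max_le (max_le ?_ ?_) ?_)
  · obtain ⟨k, hk⟩ := exists_eq_maxVal fun k => optVal θ μ₁ μ₂ k s
    rw [← hk]
    rcases le_or_gt k 3 with h | h
    · exact (user_le hθ ha hs h).1.trans (le_max_left _ _)
    · exact (relay_le hθ ha hs h).1.trans (le_max_right _ _)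
  · exact le_maxVal (fun k => optVal θ μ₁ μ₂ k s) 2
  · exact le_maxVal (fun k => optVal θ μ₁ μ₂ k s) 3
  · exact le_maxVal (fun k => optVal θ μ₁ μ₂ k s) 6

lemma optVal_eq_maxVal_iff (k : Opt) :
    optVal θ μ₁ μ₂ k s = maxVal (fun k => optVal θ μ₁ μ₂ k s) ↔
      Allowed θ μ₁ μ₂ k ∧ (k ≤ 3 → optVal θ μ₁ μ₂ 6 s ≤ userBest θ μ₁ μ₂ s) ∧
        (3 < k → userBest θ μ₁ μ₂ s ≤ optVal θ μ₁ μ₂ 6 s) := by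
  rw [maxVal_optVal hθ ha hs]
  rcases le_or_gt k 3 with h | h
  · have h1 := user_le hθ ha hs h
    constructor
    · intro he
      have h2 := le_max_right (userBest θ μ₁ μ₂ s) (optVal θ μ₁ μ₂ 6 s)
      have h3 := le_max_left (userBest θ μ₁ μ₂ s) (optVal θ μ₁ μ₂ 6 s)
      exact ⟨h1.2.1 (by linarith [h1.1]), fun _ => by linarith [h1.1],
        fun h' => absurd h (not_le.2 h')⟩
    · rintro ⟨h2, h3, -⟩
      rw [max_eq_left (h3 h)]
      exact h1.2.2 h2
  · have h1 := relay_le hθ ha hs h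
    constructor
    · intro he
      have h2 := le_max_right (userBest θ μ₁ μ₂ s) (optVal θ μ₁ μ₂ 6 s)
      have h3 := le_max_left (userBest θ μ₁ μ₂ s) (optVal θ μ₁ μ₂ 6 s)
      exact ⟨h1.2.1 (by linarith [h1.1]), fun h' => absurd h (not_lt.2 h'),
        fun _ => by linarith [h1.1]⟩
    · rintro ⟨h2, -, h3⟩
      rw [max_eq_right (h3 h)]
      exact h1.2.2 h2

end

/-! ### Ties between the users and the relay -/

include hθ in
lemma userBest_eq_of_usesCoin5 (h : UsesCoin5 θ μ₁ μ₂) (hs : 0 < s.1 ∧ 0 < s.2) :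
    optVal θ μ₁ μ₂ 6 s = userBest θ μ₁ μ₂ s := by
  have c3 := C1r_lt_Cr hθ hs
  have c4 := C2r_lt_Cr hθ hs
  have c5 := Cr_lt hθ hs
  obtain ⟨v0, v1, v2, v3, v4, v5, v6⟩ := optVal_of_pos hθ μ₁ μ₂ hs
  rcases h with ⟨h1, h2, h3, h4⟩ | ⟨h1, h2, h3, h4⟩
  · have e : Cr2 θ s = C2r θ s := by unfold Cr2 C2r; rw [h3]
    rw [userBest, max_eq_left, v2, v6, h1, h2, h4, e]
    · ring
    · rw [v2, v3, h1, h2, h4]; linarith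
  · have e : Cr1 θ s = C1r θ s := by unfold Cr1 C1r; rw [h3]
    rw [userBest, max_eq_right, v3, v6, h1, h2, h4, e]
    · ring
    · rw [v2, v3, h1, h2, h4]; linarith

include hθ in
-- Equality of the two best metrics is a tie set of logarithmic expressions, null unless it
-- degenerates to an identity. For admissible weights, the identity occurs only in the situations of
-- the fifth coin.
lemma ae_ne_userBest {m : Measure State} (hm : IsSlotLaw m) (ha : Admissible θ μ₁ μ₂)
    (h : ¬UsesCoin5 θ μ₁ μ₂) :
    ∀ᵐ s ∂m, optVal θ μ₁ μ₂ 6 s ≠ userBest θ μ₁ μ₂ s := by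
  have hη₀ := hθ.η₀
  have hη₁ := hθ.η₁
  have hl : 0 < Real.log 2 := Real.log_pos one_lt_two
  have lg : ∀ x, cap x * Real.log 2 = Real.log (1 + x) := fun x => by
    unfold cap Real.logb; field_simp
  rcases le_or_gt (θ.η - μ₁) (1 - θ.η - μ₂) with hc | hc
  · have hv : volume (LogLevelSet.tieSet θ.P₁ θ.P₂ θ.Pᵣ (θ.η - μ₁) (1 - θ.η - μ₂) μ₁ μ₂) = 0 := by
      refine LogLevelSet.volume_tieSet hθ.P₁ hθ.P₂ hθ.Pᵣ ?_
      rintro h1 h2 ⟨h3, h4 | h4⟩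
      · linarith
      · exact h (Or.inl ⟨by linarith, h2, h4, by linarith⟩)
    filter_upwards [hm.pos, measure_eq_zero_iff_ae_notMem.1 (hm.density hv)] with s hs hn he
    refine hn ⟨hs, ?_⟩
    rw [(user_le hθ ha hs (k := 2) (by decide)).2.2 hc |>.symm] at he
    obtain ⟨v0, v1, v2, v3, v4, v5, v6⟩ := optVal_of_pos hθ μ₁ μ₂ hs
    rw [v2, v6] at he
    simp only [Cr, C2r, Cr1, Cr2] at he
    simp only [← lg]
    linear_combination - Real.log 2 * he
  · have hv : volume (Prod.swap ⁻¹' LogLevelSet.tieSet θ.P₂ θ.P₁ θ.Pᵣ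
        (1 - θ.η - μ₂) (θ.η - μ₁) μ₂ μ₁) = 0 := by
      refine LogLevelSet.volume_tieSet_swap hθ.P₂ hθ.P₁ hθ.Pᵣ ?_
      rintro h1 h2 ⟨h3, h4 | h4⟩
      · linarith
      · exact h (Or.inr ⟨h2, by linarith, h4, by linarith⟩)
    filter_upwards [hm.pos, measure_eq_zero_iff_ae_notMem.1 (hm.density hv)] with s hs hn he
    refine hn ⟨hs.symm, ?_⟩
    rw [(user_le hθ ha hs (k := 3) (by decide)).2.2 hc.le |>.symm] at he
    obtain ⟨v0, v1, v2, v3, v4, v5, v6⟩ := optVal_of_pos hθ μ₁ μ₂ hs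
    rw [v3, v6] at he
    simp only [Cr, C1r, Cr1, Cr2] at he
    simp only [← lg, Prod.fst_swap, Prod.snd_swap]
    rw [add_comm (θ.P₂ * s.2)]
    linear_combination - Real.log 2 * he

end Metrics

/-! ### The table of cases -/

namespace TableCase

variable {θ : Params} {μ₁ μ₂ : ℝ} {X : TableCase}

lemma Weights.admissible (hθ : θ.Valid) (h : X.Weights θ μ₁ μ₂) : Admissible θ μ₁ μ₂ := by
  have h0 := hθ.η₀
  have h1 := hθ.η₁
  obtain ⟨a, b, c, d, h⟩ := h
  refine ⟨a, b, c, d, ?_, ?_⟩ <;> cases X <;> simp only at h <;> grind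

/-- A coin is flipped exactly where the weights tie the options between which it decides. This
dictionary replaces case distinctions over the rows in later arguments. -/
lemma Weights.mem_flipped (hθ : θ.Valid) (h : X.Weights θ μ₁ μ₂) :
    (coin1 ∈ X.flipped ↔ μ₂ = 1 - θ.η) ∧ (coin2 ∈ X.flipped ↔ μ₁ = θ.η) ∧
    (coin3 ∈ X.flipped ↔ μ₁ = 0) ∧ (coin4 ∈ X.flipped ↔ μ₂ = 0) ∧
    (coin6 ∈ X.flipped ↔ θ.η - μ₁ = 1 - θ.η - μ₂) ∧
    (X.ThreeCoins ↔ UsesCoin5 θ μ₁ μ₂) ∧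
    (X.order = 0 ↔ θ.η - μ₁ ≤ 1 - θ.η - μ₂) ∧
    (X.order = 1 ↔ 1 - θ.η - μ₂ < θ.η - μ₁) := by
  have h0 := hθ.η₀
  have h1 := hθ.η₁
  obtain ⟨a, b, c, d, h⟩ := h
  unfold UsesCoin5
  cases X <;> simp only at h <;> simp [flipped, ThreeCoins, order] <;> grind

lemma exists_weights (ha : Admissible θ μ₁ μ₂) : ∃ X : TableCase, X.Weights θ μ₁ μ₂ := by
  obtain ⟨a, b, c, d, e, f⟩ := ha
  rcases lt_trichotomy (θ.η - μ₁) (1 - θ.η - μ₂) with h | h | h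
  · by_cases h1 : μ₁ = 0
    · exact ⟨s1c2d, a, b, c, d, h, h1, by grind⟩
    by_cases h2 : μ₁ = θ.η
    · by_cases h3 : μ₂ = 0
      · by_cases h4 : θ.η = 1 / 2 ∧ θ.P₂ = θ.Pᵣ
        · exact ⟨s1c2cEq, a, b, c, d, h, h2, h3, h4⟩
        · exact ⟨s1c2c, a, b, c, d, h, h2, h3, by tauto⟩
      · exact ⟨s1c2a, a, b, c, d, h, h2, by grind⟩
    · by_cases h3 : μ₂ = 0
      · exact ⟨s1c2b, a, b, c, d, h, ⟨h1, h2⟩, h3⟩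
      · exact ⟨s1c1, a, b, c, d, h, ⟨h1, h2⟩, by grind⟩
  · by_cases h1 : μ₁ = 0
    · exact ⟨s0c2a, a, b, c, d, h, h1, by grind, by grind⟩
    by_cases h2 : μ₂ = 0
    · exact ⟨s0c2b, a, b, c, d, h, by grind, h1, h2⟩
    · exact ⟨s0c1, a, b, c, d, h, by grind, by grind⟩
  · by_cases h1 : μ₂ = 0
    · exact ⟨s2c2d, a, b, c, d, h, by grind, h1⟩
    by_cases h2 : μ₂ = 1 - θ.η
    · by_cases h3 : μ₁ = 0
      · by_cases h4 : θ.η = 1 / 2 ∧ θ.P₁ = θ.Pᵣ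
        · exact ⟨s2c2cEq, a, b, c, d, h, h3, h2, h4⟩
        · exact ⟨s2c2c, a, b, c, d, h, h3, h2, by tauto⟩
      · exact ⟨s2c2a, a, b, c, d, h, by grind, h2⟩
    · by_cases h3 : μ₁ = 0
      · exact ⟨s2c2b, a, b, c, d, h, h3, ⟨h1, h2⟩⟩
      · exact ⟨s2c1, a, b, c, d, h, by grind, ⟨h1, h2⟩⟩

/-- A case is determined by its flipped coins (except the fifth one) and its decoding order. -/
lemma eq_of_flipped_eq {X' : TableCase} {μ₁' μ₂' : ℝ} (h : X.Weights θ μ₁ μ₂)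
    (h' : X'.Weights θ μ₁' μ₂') (hf : X.flipped.erase coin5 = X'.flipped.erase coin5)
    (ho : X.order = 0 ↔ X'.order = 0) : X = X' := by
  obtain ⟨-, -, -, -, h⟩ := h
  obtain ⟨-, -, -, -, h'⟩ := h'
  cases X <;> cases X' <;>
    first
    | rfl
    | exact absurd hf (by decide)
    | (simp [order] at ho; done)
    -- What remains are the two-coin and three-coin variants of one row, told apart by `η` and the
    -- powers alone.
    | (simp only at h h'; grind)

lemma flipped_erase_eq {X' : TableCase}
    (h : ∀ n, n ≠ coin5 → (n ∈ X.flipped ↔ n ∈ X'.flipped)) :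
    X.flipped.erase coin5 = X'.flipped.erase coin5 := by
  ext n
  simp only [mem_erase]
  exact and_congr_right fun hn => h n hn

lemma existsUnique_weights (hθ : θ.Valid) (ha : Admissible θ μ₁ μ₂) :
    ∃! X : TableCase, X.Weights θ μ₁ μ₂ := by
  obtain ⟨X, hX⟩ := exists_weights ha
  refine ⟨X, hX, fun X' hX' => ?_⟩
  obtain ⟨a1, a2, a3, a4, a6, -, a7, -⟩ := hX.mem_flipped hθ
  obtain ⟨b1, b2, b3, b4, b6, -, b7, -⟩ := hX'.mem_flipped hθ
  refine eq_of_flipped_eq hX' hX (flipped_erase_eq fun n hn => ?_) (b7.trans a7.symm)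
  fin_cases n
  exacts [b1.trans a1.symm, b2.trans a2.symm, b3.trans a3.symm, b4.trans a4.symm,
    absurd rfl hn, b6.trans a6.symm]

lemma Weights.ties (h : X.Weights θ μ₁ μ₂) : X.Ties θ μ₁ μ₂ := by
  obtain ⟨-, -, -, -, h⟩ := h
  intro s
  have e2 : θ.P₂ = θ.Pᵣ → Cr2 θ s = C2r θ s := fun h => by unfold Cr2 C2r; rw [h]
  have e1 : θ.P₁ = θ.Pᵣ → Cr1 θ s = C1r θ s := fun h => by unfold Cr1 C1r; rw [h]
  cases X <;> simp only at h ⊢ <;>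
    simp only [metric_M1, metric_M2, metric_M3, metric_M4, metric_M5, metric_M6, C12r_one,
      C21r_zero] <;> grind

end TableCase

/-! ### The coin flips of a slot -/

/-- The law of the six coins of a slot. -/
def coinLaw (p : Fin 6 → I) : Measure (Fin 6 → Bool) :=
  Measure.pi fun n => ProbabilityTheory.bernoulliMeasure true false (p n)

instance (p : Fin 6 → I) : IsProbabilityMeasure (coinLaw p) := by
  unfold coinLaw; infer_instance

lemma flip_mem (c : Fin 6 → Bool) (n : Fin 6) : 0 ≤ flip c n ∧ flip c n ≤ 1 := by
  unfold flip; split_ifs <;> norm_num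

lemma measurable_flip (n : Fin 6) : Measurable fun c : Fin 6 → Bool => flip c n :=
  measurable_of_countable _

/-- By independence, the mean of a product of functions, each affine in its own coin, is obtained by
inserting the probabilities. -/
lemma integral_coinLaw_prod (p : Fin 6 → I) (α β : Fin 6 → ℝ) :
    ∫ c, ∏ n, (α n + β n * flip c n) ∂(coinLaw p) = ∏ n, (α n + β n * (p n : ℝ)) := by
  have h := integral_fintype_prod_eq_prod (𝕜 := ℝ)
    (μ := fun n => ProbabilityTheory.bernoulliMeasure true false (p n))
    (f := fun n (b : Bool) => α n + β n * (if b then (1 : ℝ) else 0))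
  refine h.trans (prod_congr rfl fun n _ => ?_)
  rw [ProbabilityTheory.integral_bernoulliMeasure]
  simp only [if_true, Bool.false_eq_true, if_false, smul_eq_mul]
  simp
  ring

lemma ae_coin_eq_true {p : Fin 6 → I} {n : Fin 6} (h : p n = 1) :
    ∀ᵐ c ∂(coinLaw p), c n = true := by
  have h1 : ∀ᵐ b ∂(ProbabilityTheory.bernoulliMeasure true false (p n)), b = true := by
    rw [h, ProbabilityTheory.bernoulliMeasure_one]
    simp
  exact (measurePreserving_eval
    (fun n => ProbabilityTheory.bernoulliMeasure true false (p n)) n).quasiMeasurePreserving.ae h1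

lemma ae_coin_eq_false {p : Fin 6 → I} {n : Fin 6} (h : p n = 0) :
    ∀ᵐ c ∂(coinLaw p), c n = false := by
  have h1 : ∀ᵐ b ∂(ProbabilityTheory.bernoulliMeasure true false (p n)), b = false := by
    rw [h, ProbabilityTheory.bernoulliMeasure_zero]
    simp
  exact (measurePreserving_eval
    (fun n => ProbabilityTheory.bernoulliMeasure true false (p n)) n).quasiMeasurePreserving.ae h1

/-! ### The option mixture of the protocol -/

/-- The weights of the options, if the coins have expectations `x` and the users are active with
weight `u`. -/
def mixture (x : Fin 6 → ℝ) (u : ℝ) : Opt → ℝ :=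
  ![u * (1 - x coin1), u * (1 - x coin2), u * (x coin1 * x coin2 * (1 - x coin6)),
    u * (x coin1 * x coin2 * x coin6), (1 - u) * (1 - x coin3), (1 - u) * (1 - x coin4),
    (1 - u) * (x coin3 * x coin4)]

lemma sum_mixture (x : Fin 6 → ℝ) (u : ℝ) : ∑ k, mixture x u k =
    1 + u * ((1 - x coin1) * (1 - x coin2)) + (1 - u) * ((1 - x coin3) * (1 - x coin4)) := by
  rw [sum_opt]
  simp only [mixture, Matrix.cons_val]
  ring

lemma mixture_nonneg {x : Fin 6 → ℝ} (hx : ∀ n, 0 ≤ x n ∧ x n ≤ 1) {u : ℝ}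
    (hu : 0 ≤ u ∧ u ≤ 1) (k : Opt) : 0 ≤ mixture x u k := by
  have hx' : ∀ n, 0 ≤ 1 - x n := fun n => sub_nonneg.2 (hx n).2
  have hx0 : ∀ n, 0 ≤ x n := fun n => (hx n).1
  have hu' : 0 ≤ 1 - u := sub_nonneg.2 hu.2
  have h2 := mul_nonneg hu.1 (mul_nonneg (mul_nonneg (hx0 coin1) (hx0 coin2)) (hx' coin6))
  have h3 := mul_nonneg hu.1 (mul_nonneg (mul_nonneg (hx0 coin1) (hx0 coin2)) (hx0 coin6))
  have h6 := mul_nonneg hu' (mul_nonneg (hx0 coin3) (hx0 coin4))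
  fin_cases k
  exacts [mul_nonneg hu.1 (hx' _), mul_nonneg hu.1 (hx' _), h2, h3, mul_nonneg hu' (hx' _),
    mul_nonneg hu' (hx' _), h6]

lemma mixture_le_one {x : Fin 6 → ℝ} (hx : ∀ n, 0 ≤ x n ∧ x n ≤ 1) {u : ℝ}
    (hu : 0 ≤ u ∧ u ≤ 1) (k : Opt) : mixture x u k ≤ 1 := by
  have hx' : ∀ n, 0 ≤ 1 - x n ∧ 1 - x n ≤ 1 := fun n =>
    ⟨sub_nonneg.2 (hx n).2, by linarith [(hx n).1]⟩
  have hu' : 0 ≤ 1 - u ∧ 1 - u ≤ 1 := ⟨sub_nonneg.2 hu.2, by linarith [hu.1]⟩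
  have hm : ∀ {a b : ℝ}, 0 ≤ a ∧ a ≤ 1 → 0 ≤ b ∧ b ≤ 1 → 0 ≤ a * b ∧ a * b ≤ 1 :=
    fun ha hb => ⟨mul_nonneg ha.1 hb.1, mul_le_one₀ ha.2 hb.1 hb.2⟩
  fin_cases k
  exacts [(hm hu (hx' _)).2, (hm hu (hx' _)).2, (hm hu (hm (hm (hx _) (hx _)) (hx' _))).2,
    (hm hu (hm (hm (hx _) (hx _)) (hx _))).2, (hm hu' (hx' _)).2, (hm hu' (hx' _)).2,
    (hm hu' (hm (hx _) (hx _))).2]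

/-- Every entry of the mixture is a product of affine functions of distinct coins, with `α` and `β`
listing their coefficients. -/
lemma integral_mixture (p : Fin 6 → I) (A B : ℝ) (k : Opt) :
    ∫ c, mixture (flip c) (A + B * flip c coin5) k ∂(coinLaw p)
      = mixture (fun n => p n) (A + B * (p coin5 : ℝ)) k := by
  let α : Opt → Fin 6 → ℝ := ![![1, 1, 1, 1, A, 1], ![1, 1, 1, 1, A, 1], ![0, 0, 1, 1, A, 1],
    ![0, 0, 1, 1, A, 0], ![1, 1, 1, 1, 1 - A, 1], ![1, 1, 1, 1, 1 - A, 1], ![1, 1, 0, 0, 1 - A, 1]]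
  let β : Opt → Fin 6 → ℝ := ![![-1, 0, 0, 0, B, 0], ![0, -1, 0, 0, B, 0], ![1, 1, 0, 0, B, -1],
    ![1, 1, 0, 0, B, 1], ![0, 0, -1, 0, -B, 0], ![0, 0, 0, -1, -B, 0], ![0, 0, 1, 1, -B, 0]]
  have h : ∀ (x : Fin 6 → ℝ), mixture x (A + B * x coin5) k = ∏ n, (α k n + β k n * x n) := by
    intro x
    rw [Fin.prod_univ_six]
    fin_cases k <;>
      simp only [mixture, α, β, Fin.zero_eta, Fin.mk_one, Fin.reduceFinMk, Matrix.cons_val] <;>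
      ring
  simp only [h]
  exact integral_coinLaw_prod p (α k) (β k)

section Protocol

variable (θ : Params) (μ₁ μ₂ : ℝ)

open Classical in
/-- Constant part of the activity of the users. -/
def userConst (s : State) : ℝ :=
  if UsesCoin5 θ μ₁ μ₂ then 0 else if optVal θ μ₁ μ₂ 6 s ≤ userBest θ μ₁ μ₂ s then 1 else 0

open Classical in
/-- Dependence of the activity of the users on the fifth coin. -/
def userSlope : ℝ := if UsesCoin5 θ μ₁ μ₂ then 1 else 0

/-- The activity of the users, if the fifth coin has expectation `y`. -/
def userAct (y : ℝ) (s : State) : ℝ := userConst θ μ₁ μ₂ s + userSlope θ μ₁ μ₂ * y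

/-- The stationary policy that is equivalent to the protocol. -/
def protoPolicy (p : Fin 6 → I) (k : Opt) (s : State) : ℝ :=
  mixture (fun n => p n) (userAct θ μ₁ μ₂ (p coin5) s) k

/-- The coins that are not flipped, with their constant values. -/
structure ConstantCoins (p : Fin 6 → I) : Prop where
  one : μ₂ ≠ 1 - θ.η → p coin1 = 1
  two : μ₁ ≠ θ.η → p coin2 = 1
  three : μ₁ ≠ 0 → p coin3 = 1
  four : μ₂ ≠ 0 → p coin4 = 1
  six₀ : θ.η - μ₁ < 1 - θ.η - μ₂ → p coin6 = 0
  six₁ : 1 - θ.η - μ₂ < θ.η - μ₁ → p coin6 = 1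

/-- Outcomes of the coins that are compatible with the constant coins. -/
structure GoodFlips (c : Fin 6 → Bool) : Prop where
  one : μ₂ ≠ 1 - θ.η → c coin1 = true
  two : μ₁ ≠ θ.η → c coin2 = true
  three : μ₁ ≠ 0 → c coin3 = true
  four : μ₂ ≠ 0 → c coin4 = true
  six₀ : θ.η - μ₁ < 1 - θ.η - μ₂ → c coin6 = false
  six₁ : 1 - θ.η - μ₂ < θ.η - μ₁ → c coin6 = true

variable {θ μ₁ μ₂}

lemma userAct_mem {y : ℝ} (hy : 0 ≤ y ∧ y ≤ 1) (s : State) :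
    0 ≤ userAct θ μ₁ μ₂ y s ∧ userAct θ μ₁ μ₂ y s ≤ 1 := by
  unfold userAct userConst userSlope
  split_ifs <;> simp [hy]

lemma measurable_userConst : Measurable (userConst θ μ₁ μ₂) := by
  unfold userConst
  by_cases h : UsesCoin5 θ μ₁ μ₂
  · simp only [if_pos h]
    exact measurable_const
  · simp only [if_neg h]
    exact Measurable.ite (measurableSet_le (measurable_optVal θ μ₁ μ₂ 6)
      ((measurable_optVal θ μ₁ μ₂ 2).max (measurable_optVal θ μ₁ μ₂ 3))) measurable_const
      measurable_const

lemma measurable_mixture {α : Type*} [MeasurableSpace α] {x : Fin 6 → α → ℝ} {u : α → ℝ}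
    (hx : ∀ n, Measurable (x n)) (hu : Measurable u) (k : Opt) :
    Measurable fun z => mixture (fun n => x n z) (u z) k := by
  have h1 : Measurable fun z => 1 - u z := hu.const_sub 1
  have h2 : ∀ n, Measurable fun z => 1 - x n z := fun n => (hx n).const_sub 1
  fin_cases k
  exacts [hu.mul (h2 _), hu.mul (h2 _), hu.mul (((hx _).mul (hx _)).mul (h2 _)),
    hu.mul (((hx _).mul (hx _)).mul (hx _)), h1.mul (h2 _), h1.mul (h2 _),
    h1.mul ((hx _).mul (hx _))]

lemma measurable_userAct (y : ℝ) : Measurable (userAct θ μ₁ μ₂ y) :=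
  measurable_userConst.add_const _

lemma ConstantCoins.ae_goodFlips {p : Fin 6 → I} (hp : ConstantCoins θ μ₁ μ₂ p) :
    ∀ᵐ c ∂(coinLaw p), GoodFlips θ μ₁ μ₂ c := by
  have ht : ∀ (n : Fin 6) (P : Prop), (P → p n = 1) → ∀ᵐ c ∂(coinLaw p), P → c n = true :=
    fun n P h => by
      by_cases hP : P
      · exact (ae_coin_eq_true (h hP)).mono fun c hc _ => hc
      · exact Eventually.of_forall fun c h' => absurd h' hP
  have hf : ∀ (n : Fin 6) (P : Prop), (P → p n = 0) → ∀ᵐ c ∂(coinLaw p), P → c n = false :=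
    fun n P h => by
      by_cases hP : P
      · exact (ae_coin_eq_false (h hP)).mono fun c hc _ => hc
      · exact Eventually.of_forall fun c h' => absurd h' hP
  filter_upwards [ht _ _ hp.one, ht _ _ hp.two, ht _ _ hp.three, ht _ _ hp.four, hf _ _ hp.six₀,
    ht _ _ hp.six₁] with c h1 h2 h3 h4 h5 h6
  exact ⟨h1, h2, h3, h4, h5, h6⟩

/-- The total mass is 1 because in each of the pairs of coins 1, 2 and 3, 4 at least one coin is
constantly 1; the corners where both would be free are not admissible. -/
lemma isPolicy_protoPolicy (ha : Admissible θ μ₁ μ₂) {p : Fin 6 → I}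
    (hp : ConstantCoins θ μ₁ μ₂ p) : IsPolicy (protoPolicy θ μ₁ μ₂ p) := by
  have hu := fun s => userAct_mem (θ := θ) (μ₁ := μ₁) (μ₂ := μ₂) (p coin5).2 s
  refine ⟨fun k => measurable_mixture (fun n => measurable_const) (measurable_userAct _) k,
    fun k s => mixture_nonneg (fun n => (p n).2) (hu s) k, fun s => ?_⟩
  unfold protoPolicy
  rw [sum_mixture]
  have h1 : (1 - (p coin1 : ℝ)) * (1 - (p coin2 : ℝ)) = 0 := by
    by_cases h : μ₂ = 1 - θ.η
    · rw [hp.two fun h' => ha.ne_top ⟨h', h⟩]; simp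
    · rw [hp.one h]; simp
  have h2 : (1 - (p coin3 : ℝ)) * (1 - (p coin4 : ℝ)) = 0 := by
    by_cases h : μ₁ = 0
    · rw [hp.four fun h' => ha.ne_zero ⟨h, h'⟩]; simp
    · rw [hp.three h]; simp
  rw [h1, h2]
  ring

/-- The mode of the users that is a candidate. -/
def userIdx (c : Fin 6 → Bool) : Fin 6 := if c coin1 then if c coin2 then 2 else 1 else 0

/-- The mode of the relay that is a candidate. -/
def relayIdx (c : Fin 6 → Bool) : Fin 6 := if c coin3 then if c coin4 then 5 else 4 else 3

/-- A coin can only deviate from its constant value where the weights tie the options concerned, so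
every candidate attains the best metric of its group. -/
lemma metric_userIdx (hθ : θ.Valid) (ha : Admissible θ μ₁ μ₂) {c : Fin 6 → Bool}
    (hc : GoodFlips θ μ₁ μ₂ c) {s : State} (hs : 0 < s.1 ∧ 0 < s.2) :
    metric θ μ₁ μ₂ (protoT c) s (userIdx c) = userBest θ μ₁ μ₂ s := by
  have hu := fun k hk => (user_le hθ ha hs (k := k) hk).2
  have e := optVal_eq θ μ₁ μ₂
  unfold userIdx
  cases h1 : c coin1
  · have h : μ₂ = 1 - θ.η := by by_contra h; simp [hc.one h] at h1
    rw [← (hu 0 (by decide)).2 h, e]; rfl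
  cases h2 : c coin2
  · have h : μ₁ = θ.η := by by_contra h; simp [hc.two h] at h2
    rw [← (hu 1 (by decide)).2 h, e]; rfl
  simp only [if_true]
  unfold protoT flip
  cases h6 : c coin6
  · have h : θ.η - μ₁ ≤ 1 - θ.η - μ₂ := by
      by_contra! h; simp [hc.six₁ h] at h6
    rw [← (hu 2 (by decide)).2 h, e]; rfl
  · have h : 1 - θ.η - μ₂ ≤ θ.η - μ₁ := by
      by_contra! h; simp [hc.six₀ h] at h6
    rw [← (hu 3 (by decide)).2 h, e]; rfl

lemma metric_relayIdx (hθ : θ.Valid) (ha : Admissible θ μ₁ μ₂) {c : Fin 6 → Bool}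
    (hc : GoodFlips θ μ₁ μ₂ c) {s : State} (hs : 0 < s.1 ∧ 0 < s.2) :
    metric θ μ₁ μ₂ (protoT c) s (relayIdx c) = optVal θ μ₁ μ₂ 6 s := by
  have hu := fun k hk => (relay_le hθ ha hs (k := k) hk).2
  have e := optVal_eq θ μ₁ μ₂
  unfold relayIdx
  cases h1 : c coin3
  · have h : μ₁ = 0 := by by_contra h; simp [hc.three h] at h1
    rw [← (hu 4 (by decide)).2 h, e]; rfl
  cases h2 : c coin4
  · have h : μ₂ = 0 := by by_contra h; simp [hc.four h] at h2
    rw [← (hu 5 (by decide)).2 h, e]; rfl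
  rw [e]; rfl

/-- Coins 1 and 2 never both show 0, nor do coins 3 and 4. So each group has exactly one candidate.
-/
lemma indicator_eq (ha : Admissible θ μ₁ μ₂) {c : Fin 6 → Bool} (hc : GoodFlips θ μ₁ μ₂ c)
    (a b : ℝ) (k : Fin 6) :
    ![(1 - flip c coin1) * a, (1 - flip c coin2) * a, flip c coin1 * flip c coin2 * a,
      (1 - flip c coin3) * b, (1 - flip c coin4) * b, flip c coin3 * flip c coin4 * b] k =
    if k = userIdx c then a else if k = relayIdx c then b else 0 := by
  have h12 : c coin1 = false → c coin2 = true := fun h => hc.two fun h' => by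
    refine ha.ne_top ⟨h', ?_⟩
    by_contra h''
    simp [hc.one h''] at h
  have h34 : c coin3 = false → c coin4 = true := fun h => hc.four fun h' => by
    refine ha.ne_zero ⟨?_, h'⟩
    by_contra h''
    simp [hc.three h''] at h
  unfold userIdx relayIdx flip
  cases h1 : c coin1 <;> cases h2 : c coin2 <;> cases h3 : c coin3 <;> cases h4 : c coin4 <;>
    simp_all <;> fin_cases k <;> simp

lemma userIdx_lt_relayIdx (c : Fin 6 → Bool) : userIdx c < relayIdx c := by
  unfold userIdx relayIdx
  split_ifs <;> decide

/-- The mode that the protocol selects. -/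
def selectedMode (θ : Params) (μ₁ μ₂ : ℝ) (c : Fin 6 → Bool) (s : State) : Fin 6 :=
  if userAct θ μ₁ μ₂ (flip c coin5) s = 1 then userIdx c else relayIdx c

lemma first_argmax {v : Fin 6 → ℝ} {k₀ : Fin 6} (h1 : ∀ j, v j ≤ v k₀)
    (h2 : ∀ j, j < k₀ → v j < v k₀) (k : Fin 6) :
    ((∀ j, v j ≤ v k) ∧ ∀ j, j < k → v j < v k) ↔ k = k₀ := by
  constructor
  · rintro ⟨h3, h4⟩
    rcases lt_trichotomy k k₀ with h | h | h
    · exact absurd (h2 k h) (not_lt.2 (h3 k₀))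
    · exact h
    · exact absurd (h4 k₀ h) (not_lt.2 (h1 k))
  · rintro rfl
    exact ⟨h1, h2⟩

/-- The protocol compares one user candidate with one relay candidate. Both metrics are positive, so
modes with zero indicator lose. On a tie the smallest index favours the users, in agreement with the
non-strict inequality in `userConst`. -/
lemma protoQ_eq (hθ : θ.Valid) (ha : Admissible θ μ₁ μ₂) {c : Fin 6 → Bool}
    (hc : GoodFlips θ μ₁ μ₂ c) {s : State} (hs : 0 < s.1 ∧ 0 < s.2) (k : Fin 6) :
    protoQ θ μ₁ μ₂ c s k = if k = selectedMode θ μ₁ μ₂ c s then 1 else 0 := by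
  classical
  have hW := userBest_pos hθ ha hs
  have hR := relayBest_pos hθ ha hs
  have hmu := metric_userIdx hθ ha hc hs
  have hmr := metric_relayIdx hθ ha hc hs
  have hlt := userIdx_lt_relayIdx c
  set W := userBest θ μ₁ μ₂ s
  set R := optVal θ μ₁ μ₂ 6 s
  obtain ⟨a, b, hab, hsel⟩ : ∃ a b : ℝ,
      (∀ k, weighted θ μ₁ μ₂ c s k =
        if k = userIdx c then a * W else if k = relayIdx c then b * R else 0) ∧
      ((a * W = W ∧ b * R ≤ W ∧ selectedMode θ μ₁ μ₂ c s = userIdx c) ∨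
        (b * R = R ∧ a * W < R ∧ selectedMode θ μ₁ μ₂ c s = relayIdx c)) := by
    refine ⟨if UsesCoin5 θ μ₁ μ₂ then flip c coin5 else 1,
      if UsesCoin5 θ μ₁ μ₂ then 1 - flip c coin5 else 1, fun k => ?_, ?_⟩
    · rw [weighted, indicator, indicator_eq ha hc]
      by_cases h1 : k = userIdx c
      · rw [if_pos h1, if_pos h1, h1, hmu]
      · rw [if_neg h1, if_neg h1]
        by_cases h2 : k = relayIdx c
        · rw [if_pos h2, if_pos h2, h2, hmr]
        · rw [if_neg h2, if_neg h2, zero_mul]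
    · unfold selectedMode userAct userConst userSlope
      by_cases h5 : UsesCoin5 θ μ₁ μ₂
      · simp only [if_pos h5, flip]
        cases c coin5
        · right; simp [hR]
        · left; simp [hW.le]
      · simp only [if_neg h5]
        rcases le_or_gt R W with h | h
        · refine Or.inl ⟨one_mul W, by rwa [one_mul], ?_⟩
          rw [if_pos (show optVal θ μ₁ μ₂ 6 s ≤ userBest θ μ₁ μ₂ s from h)]
          simp
        · refine Or.inr ⟨one_mul R, by rwa [one_mul], ?_⟩
          rw [if_neg (show ¬optVal θ μ₁ μ₂ 6 s ≤ userBest θ μ₁ μ₂ s from not_le.2 h)]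
          simp
  unfold protoQ
  have key : ((∀ j, weighted θ μ₁ μ₂ c s j ≤ weighted θ μ₁ μ₂ c s k) ∧
      ∀ j, j < k → weighted θ μ₁ μ₂ c s j < weighted θ μ₁ μ₂ c s k) ↔
      k = selectedMode θ μ₁ μ₂ c s := by
    simp only [hab]
    rcases hsel with ⟨h1, h2, h3⟩ | ⟨h1, h2, h3⟩
    · rw [h3]
      refine first_argmax (v := fun k =>
        if k = userIdx c then a * W else if k = relayIdx c then b * R else 0)
        (fun j => ?_) (fun j hj => ?_) k
      · simp only [if_true, h1]
        split_ifs <;> linarith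
      · simp only [if_true, h1, if_neg hj.ne, if_neg (hj.trans hlt).ne, hW]
    · rw [h3]
      refine first_argmax (v := fun k =>
        if k = userIdx c then a * W else if k = relayIdx c then b * R else 0)
        (fun j => ?_) (fun j hj => ?_) k
      · simp only [if_true, h1, if_neg hlt.ne']
        split_ifs <;> linarith
      · simp only [if_true, h1, if_neg hlt.ne', if_neg hj.ne]
        split_ifs <;> linarith
  simp only [key]

lemma userAct_flip (c : Fin 6 → Bool) (s : State) :
    userAct θ μ₁ μ₂ (flip c coin5) s = 0 ∨ userAct θ μ₁ μ₂ (flip c coin5) s = 1 := by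
  unfold userAct userConst userSlope flip
  split_ifs <;> simp

/-- The 0-1 selection is the value of the mixture formula at the coin outcomes; averaging this
formula over the coins then leads to `protoPolicy`. -/
lemma share_protoQ (hθ : θ.Valid) (ha : Admissible θ μ₁ μ₂) {c : Fin 6 → Bool}
    (hc : GoodFlips θ μ₁ μ₂ c) {s : State} (hs : 0 < s.1 ∧ 0 < s.2) :
    share (protoQ θ μ₁ μ₂ c s) (protoT c) =
      mixture (flip c) (userAct θ μ₁ μ₂ (flip c coin5) s) := by
  have h12 : c coin1 = false → c coin2 = true := fun h => hc.two fun h' => by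
    refine ha.ne_top ⟨h', ?_⟩
    by_contra h''
    simp [hc.one h''] at h
  have h34 : c coin3 = false → c coin4 = true := fun h => hc.four fun h' => by
    refine ha.ne_zero ⟨?_, h'⟩
    by_contra h''
    simp [hc.three h''] at h
  have hq := protoQ_eq hθ ha hc hs
  unfold share
  simp only [hq]
  unfold selectedMode mixture protoT
  rcases userAct_flip (θ := θ) (μ₁ := μ₁) (μ₂ := μ₂) c s with h | h <;> rw [h]
  · unfold relayIdx flip
    cases h3 : c coin3 <;> cases h4 : c coin4 <;> simp_all [M1, M2, M3, M4, M5, M6]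
  · unfold userIdx flip
    cases h1 : c coin1 <;> cases h2 : c coin2 <;> simp_all [M1, M2, M3, M4, M5, M6]

lemma sum_protoQ (hθ : θ.Valid) (ha : Admissible θ μ₁ μ₂) {c : Fin 6 → Bool}
    (hc : GoodFlips θ μ₁ μ₂ c) {s : State} (hs : 0 < s.1 ∧ 0 < s.2) :
    ∑ k, protoQ θ μ₁ μ₂ c s k = 1 := by
  simp [protoQ_eq hθ ha hc hs]

/-- The policy of the protocol maximizes the Lagrangian. -/
lemma maximizes_protoPolicy (hθ : θ.Valid) {m : Measure State} (hm : IsSlotLaw m)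
    (ha : Admissible θ μ₁ μ₂) {p : Fin 6 → I} (hp : ConstantCoins θ μ₁ μ₂ p) :
    Maximizes m θ μ₁ μ₂ (protoPolicy θ μ₁ μ₂ p) := by
  filter_upwards [hm.pos] with s hs
  refine sum_eq_maxVal_of_forall ((isPolicy_protoPolicy ha hp).sum_eq s) fun k hk => ?_
  rw [optVal_eq_maxVal_iff hθ ha hs]
  have hu : userAct θ μ₁ μ₂ (p coin5) s ≠ 0 → optVal θ μ₁ μ₂ 6 s ≤ userBest θ μ₁ μ₂ s := by
    intro h
    by_cases h5 : UsesCoin5 θ μ₁ μ₂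
    · exact (userBest_eq_of_usesCoin5 hθ h5 hs).le
    · by_contra hc
      simp [userAct, userConst, userSlope, h5, hc] at h
  have hr : 1 - userAct θ μ₁ μ₂ (p coin5) s ≠ 0 → userBest θ μ₁ μ₂ s ≤ optVal θ μ₁ μ₂ 6 s := by
    intro h
    by_cases h5 : UsesCoin5 θ μ₁ μ₂
    · exact (userBest_eq_of_usesCoin5 hθ h5 hs).ge
    · by_contra hc
      simp [userAct, userConst, userSlope, h5, (not_le.1 hc).le] at h
  have hone : ∀ {n : Fin 6}, 1 - (p n : ℝ) ≠ 0 → p n ≠ 1 := fun h h' => by simp [h'] at h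
  have hzero : ∀ {n : Fin 6}, (p n : ℝ) ≠ 0 → p n ≠ 0 := fun h h' => by simp [h'] at h
  have big : ∀ {k : Opt}, k ≤ 3 → 3 < k → userBest θ μ₁ μ₂ s ≤ optVal θ μ₁ μ₂ 6 s :=
    fun h h' => absurd h (not_le.2 h')
  have small : ∀ {k : Opt}, 3 < k → k ≤ 3 → optVal θ μ₁ μ₂ 6 s ≤ userBest θ μ₁ μ₂ s :=
    fun h h' => absurd h' (not_le.2 h)
  unfold protoPolicy at hk
  fin_cases k
  · obtain ⟨h1, h2⟩ := mul_ne_zero_iff.1 hk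
    exact ⟨by_contra fun h => hone h2 (hp.one h), fun _ => hu h1, big (by decide)⟩
  · obtain ⟨h1, h2⟩ := mul_ne_zero_iff.1 hk
    exact ⟨by_contra fun h => hone h2 (hp.two h), fun _ => hu h1, big (by decide)⟩
  · obtain ⟨h1, h2⟩ := mul_ne_zero_iff.1 hk
    obtain ⟨-, h3⟩ := mul_ne_zero_iff.1 h2
    exact ⟨not_lt.1 fun h => hone h3 (hp.six₁ h), fun _ => hu h1, big (by decide)⟩
  · obtain ⟨h1, h2⟩ := mul_ne_zero_iff.1 hk
    obtain ⟨-, h3⟩ := mul_ne_zero_iff.1 h2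
    exact ⟨not_lt.1 fun h => hzero h3 (hp.six₀ h), fun _ => hu h1, big (by decide)⟩
  · obtain ⟨h1, h2⟩ := mul_ne_zero_iff.1 hk
    exact ⟨by_contra fun h => hone h2 (hp.three h), small (by decide), fun _ => hr h1⟩
  · obtain ⟨h1, h2⟩ := mul_ne_zero_iff.1 hk
    exact ⟨by_contra fun h => hone h2 (hp.four h), small (by decide), fun _ => hr h1⟩
  · obtain ⟨h1, h2⟩ := mul_ne_zero_iff.1 hk
    exact ⟨trivial, small (by decide), fun _ => hr h1⟩

end Protocol

/-! ### Channel and coins together -/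

section Joint

variable {ν : Measure (ℕ → State)} (hν : IsChannel ν) (p : Fin 6 → I)

/-- The joint law of channel state and coins in a slot. -/
def jointLaw (ν : Measure (ℕ → State)) (p : Fin 6 → I) : Measure (State × (Fin 6 → Bool)) :=
  (slotLaw ν).prod (coinLaw p)

lemma law_eq (ν : Measure (ℕ → State)) (p : Fin 6 → I) :
    law ν p = ν.prod (Measure.infinitePi fun _ : ℕ => coinLaw p) := rfl

include hν

lemma measurePreserving_joint (i : ℕ) :
    MeasurePreserving (fun ω : Outcome => (ω.1 i, ω.2 i)) (law ν p) (jointLaw ν p) := by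
  have := hν.prob
  have := (isSlotLaw hν).prob
  exact (measurePreserving_slot hν i).prod
    (measurePreserving_eval_infinitePi (fun _ : ℕ => coinLaw p) i)

lemma ae_forall_joint {P : State × (Fin 6 → Bool) → Prop} (h : ∀ᵐ z ∂(jointLaw ν p), P z) :
    ∀ᵐ ω ∂(law ν p), ∀ i, P (ω.1 i, ω.2 i) :=
  ae_all_iff.2 fun i => (measurePreserving_joint hν p i).quasiMeasurePreserving.ae h

lemma ae_hasAverage_joint {f : State × (Fin 6 → Bool) → ℝ} (hf : Measurable f)
    (hfi : Integrable f (jointLaw ν p)) :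
    ∀ᵐ ω ∂(law ν p), HasAverage (fun i => f (ω.1 i, ω.2 i)) (∫ z, f z ∂(jointLaw ν p)) := by
  have := hν.prob
  have h0 := measurePreserving_joint hν p 0
  have hprob : IsProbabilityMeasure (law ν p) := by rw [law_eq]; infer_instance
  have herg : Ergodic (Prod.map shift shift) (law ν p) :=
    ergodic_prod_shift hν.ergodic_shift (coinLaw p)
  have h1 := ae_tendsto_birkhoffSum_div herg (hf.comp h0.measurable)
    (h0.integrable_comp_of_integrable hfi)
  have h2 : ∫ ω, (f ∘ fun ω : Outcome => (ω.1 0, ω.2 0)) ω ∂(law ν p)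
      = ∫ z, f z ∂(jointLaw ν p) := by
    rw [← h0.map_eq, integral_map h0.measurable.aemeasurable hf.aestronglyMeasurable]
    rfl
  rw [h2] at h1
  filter_upwards [h1] with ω hω
  refine hω.congr fun n => ?_
  simp [birkhoffSum, Prod.map_iterate, shift_iterate]

lemma isProbabilityMeasure_law : IsProbabilityMeasure (law ν p) := by
  have := hν.prob
  rw [law_eq]; infer_instance

variable {θ : Params} {μ₁ μ₂ : ℝ}

omit hν in
lemma measurable_jointMixture (k : Opt) {h : State → ℝ} (hh : Measurable h) :
    Measurable fun z : State × (Fin 6 → Bool) =>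
      mixture (flip z.2) (userAct θ μ₁ μ₂ (flip z.2 coin5) z.1) k * h z.1 := by
  refine Measurable.mul (measurable_mixture (x := fun n (z : State × (Fin 6 → Bool)) => flip z.2 n)
    (fun n => (measurable_flip n).comp measurable_snd) ?_ k) (hh.comp measurable_fst)
  exact (measurable_userConst.comp measurable_fst).add
    (((measurable_flip coin5).comp measurable_snd).const_mul _)

lemma integrable_jointMixture (k : Opt) {h : State → ℝ} (hh : Measurable h)
    (hi : Integrable h (slotLaw ν)) :
    Integrable (fun z : State × (Fin 6 → Bool) =>
      mixture (flip z.2) (userAct θ μ₁ μ₂ (flip z.2 coin5) z.1) k * h z.1) (jointLaw ν p) := by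
  have := (isSlotLaw hν).prob
  refine (hi.abs.comp_fst (coinLaw p)).mono' (measurable_jointMixture k hh).aestronglyMeasurable
    (Eventually.of_forall fun z => ?_)
  have hu := userAct_mem (θ := θ) (μ₁ := μ₁) (μ₂ := μ₂) (flip_mem z.2 coin5) z.1
  rw [norm_mul, Real.norm_eq_abs, Real.norm_eq_abs,
    abs_of_nonneg (mixture_nonneg (flip_mem z.2) hu k)]
  exact mul_le_of_le_one_left (abs_nonneg _) (mixture_le_one (flip_mem z.2) hu k)

lemma integral_jointMixture (k : Opt) {h : State → ℝ} (hh : Measurable h)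
    (hi : Integrable h (slotLaw ν)) :
    ∫ z : State × (Fin 6 → Bool), mixture (flip z.2) (userAct θ μ₁ μ₂ (flip z.2 coin5) z.1) k * h z.1 ∂(jointLaw ν p)
      = ∫ s, protoPolicy θ μ₁ μ₂ p k s * h s ∂(slotLaw ν) := by
  have := (isSlotLaw hν).prob
  rw [jointLaw, integral_prod _ (integrable_jointMixture hν p k hh hi)]
  refine integral_congr_ae (Eventually.of_forall fun s => ?_)
  simp only
  rw [integral_mul_const]
  congr 1
  exact integral_mixture p _ _ k

lemma integral_sum_jointMixture {h : Opt → State → ℝ} (hh : ∀ k, Measurable (h k))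
    (hi : ∀ k, Integrable (h k) (slotLaw ν)) :
    ∫ z : State × (Fin 6 → Bool), ∑ k, mixture (flip z.2) (userAct θ μ₁ μ₂ (flip z.2 coin5) z.1) k * h k z.1
        ∂(jointLaw ν p)
      = ∫ s, ∑ k, protoPolicy θ μ₁ μ₂ p k s * h k s ∂(slotLaw ν) := by
  have hpm : ∀ k, Measurable (protoPolicy θ μ₁ μ₂ p k) := fun k =>
    measurable_mixture (fun n => measurable_const) (measurable_userAct _) k
  rw [integral_finsetSum _ fun k _ => integrable_jointMixture hν p k (hh k) (hi k),
    integral_finsetSum]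
  · exact sum_congr rfl fun k _ => integral_jointMixture hν p k (hh k) (hi k)
  · intro k _
    refine (hi k).bdd_mul (c := 1) (hpm k).aestronglyMeasurable
      (Eventually.of_forall fun s => ?_)
    have hu := userAct_mem (θ := θ) (μ₁ := μ₁) (μ₂ := μ₂) (p coin5).2 s
    rw [Real.norm_eq_abs, protoPolicy, abs_of_nonneg (mixture_nonneg (fun n => (p n).2) hu k)]
    exact mixture_le_one (fun n => (p n).2) hu k

variable {p}

lemma ae_joint_good (hp : ConstantCoins θ μ₁ μ₂ p) :
    ∀ᵐ z ∂(jointLaw ν p), (0 < z.1.1 ∧ 0 < z.1.2) ∧ GoodFlips θ μ₁ μ₂ z.2 := by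
  have := (isSlotLaw hν).prob
  have h1 : ∀ᵐ z ∂(jointLaw ν p), 0 < z.1.1 ∧ 0 < z.1.2 :=
    Measure.quasiMeasurePreserving_fst.ae (isSlotLaw hν).pos
  have h2 : ∀ᵐ z ∂(jointLaw ν p), GoodFlips θ μ₁ μ₂ z.2 :=
    Measure.quasiMeasurePreserving_snd.ae hp.ae_goodFlips
  exact h1.and h2

/-- Expectations of functions that depend linearly on the option mixture of the protocol. -/
lemma expect_eq (hθ : θ.Valid) (ha : Admissible θ μ₁ μ₂) (hp : ConstantCoins θ μ₁ μ₂ p)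
    {f : (Fin 6 → Bool) → State → ℝ} {h : Opt → State → ℝ} (hh : ∀ k, Measurable (h k))
    (hi : ∀ k, Integrable (h k) (slotLaw ν))
    (hf : ∀ c s, 0 < s.1 ∧ 0 < s.2 → ∑ k, protoQ θ μ₁ μ₂ c s k = 1 →
      f c s = ∑ k, share (protoQ θ μ₁ μ₂ c s) (protoT c) k * h k s) :
    expect ν p f = ∫ s, ∑ k, protoPolicy θ μ₁ μ₂ p k s * h k s ∂(slotLaw ν) := by
  have h0 := measurePreserving_joint hν p 0
  rw [← integral_sum_jointMixture hν p hh hi, ← h0.map_eq, integral_map h0.measurable.aemeasurable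
    (Finset.measurable_sum _ fun k _ => measurable_jointMixture k (hh k)).aestronglyMeasurable]
  refine integral_congr_ae ?_
  filter_upwards [h0.quasiMeasurePreserving.ae (ae_joint_good hν hp)] with ω hω
  rw [hf _ _ hω.1 (sum_protoQ hθ ha hω.2 hω.1), share_protoQ hθ ha hω.2 hω.1]

/-- Channel and coins together are ergodic under the product shift, so the rates are means over the
joint slot law, in which the coins can be integrated out first. -/
lemma ae_hasRates (hθ : θ.Valid) (ha : Admissible θ μ₁ μ₂) (hp : ConstantCoins θ μ₁ μ₂ p) :
    ∀ᵐ ω ∂(law ν p), HasRates θ ω.1 (fun i => protoQ θ μ₁ μ₂ (ω.2 i) (ω.1 i))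
      (fun i => protoT (ω.2 i)) (expRate (slotLaw ν) θ (protoPolicy θ μ₁ μ₂ p) 0)
      (expRate (slotLaw ν) θ (protoPolicy θ μ₁ μ₂ p) 1)
      (expRate (slotLaw ν) θ (protoPolicy θ μ₁ μ₂ p) 2)
      (expRate (slotLaw ν) θ (protoPolicy θ μ₁ μ₂ p) 3) := by
  have hm := isSlotLaw hν
  have h1 : ∀ j, ∀ᵐ ω ∂(law ν p), HasAverage (fun i => ∑ k, mixture (flip (ω.2 i))
      (userAct θ μ₁ μ₂ (flip (ω.2 i) coin5) (ω.1 i)) k * optRate θ k j (ω.1 i))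
      (expRate (slotLaw ν) θ (protoPolicy θ μ₁ μ₂ p) j) := fun j => by
    rw [expRate, ← integral_sum_jointMixture hν p (fun k => measurable_optRate θ k j)
      (fun k => integrable_optRate hθ hm k j)]
    exact ae_hasAverage_joint hν p (f := fun z => ∑ k, mixture (flip z.2)
      (userAct θ μ₁ μ₂ (flip z.2 coin5) z.1) k * optRate θ k j z.1)
      (Finset.measurable_sum _ fun k _ => measurable_jointMixture k (measurable_optRate θ k j))
      (integrable_finsetSum _ fun k _ => integrable_jointMixture hν p k (measurable_optRate θ k j)
        (integrable_optRate hθ hm k j))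
  filter_upwards [ae_all_iff.2 h1, ae_forall_joint hν p (ae_joint_good hν hp)] with ω hω hg
  refine hasRates_iff.2 fun j => (hω j).congr fun i => ?_
  rw [slotRate_eq, share_protoQ hθ ha (hg i).2 (hg i).1]

/-- Long-term averages are unique and almost surely constant, so a checked constraint is an equation
between mean rates. -/
lemma protocolRates_iff (hθ : θ.Valid) (ha : Admissible θ μ₁ μ₂) (hp : ConstantCoins θ μ₁ μ₂ p)
    (P : ℝ → ℝ → ℝ → ℝ → Prop) : ProtocolRates ν θ μ₁ μ₂ p P ↔
      P (expRate (slotLaw ν) θ (protoPolicy θ μ₁ μ₂ p) 0)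
        (expRate (slotLaw ν) θ (protoPolicy θ μ₁ μ₂ p) 1)
        (expRate (slotLaw ν) θ (protoPolicy θ μ₁ μ₂ p) 2)
        (expRate (slotLaw ν) θ (protoPolicy θ μ₁ μ₂ p) 3) := by
  have := isProbabilityMeasure_law hν p
  have hr := ae_hasRates hν hθ ha hp
  constructor
  · intro h
    obtain ⟨ω, h1, a, b, c, d, h2, h3⟩ := (hr.and h).exists
    rwa [h1.h1r.unique h2.h1r, h1.h2r.unique h2.h2r, h1.hr1.unique h2.hr1, h1.hr2.unique h2.hr2]
  · intro h
    filter_upwards [hr] with ω hω using ⟨_, _, _, _, hω, h⟩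

lemma protocolOptimal_of_balanced (hθ : θ.Valid) (ha : Admissible θ μ₁ μ₂)
    (hp : ConstantCoins θ μ₁ μ₂ p) (hb : Balanced (slotLaw ν) θ (protoPolicy θ μ₁ μ₂ p)) :
    ProtocolOptimal ν θ μ₁ μ₂ p := by
  have hm := isSlotLaw hν
  have := hν.prob
  have hD : ∀ᵐ ω ∂(law ν p), HasAverage (fun i => maxVal fun k => optVal θ μ₁ μ₂ k (ω.1 i))
      (dualVal (slotLaw ν) θ μ₁ μ₂) :=
    (Measure.quasiMeasurePreserving_fst (μ := ν)).ae
      (ae_hasAverage_maxVal hν hθ (coef θ μ₁ μ₂))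
  filter_upwards [hD, ae_hasRates hν hθ ha hp,
    ae_forall_joint hν p (ae_joint_good hν hp)] with ω h1 h2 hg
  refine isSolution_of_sum_coef_eq (R := expRate (slotLaw ν) θ (protoPolicy θ μ₁ μ₂ p)) h1
    ⟨h2, hb.1, hb.2, fun i => sum_protoQ hθ ha (hg i).2 (hg i).1, fun i k => ?_,
      fun i => flip_mem _ _⟩
    ((maximizes_iff hθ hm (isPolicy_protoPolicy ha hp) _ _).1
      (maximizes_protoPolicy hθ hm ha hp))
  unfold protoQ
  split_ifs <;> norm_num

end Joint

/-! ### Means of the rates of the protocol -/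

/-- A share of each slot. -/
structure IsActivity (u : State → ℝ) : Prop where
  measurable : Measurable u
  nonneg : ∀ s, 0 ≤ u s
  le_one : ∀ s, u s ≤ 1

lemma IsActivity.compl {u : State → ℝ} (hu : IsActivity u) : IsActivity fun s => 1 - u s :=
  ⟨hu.measurable.const_sub 1, fun s => sub_nonneg.2 (hu.le_one s),
    fun s => sub_le_self _ (hu.nonneg s)⟩

lemma _root_.RandomizedPolicy.IsPolicy.isActivity {w : Opt → State → ℝ} (hw : IsPolicy w)
    (k : Opt) : IsActivity (w k) :=
  ⟨hw.measurable k, hw.nonneg k, hw.le_one k⟩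

lemma isActivity_userAct {θ : Params} {μ₁ μ₂ : ℝ} (y : I) : IsActivity (userAct θ μ₁ μ₂ y) :=
  ⟨measurable_userAct _, fun s => (userAct_mem y.2 s).1, fun s => (userAct_mem y.2 s).2⟩

/-- The mean of `h` over the share `u` of the slots. -/
def partMean (m : Measure State) (u h : State → ℝ) : ℝ := ∫ s, u s * h s ∂m

section PartMean

variable {m : Measure State} {u v f g h : State → ℝ}

lemma IsActivity.integrable_mul (hu : IsActivity u) (hh : Integrable h m) :
    Integrable (fun s => u s * h s) m :=
  hh.bdd_mul (c := 1) hu.measurable.aestronglyMeasurable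
    (Eventually.of_forall fun s => by
      rw [Real.norm_eq_abs, abs_of_nonneg (hu.nonneg s)]; exact hu.le_one s)

lemma IsActivity.partMean_add (hu : IsActivity u) (hf : Integrable f m) (hg : Integrable g m) :
    partMean m u (fun s => f s + g s) = partMean m u f + partMean m u g := by
  simp only [partMean, mul_add]
  exact integral_add (hu.integrable_mul hf) (hu.integrable_mul hg)

lemma IsActivity.partMean_sub (hu : IsActivity u) (hf : Integrable f m) (hg : Integrable g m) :
    partMean m u (fun s => f s - g s) = partMean m u f - partMean m u g := by
  simp only [partMean, mul_sub]
  exact integral_sub (hu.integrable_mul hf) (hu.integrable_mul hg)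

lemma IsActivity.partMean_compl (hu : IsActivity u) (hh : Integrable h m) :
    partMean m (fun s => 1 - u s) h = ∫ s, h s ∂m - partMean m u h := by
  simp only [partMean, sub_mul, one_mul]
  exact integral_sub hh (hu.integrable_mul hh)

lemma partMean_congr (huv : ∀ᵐ s ∂m, u s = v s) (h : State → ℝ) :
    partMean m u h = partMean m v h :=
  integral_congr_ae (huv.mono fun s hs => by simp only [hs])

lemma partMean_congr_right (u : State → ℝ) (hfg : ∀ᵐ s ∂m, f s = g s) :
    partMean m u f = partMean m u g :=
  integral_congr_ae (hfg.mono fun s hs => by simp only [hs])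

lemma partMean_zero (m : Measure State) (u : State → ℝ) : partMean m u (fun _ => 0) = 0 := by
  simp [partMean]

lemma partMean_eq_zero (hu : ∀ᵐ s ∂m, u s = 0) (h : State → ℝ) : partMean m u h = 0 := by
  rw [partMean_congr (v := fun _ => 0) hu]
  simp [partMean]

lemma partMean_nonneg (hu : IsActivity u) (hp : ∀ᵐ s ∂m, 0 < h s) : 0 ≤ partMean m u h :=
  integral_nonneg_of_ae (hp.mono fun s hs => mul_nonneg (hu.nonneg s) hs.le)

lemma partMean_pos (hu : IsActivity u) (hh : Integrable h m) (hp : ∀ᵐ s ∂m, 0 < h s)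
    (hne : ¬∀ᵐ s ∂m, u s = 0) : 0 < partMean m u h := by
  refine lt_of_le_of_ne (partMean_nonneg hu hp) fun h0 => hne ?_
  have h1 := (integral_eq_zero_iff_of_nonneg_ae
    (hp.mono fun s hs => mul_nonneg (hu.nonneg s) hs.le) (hu.integrable_mul hh)).1 h0.symm
  filter_upwards [h1, hp] with s h2 h3
  exact (mul_eq_zero.1 h2).resolve_right h3.ne'

end PartMean

/-- The probabilities with which the coins select the options, given the active side. -/
def coinShare (x : Fin 6 → ℝ) : Opt → ℝ :=
  ![1 - x coin1, 1 - x coin2, x coin1 * x coin2 * (1 - x coin6), x coin1 * x coin2 * x coin6,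
    1 - x coin3, 1 - x coin4, x coin3 * x coin4]

lemma integral_sum_mixture {m : Measure State} {u : State → ℝ} (hu : IsActivity u)
    (x : Fin 6 → ℝ) {h : Opt → State → ℝ} (hi : ∀ k, Integrable (h k) m) :
    ∫ s, ∑ k, mixture x (u s) k * h k s ∂m =
      ∑ k, coinShare x k * partMean m (if k ≤ 3 then u else fun s => 1 - u s) (h k) := by
  have h1 : ∀ (k : Opt) (s : State), mixture x (u s) k * h k s =
      coinShare x k * ((if k ≤ 3 then u else fun s => 1 - u s) s * h k s) := by
    intro k s
    rw [← mul_assoc]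
    congr 1
    fin_cases k <;> exact mul_comm _ _
  have h2 : ∀ k : Opt, IsActivity (if k ≤ 3 then u else fun s => 1 - u s) := fun k => by
    split_ifs
    exacts [hu, hu.compl]
  simp only [h1]
  rw [integral_finsetSum _ fun k _ => ((h2 k).integrable_mul (hi k)).const_mul _]
  exact sum_congr rfl fun k _ => integral_const_mul _ _

section ProtocolMeans

variable {θ : Params} (hθ : θ.Valid) {m : Measure State} (hm : IsSlotLaw m) {u : State → ℝ}
  (hu : IsActivity u)
include hθ hm hu

/-- The mean rates of a policy that is a mixture according to coins. -/
lemma expRate_mixture (x : Fin 6 → ℝ) :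
    let w : Opt → State → ℝ := fun k s => mixture x (u s) k
    let U := partMean m u
    let V := partMean m fun s => 1 - u s
    expRate m θ w 0 = (1 - x coin1) * U (C1r θ) + x coin1 * x coin2 *
      ((1 - x coin6) * (U (Cr θ) - U (C2r θ)) + x coin6 * U (C1r θ)) ∧
    expRate m θ w 1 = (1 - x coin2) * U (C2r θ) + x coin1 * x coin2 *
      ((1 - x coin6) * U (C2r θ) + x coin6 * (U (Cr θ) - U (C1r θ))) ∧
    expRate m θ w 2 = ((1 - x coin3) + x coin3 * x coin4) * V (Cr1 θ) ∧
    expRate m θ w 3 = ((1 - x coin4) + x coin3 * x coin4) * V (Cr2 θ) := by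
  intro w U V
  have e0 : U (C12r θ 0) = U (Cr θ) - U (C2r θ) := by
    rw [← hu.partMean_sub (integrable_Cr hθ hm) (integrable_C2r hθ hm)]
    exact partMean_congr_right u (hm.pos.mono fun s hs => C12r_zero hθ hs)
  have e1 : U (C21r θ 1) = U (Cr θ) - U (C1r θ) := by
    rw [← hu.partMean_sub (integrable_Cr hθ hm) (integrable_C1r hθ hm)]
    exact partMean_congr_right u (hm.pos.mono fun s hs => C21r_one hθ hs)
  have hr : ∀ j, expRate m θ w j = _ := fun j =>
    integral_sum_mixture hu x fun k => integrable_optRate hθ hm k j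
  have h0 : U (fun _ => 0) = 0 := partMean_zero m u
  have h0' : V (fun _ => 0) = 0 := partMean_zero m _
  have h3 : ∀ j, expRate m θ w j =
      (1 - x coin1) * U (optRate θ 0 j) + (1 - x coin2) * U (optRate θ 1 j) +
      x coin1 * x coin2 * (1 - x coin6) * U (optRate θ 2 j) +
      x coin1 * x coin2 * x coin6 * U (optRate θ 3 j) + (1 - x coin3) * V (optRate θ 4 j) +
      (1 - x coin4) * V (optRate θ 5 j) + x coin3 * x coin4 * V (optRate θ 6 j) := fun j => by
    rw [hr j, sum_opt]
    rfl
  have g0 : ∀ k : Opt, (optRate θ k 0 = if k = 0 ∨ k = 3 then C1r θ else if k = 2 then C12r θ 0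
      else fun _ => 0) := fun k => by
    fin_cases k <;> first | rfl | exact C12r_one_eq θ
  have g1 : ∀ k : Opt, (optRate θ k 1 = if k = 1 ∨ k = 2 then C2r θ else if k = 3 then C21r θ 1
      else fun _ => 0) := fun k => by
    fin_cases k <;> first | rfl | exact C21r_zero_eq θ
  have g2 : ∀ k : Opt, (optRate θ k 2 = if k = 4 ∨ k = 6 then Cr1 θ else fun _ => 0) := fun k => by
    fin_cases k <;> rfl
  have g3 : ∀ k : Opt, (optRate θ k 3 = if k = 5 ∨ k = 6 then Cr2 θ else fun _ => 0) := fun k => by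
    fin_cases k <;> rfl
  refine ⟨?_, ?_, ?_, ?_⟩
  · rw [h3]; simp only [g0]; simp [h0, h0', e0]; ring
  · rw [h3]; simp only [g1]; simp [h0, h0', e1]; ring
  · rw [h3]; simp only [g2]; simp [h0, h0']; ring
  · rw [h3]; simp only [g3]; simp [h0, h0']; ring

lemma partMean_rates_pos (hne : ¬∀ᵐ s ∂m, u s = 0) :
    0 < partMean m u (C1r θ) ∧ 0 < partMean m u (C2r θ) ∧
    partMean m u (C1r θ) < partMean m u (Cr θ) ∧ partMean m u (C2r θ) < partMean m u (Cr θ) ∧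
    partMean m u (Cr θ) < partMean m u (C1r θ) + partMean m u (C2r θ) ∧
    0 < partMean m u (Cr1 θ) ∧ 0 < partMean m u (Cr2 θ) := by
  have i1 := integrable_C1r hθ hm
  have i2 := integrable_C2r hθ hm
  have ir := integrable_Cr hθ hm
  have p1 := partMean_pos hu (ir.sub i1)
    (hm.pos.mono fun s hs => sub_pos.2 (C1r_lt_Cr hθ hs)) hne
  have p2 := partMean_pos hu (ir.sub i2)
    (hm.pos.mono fun s hs => sub_pos.2 (C2r_lt_Cr hθ hs)) hne
  have p3 := partMean_pos hu ((i1.add i2).sub ir)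
    (hm.pos.mono fun s hs => sub_pos.2 (Cr_lt hθ hs)) hne
  have q1 : partMean m u (C1r θ + C2r θ - Cr θ) = _ := hu.partMean_sub (i1.add i2) ir
  have q2 : partMean m u (C1r θ + C2r θ) = _ := hu.partMean_add i1 i2
  have q3 : partMean m u (Cr θ - C1r θ) = _ := hu.partMean_sub ir i1
  have q4 : partMean m u (Cr θ - C2r θ) = _ := hu.partMean_sub ir i2
  rw [q3] at p1
  rw [q4] at p2
  rw [q1, q2] at p3
  exact ⟨partMean_pos hu i1 (hm.pos.mono fun s hs => C1r_pos hθ hs) hne,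
    partMean_pos hu i2 (hm.pos.mono fun s hs => C2r_pos hθ hs) hne, by linarith, by linarith,
    by linarith, partMean_pos hu (integrable_Cr1 hθ hm) (hm.pos.mono fun s hs => Cr1_pos hθ hs) hne,
    partMean_pos hu (integrable_Cr2 hθ hm) (hm.pos.mono fun s hs => Cr2_pos hθ hs) hne⟩

end ProtocolMeans

section Expectations

variable {ν : Measure (ℕ → State)} (hν : IsChannel ν) {θ : Params} (hθ : θ.Valid) {μ₁ μ₂ : ℝ}
  (ha : Admissible θ μ₁ μ₂) {p : Fin 6 → I} (hp : ConstantCoins θ μ₁ μ₂ p)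
include hν hθ ha hp

/-- All expectations in the table that do not involve `t` weight the modes by constants `α`. The
hypothesis on `f` may use that the shares sum to 1, which covers the factors `1 - q`. -/
lemma expect_mode (α : Fin 6 → ℝ) {h : State → ℝ} (hh : Measurable h)
    (hi : Integrable h (slotLaw ν)) {f : (Fin 6 → Bool) → State → ℝ}
    (hf : ∀ c s, ∑ k, protoQ θ μ₁ μ₂ c s k = 1 →
      f c s = (∑ k, α k * protoQ θ μ₁ μ₂ c s k) * h s) :
    expect ν p f =
      (α 0 * (1 - p coin1) + α 1 * (1 - p coin2) + α 2 * (p coin1 * p coin2)) *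
          partMean (slotLaw ν) (userAct θ μ₁ μ₂ (p coin5)) h +
        (α 3 * (1 - p coin3) + α 4 * (1 - p coin4) + α 5 * (p coin3 * p coin4)) *
          partMean (slotLaw ν) (fun s => 1 - userAct θ μ₁ μ₂ (p coin5) s) h := by
  let β : Opt → ℝ := ![α 0, α 1, α 2, α 2, α 3, α 4, α 5]
  rw [expect_eq hν hθ ha hp (h := fun k s => β k * h s) (fun k => hh.const_mul _)
    (fun k => hi.const_mul _) fun c s _ h1 => ?_]
  · have h2 := integral_sum_mixture (m := slotLaw ν) (isActivity_userAct (θ := θ) (μ₁ := μ₁)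
      (μ₂ := μ₂) (p coin5)) (fun n => (p n : ℝ)) (h := fun k s => β k * h s)
      fun k => hi.const_mul _
    have h3 : ∀ (v : State → ℝ) (b : ℝ), partMean (slotLaw ν) v (fun s => b * h s)
        = b * partMean (slotLaw ν) v h := fun v b => by
      simp only [partMean, ← integral_const_mul]
      exact integral_congr_ae (Eventually.of_forall fun s => by ring)
    refine h2.trans ?_
    simp only [h3]
    rw [sum_opt]
    simp [coinShare, β]
    ring
  · rw [hf c s h1, sum_opt, Fin.sum_univ_six]
    simp [share, β]
    ring

end Expectations

/-! ### The conditions of the table in terms of means -/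

/-- Measurable functions with finite mean. -/
structure IsRate (m : Measure State) (h : State → ℝ) : Prop where
  measurable : Measurable h
  integrable : Integrable h m

lemma IsRate.sub {m : Measure State} {f g : State → ℝ} (hf : IsRate m f) (hg : IsRate m g) :
    IsRate m fun s => f s - g s :=
  ⟨hf.measurable.sub hg.measurable, hf.integrable.sub hg.integrable⟩

lemma IsRate.add {m : Measure State} {f g : State → ℝ} (hf : IsRate m f) (hg : IsRate m g) :
    IsRate m fun s => f s + g s :=
  ⟨hf.measurable.add hg.measurable, hf.integrable.add hg.integrable⟩

lemma isRate_caps {θ : Params} (hθ : θ.Valid) {m : Measure State} (hm : IsSlotLaw m) :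
    IsRate m (C1r θ) ∧ IsRate m (C2r θ) ∧ IsRate m (Cr θ) ∧ IsRate m (Cr1 θ) ∧
      IsRate m (Cr2 θ) :=
  ⟨⟨measurable_C1r θ, integrable_C1r hθ hm⟩, ⟨measurable_C2r θ, integrable_C2r hθ hm⟩,
    ⟨measurable_Cr θ, integrable_Cr hθ hm⟩, ⟨measurable_Cr1 θ, integrable_Cr1 hθ hm⟩,
    ⟨measurable_Cr2 θ, integrable_Cr2 hθ hm⟩⟩

lemma Admissible.coins {θ : Params} {μ₁ μ₂ : ℝ} (ha : Admissible θ μ₁ μ₂) {p : Fin 6 → I}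
    (hp : ConstantCoins θ μ₁ μ₂ p) :
    (1 - (p coin1 : ℝ)) * (1 - p coin2) = 0 ∧ (1 - (p coin3 : ℝ)) * (1 - p coin4) = 0 := by
  constructor
  · by_cases h : μ₂ = 1 - θ.η
    · rw [hp.two fun h' => ha.ne_top ⟨h', h⟩]; simp
    · rw [hp.one h]; simp
  · by_cases h : μ₁ = 0
    · rw [hp.four fun h' => ha.ne_zero ⟨h, h'⟩]; simp
    · rw [hp.three h]; simp

section Expectations

variable {ν : Measure (ℕ → State)} (hν : IsChannel ν) {θ : Params} (hθ : θ.Valid) {μ₁ μ₂ : ℝ}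
  (ha : Admissible θ μ₁ μ₂) {p : Fin 6 → I} (hp : ConstantCoins θ μ₁ μ₂ p)

/-- Mean over the slots in which the users are active. -/
def userMean (ν : Measure (ℕ → State)) (θ : Params) (μ₁ μ₂ : ℝ) (p : Fin 6 → I)
    (h : State → ℝ) : ℝ :=
  partMean (slotLaw ν) (userAct θ μ₁ μ₂ (p coin5)) h

/-- Mean over the slots in which the relay is active. -/
def relayMean (ν : Measure (ℕ → State)) (θ : Params) (μ₁ μ₂ : ℝ) (p : Fin 6 → I)
    (h : State → ℝ) : ℝ :=
  partMean (slotLaw ν) (fun s => 1 - userAct θ μ₁ μ₂ (p coin5) s) h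

include hν hθ ha hp

variable {h : State → ℝ} (hh : IsRate (slotLaw ν) h)

section
include hh

lemma expect_M3 : expect ν p (fun c s => protoQ θ μ₁ μ₂ c s M3 * h s) =
    p coin1 * p coin2 * userMean ν θ μ₁ μ₂ p h := by
  rw [expect_mode hν hθ ha hp ![0, 0, 1, 0, 0, 0] hh.measurable hh.integrable
    fun c s _ => by simp [Fin.sum_univ_six]]
  simp [userMean]

lemma expect_M6 : expect ν p (fun c s => protoQ θ μ₁ μ₂ c s M6 * h s) =
    p coin3 * p coin4 * relayMean ν θ μ₁ μ₂ p h := by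
  rw [expect_mode hν hθ ha hp ![0, 0, 0, 0, 0, 1] hh.measurable hh.integrable
    fun c s _ => by simp [Fin.sum_univ_six]]
  simp [relayMean]

lemma expect_M4_add_M6 :
    expect ν p (fun c s => (protoQ θ μ₁ μ₂ c s M4 + protoQ θ μ₁ μ₂ c s M6) * h s) =
    (1 - p coin3 + p coin3 * p coin4) * relayMean ν θ μ₁ μ₂ p h := by
  rw [expect_mode hν hθ ha hp ![0, 0, 0, 1, 0, 1] hh.measurable hh.integrable
    fun c s _ => by simp [Fin.sum_univ_six]]
  simp [relayMean]

lemma expect_M5_add_M6 :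
    expect ν p (fun c s => (protoQ θ μ₁ μ₂ c s M5 + protoQ θ μ₁ μ₂ c s M6) * h s) =
    (1 - p coin4 + p coin3 * p coin4) * relayMean ν θ μ₁ μ₂ p h := by
  rw [expect_mode hν hθ ha hp ![0, 0, 0, 0, 1, 1] hh.measurable hh.integrable
    fun c s _ => by simp [Fin.sum_univ_six]]
  simp [relayMean]

lemma expect_M2_add_M3 :
    expect ν p (fun c s => (protoQ θ μ₁ μ₂ c s M2 + protoQ θ μ₁ μ₂ c s M3) * h s) =
    (1 - p coin2 + p coin1 * p coin2) * userMean ν θ μ₁ μ₂ p h := by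
  rw [expect_mode hν hθ ha hp ![0, 1, 1, 0, 0, 0] hh.measurable hh.integrable
    fun c s _ => by simp [Fin.sum_univ_six]]
  simp [userMean]

lemma expect_M1_add_M3 :
    expect ν p (fun c s => (protoQ θ μ₁ μ₂ c s M1 + protoQ θ μ₁ μ₂ c s M3) * h s) =
    (1 - p coin1 + p coin1 * p coin2) * userMean ν θ μ₁ μ₂ p h := by
  rw [expect_mode hν hθ ha hp ![1, 0, 1, 0, 0, 0] hh.measurable hh.integrable
    fun c s _ => by simp [Fin.sum_univ_six]]
  simp [userMean]

lemma expect_state : expect ν p (fun _ s => h s) = ∫ s, h s ∂(slotLaw ν) := by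
  rw [expect_mode hν hθ ha hp (fun _ => 1) hh.measurable hh.integrable
    fun c s h1 => by simp [h1], (isActivity_userAct (p coin5)).partMean_compl hh.integrable]
  obtain ⟨e1, e2⟩ := ha.coins hp
  linear_combination partMean (slotLaw ν) (userAct θ μ₁ μ₂ (p coin5)) h * (e1 - e2) +
    (∫ s, h s ∂(slotLaw ν)) * e2

lemma expect_not_M2_M3 :
    expect ν p (fun c s => (1 - (protoQ θ μ₁ μ₂ c s M2 + protoQ θ μ₁ μ₂ c s M3)) * h s) =
    (1 - p coin1) * userMean ν θ μ₁ μ₂ p h + relayMean ν θ μ₁ μ₂ p h := by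
  rw [expect_mode hν hθ ha hp ![1, 0, 0, 1, 1, 1] hh.measurable hh.integrable fun c s h1 => by
    rw [Fin.sum_univ_six] at h1 ⊢
    simp only [Matrix.cons_val]
    linear_combination -h s * h1]
  obtain ⟨e1, e2⟩ := ha.coins hp
  simp [userMean, relayMean]
  linear_combination partMean (slotLaw ν) (fun s => 1 - userAct θ μ₁ μ₂ (p coin5) s) h * e2

lemma expect_not_M1_M3 :
    expect ν p (fun c s => (1 - (protoQ θ μ₁ μ₂ c s M1 + protoQ θ μ₁ μ₂ c s M3)) * h s) =
    (1 - p coin2) * userMean ν θ μ₁ μ₂ p h + relayMean ν θ μ₁ μ₂ p h := by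
  rw [expect_mode hν hθ ha hp ![0, 1, 0, 1, 1, 1] hh.measurable hh.integrable fun c s h1 => by
    rw [Fin.sum_univ_six] at h1 ⊢
    simp only [Matrix.cons_val]
    linear_combination -h s * h1]
  obtain ⟨e1, e2⟩ := ha.coins hp
  simp [userMean, relayMean]
  linear_combination partMean (slotLaw ν) (fun s => 1 - userAct θ μ₁ μ₂ (p coin5) s) h * e2

end

omit hν hθ ha hp in
lemma userMean_sub {f g : State → ℝ} (hf : IsRate (slotLaw ν) f) (hg : IsRate (slotLaw ν) g) :
    userMean ν θ μ₁ μ₂ p (fun s => f s - g s) =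
      userMean ν θ μ₁ μ₂ p f - userMean ν θ μ₁ μ₂ p g :=
  (isActivity_userAct (p coin5)).partMean_sub hf.integrable hg.integrable

lemma expect_M3_order {f : ℝ → State → ℝ} (hf : ∀ t, IsRate (slotLaw ν) (f t))
    (hft : ∀ t s, f t s = t * f 1 s + (1 - t) * f 0 s) :
    expect ν p (fun c s => protoQ θ μ₁ μ₂ c s M3 * f (protoT c) s) =
      p coin1 * p coin2 * ((1 - p coin6) * userMean ν θ μ₁ μ₂ p (f 0) +
        p coin6 * userMean ν θ μ₁ μ₂ p (f 1)) := by
  have h0 : IsRate (slotLaw ν) fun _ : State => (0 : ℝ) :=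
    ⟨measurable_const, integrable_zero _ _ _⟩
  let H : Opt → State → ℝ := ![fun _ => 0, fun _ => 0, f 0, f 1, fun _ => 0, fun _ => 0, fun _ => 0]
  have hH : ∀ k, IsRate (slotLaw ν) (H k) := fun k => by
    fin_cases k
    exacts [h0, h0, hf 0, hf 1, h0, h0, h0]
  rw [expect_eq hν hθ ha hp (fun k => (hH k).measurable) (fun k => (hH k).integrable)
    fun c s _ _ => ?_]
  · refine (integral_sum_mixture (isActivity_userAct (θ := θ) (μ₁ := μ₁) (μ₂ := μ₂) (p coin5))
      (fun n => (p n : ℝ)) fun k => (hH k).integrable).trans ?_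
    rw [sum_opt]
    simp [coinShare, H, partMean_zero, userMean]
    ring
  · rw [hft, sum_opt]
    simp [share, H]
    ring

end Expectations

section Conditions

variable {ν : Measure (ℕ → State)} (hν : IsChannel ν) {θ : Params} (hθ : θ.Valid) {μ₁ μ₂ : ℝ}
  (ha : Admissible θ μ₁ μ₂) {p : Fin 6 → I} (hp : ConstantCoins θ μ₁ μ₂ p)

include hν hθ

/-- The rates of the protocol. -/
lemma expRate_protoPolicy (μ₁ μ₂ : ℝ) (p : Fin 6 → I) :
    let U := userMean ν θ μ₁ μ₂ p
    let V := relayMean ν θ μ₁ μ₂ p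
    let R := expRate (slotLaw ν) θ (protoPolicy θ μ₁ μ₂ p)
    R 0 = (1 - p coin1) * U (C1r θ) + p coin1 * p coin2 *
      ((1 - p coin6) * (U (Cr θ) - U (C2r θ)) + p coin6 * U (C1r θ)) ∧
    R 1 = (1 - p coin2) * U (C2r θ) + p coin1 * p coin2 *
      ((1 - p coin6) * U (C2r θ) + p coin6 * (U (Cr θ) - U (C1r θ))) ∧
    R 2 = (1 - p coin3 + p coin3 * p coin4) * V (Cr1 θ) ∧
    R 3 = (1 - p coin4 + p coin3 * p coin4) * V (Cr2 θ) :=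
  expRate_mixture hθ (isSlotLaw hν) (isActivity_userAct (p coin5)) fun n => (p n : ℝ)

include ha hp

lemma expect_M3_C12r : expect ν p (fun c s => protoQ θ μ₁ μ₂ c s M3 * C12r θ (protoT c) s) =
    p coin1 * p coin2 * ((1 - p coin6) * (userMean ν θ μ₁ μ₂ p (Cr θ) -
      userMean ν θ μ₁ μ₂ p (C2r θ)) + p coin6 * userMean ν θ μ₁ μ₂ p (C1r θ)) := by
  have hm := isSlotLaw hν
  obtain ⟨r1, r2, rr, -, -⟩ := isRate_caps hθ hm
  have h0 : IsRate (slotLaw ν) (C12r θ 0) :=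
    ⟨measurable_C12r θ 0, integrable_optRate hθ hm 2 0⟩
  have h1 : IsRate (slotLaw ν) (C12r θ 1) :=
    ⟨measurable_C12r θ 1, integrable_optRate hθ hm 3 0⟩
  have hft : ∀ t s, C12r θ t s = t * C12r θ 1 s + (1 - t) * C12r θ 0 s := fun t s => by
    simp only [C12r]; ring
  rw [expect_M3_order hν hθ ha hp (f := C12r θ) (fun t => ⟨measurable_C12r θ t, ?_⟩) hft,
    C12r_one_eq, ← userMean_sub rr r2]
  · congr 3
    exact partMean_congr_right _ (hm.pos.mono fun s hs => C12r_zero hθ hs)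
  · rw [show C12r θ t = fun s => t * C12r θ 1 s + (1 - t) * C12r θ 0 s from funext (hft t)]
    exact (h1.integrable.const_mul t).add (h0.integrable.const_mul _)

lemma expect_M3_C21r : expect ν p (fun c s => protoQ θ μ₁ μ₂ c s M3 * C21r θ (protoT c) s) =
    p coin1 * p coin2 * ((1 - p coin6) * userMean ν θ μ₁ μ₂ p (C2r θ) +
      p coin6 * (userMean ν θ μ₁ μ₂ p (Cr θ) - userMean ν θ μ₁ μ₂ p (C1r θ))) := by
  have hm := isSlotLaw hν
  obtain ⟨r1, r2, rr, -, -⟩ := isRate_caps hθ hm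
  have h0 : IsRate (slotLaw ν) (C21r θ 0) :=
    ⟨measurable_C21r θ 0, integrable_optRate hθ hm 2 1⟩
  have h1 : IsRate (slotLaw ν) (C21r θ 1) :=
    ⟨measurable_C21r θ 1, integrable_optRate hθ hm 3 1⟩
  have hft : ∀ t s, C21r θ t s = t * C21r θ 1 s + (1 - t) * C21r θ 0 s := fun t s => by
    simp only [C21r]; ring
  rw [expect_M3_order hν hθ ha hp (f := C21r θ) (fun t => ⟨measurable_C21r θ t, ?_⟩) hft,
    C21r_zero_eq, ← userMean_sub rr r1]
  · congr 3
    exact partMean_congr_right _ (hm.pos.mono fun s hs => C21r_one hθ hs)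
  · rw [show C21r θ t = fun s => t * C21r θ 1 s + (1 - t) * C21r θ 0 s from funext (hft t)]
    exact (h1.integrable.const_mul t).add (h0.integrable.const_mul _)

/-- Positive means of a balanced protocol. -/
lemma means_pos_of_balanced (hb : Balanced (slotLaw ν) θ (protoPolicy θ μ₁ μ₂ p)) :
    0 < userMean ν θ μ₁ μ₂ p (C1r θ) ∧ 0 < userMean ν θ μ₁ μ₂ p (C2r θ) ∧
    userMean ν θ μ₁ μ₂ p (C1r θ) < userMean ν θ μ₁ μ₂ p (Cr θ) ∧
    userMean ν θ μ₁ μ₂ p (C2r θ) < userMean ν θ μ₁ μ₂ p (Cr θ) ∧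
    userMean ν θ μ₁ μ₂ p (Cr θ) <
      userMean ν θ μ₁ μ₂ p (C1r θ) + userMean ν θ μ₁ μ₂ p (C2r θ) ∧
    0 < relayMean ν θ μ₁ μ₂ p (Cr1 θ) ∧ 0 < relayMean ν θ μ₁ μ₂ p (Cr2 θ) := by
  have hm := isSlotLaw hν
  have hact : IsActivity (userAct θ μ₁ μ₂ (p coin5)) := isActivity_userAct (p coin5)
  have hn := hb.not_unused hθ hm (isPolicy_protoPolicy ha hp)
  have h1 := partMean_rates_pos hθ hm hact fun h0 => hn.1 (by
    refine ⟨?_, ?_, ?_, ?_⟩ <;> filter_upwards [h0] with s hs <;>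
      exact mul_eq_zero_of_left hs _)
  have h2 := partMean_rates_pos hθ hm hact.compl fun h0 => hn.2 (by
    refine ⟨?_, ?_, ?_⟩ <;> filter_upwards [h0] with s hs <;>
      exact mul_eq_zero_of_left hs _)
  exact ⟨h1.1, h1.2.1, h1.2.2.1, h1.2.2.2.1, h1.2.2.2.2.1, h2.2.2.2.2.2.1, h2.2.2.2.2.2.2⟩

end Conditions

section

variable {θ : Params} (hθ : θ.Valid) {μ₁ μ₂ : ℝ} {X : TableCase} (hX : X.Weights θ μ₁ μ₂)
  {p : Fin 6 → I}
include hθ hX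

/-- Passes from the entries of a row to conditions on the weights alone. -/
lemma TableCase.Weights.constantEntries_iff :
    X.ConstantEntries p ↔ ConstantCoins θ μ₁ μ₂ p := by
  obtain ⟨h1, h2, h3, h4, h6, -, h7, h8⟩ := hX.mem_flipped hθ
  have h0 : coin6 ∉ X.flipped →
      (θ.η - μ₁ < 1 - θ.η - μ₂ ∧ X.order = 0) ∨ (1 - θ.η - μ₂ < θ.η - μ₁ ∧ X.order = 1) := by
    intro h
    rw [h6] at h
    rcases lt_or_gt_of_ne h with h | h
    · exact Or.inl ⟨h, h7.2 h.le⟩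
    · exact Or.inr ⟨h, h8.2 h⟩
  constructor
  · rintro ⟨e, e6⟩
    exact ⟨fun h => e _ (by decide) (mt h1.1 h), fun h => e _ (by decide) (mt h2.1 h),
      fun h => e _ (by decide) (mt h3.1 h), fun h => e _ (by decide) (mt h4.1 h),
      fun h => (e6 (mt h6.1 h.ne)).trans (h7.2 h.le),
      fun h => (e6 (mt h6.1 h.ne')).trans (h8.2 h)⟩
  · rintro ⟨e1, e2, e3, e4, e5, e6⟩
    refine ⟨fun n hn hf => ?_, fun hf => ?_⟩
    · simp only [mem_insert, mem_singleton] at hn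
      rcases hn with rfl | rfl | rfl | rfl
      exacts [e1 (mt h1.2 hf), e2 (mt h2.2 hf), e3 (mt h3.2 hf), e4 (mt h4.2 hf)]
    · rcases h0 hf with ⟨h, ho⟩ | ⟨h, ho⟩
      · rw [ho, e5 h]
      · rw [ho, e6 h]

end

section Conditions

variable {ν : Measure (ℕ → State)} (hν : IsChannel ν) {θ : Params} (hθ : θ.Valid) {μ₁ μ₂ : ℝ}
  {X : TableCase} (hX : X.Weights θ μ₁ μ₂) {p : Fin 6 → I} (hp : X.ConstantEntries p)
include hν hθ hX hp

/-- Except with three coins, the conditions of a case mean that the protocol is balanced. -/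
lemma conditions_iff_balanced (h3 : ¬X.ThreeCoins) :
    Conditions ν θ μ₁ μ₂ p X ↔ Balanced (slotLaw ν) θ (protoPolicy θ μ₁ μ₂ p) := by
  have ha := hX.admissible hθ
  have hc := (hX.constantEntries_iff hθ).1 hp
  obtain ⟨r1, r2, rr, rr1, rr2⟩ := isRate_caps hθ (isSlotLaw hν)
  have hpos := means_pos_of_balanced hν hθ ha hc
  obtain ⟨R0, R1, R2, R3⟩ := expRate_protoPolicy hν hθ μ₁ μ₂ p
  -- All expectations of the table become polynomials in the coin probabilities and five means. In
  -- each row the formulas, cleared of denominators, are linear combinations of C1 and C2;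
  -- conversely, balance makes the denominators nonzero.
  obtain ⟨hp, hp6⟩ := hp
  have g1 := expect_M3 hν hθ ha hc r1
  have g2 := expect_M3 hν hθ ha hc r2
  have g3 := expect_M3 hν hθ ha hc (rr.sub r1)
  have g4 := expect_M3 hν hθ ha hc (rr.sub r2)
  have g5 := expect_M3 hν hθ ha hc ((rr.sub r1).sub r2)
  have g6 := expect_M6 hν hθ ha hc rr1
  have g7 := expect_M6 hν hθ ha hc rr2
  have g8 := expect_M4_add_M6 hν hθ ha hc rr1
  have g9 := expect_M4_add_M6 hν hθ ha hc rr2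
  have g10 := expect_M5_add_M6 hν hθ ha hc rr1
  have g11 := expect_M5_add_M6 hν hθ ha hc rr2
  have g12 := expect_M2_add_M3 hν hθ ha hc r2
  have g13 := expect_M2_add_M3 hν hθ ha hc (rr.sub r2)
  have g14 := expect_M1_add_M3 hν hθ ha hc r1
  have g15 := expect_M1_add_M3 hν hθ ha hc (rr.sub r1)
  have g16 := expect_not_M2_M3 hν hθ ha hc rr1
  have g17 := expect_not_M2_M3 hν hθ ha hc rr2
  have g18 := expect_not_M1_M3 hν hθ ha hc rr1
  have g19 := expect_not_M1_M3 hν hθ ha hc rr2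
  have g20 := expect_M3_C12r hν hθ ha hc
  have g21 := expect_M3_C21r hν hθ ha hc
  rw [userMean_sub rr r1] at g3 g15
  rw [userMean_sub rr r2] at g4 g13
  rw [userMean_sub (rr.sub r1) r2, userMean_sub rr r1] at g5
  have hP := protocolRates_iff hν hθ ha hc
  unfold Balanced at hpos ⊢
  rw [R0, R1, R2, R3] at hpos ⊢
  generalize userMean ν θ μ₁ μ₂ p (C1r θ) = c₁ at *
  generalize userMean ν θ μ₁ μ₂ p (C2r θ) = c₂ at *
  generalize userMean ν θ μ₁ μ₂ p (Cr θ) = c at *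
  generalize relayMean ν θ μ₁ μ₂ p (Cr1 θ) = d at *
  generalize relayMean ν θ μ₁ μ₂ p (Cr2 θ) = e at *
  have hone : ∀ n ∈ ({coin1, coin2, coin3, coin4} : Finset (Fin 6)), n ∉ X.flipped →
      (p n : ℝ) = 1 := fun n h h' => by rw [hp n h h']; rfl
  have h1 := hone coin1 (by decide)
  have h2 := hone coin2 (by decide)
  have h3' := hone coin3 (by decide)
  have h4 := hone coin4 (by decide)
  have h6 : coin6 ∉ X.flipped → (p coin6 : ℝ) = X.order := fun h => by rw [hp6 h]
  clear hp hp6 hone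
  cases X
  case s0c1 =>
    simp only [Conditions, IsRatio, hP, R0, R1, R2, R3, g5, g4, g7]
    simp only [h1 (by decide), h2 (by decide), h3' (by decide), h4 (by decide)] at hpos ⊢
    constructor
    · rintro ⟨⟨k0, k1⟩, k2⟩
      rw [eq_div_iff k0] at k1
      exact ⟨by linear_combination -k1, by linear_combination k1 + k2⟩
    · rintro ⟨k1, k2⟩
      obtain ⟨q1, q2, q3, q4, q5, q6, q7⟩ := hpos ⟨k1, k2⟩
      have n0 : 1 * 1 * (c - c₁ - c₂) ≠ 0 := by intro h; linarith
      refine ⟨⟨n0, ?_⟩, by linear_combination k1 + k2⟩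
      rw [eq_div_iff n0]
      linear_combination -k1
  case s0c2a =>
    simp only [Conditions, IsRatio, hP, R1, R2, g5, g20, g9, g8, g2]
    simp only [h1 (by decide), h2 (by decide), h4 (by decide)] at hpos ⊢
    constructor
    -- The formula for the sixth coin merely restates C2, which is checked anyway.
    · rintro ⟨⟨k0, k1⟩, -, k3⟩
      rw [eq_div_iff k0] at k1
      exact ⟨by linear_combination -k1, k3⟩
    · rintro ⟨k1, k2⟩
      obtain ⟨q1, q2, q3, q4, q5, q6, q7⟩ := hpos ⟨k1, k2⟩
      have n0 : 1 * 1 * (c - c₁ - c₂) ≠ 0 := by intro h; linarith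
      have n1 : (1 - (p coin3 : ℝ) + p coin3 * 1) * e ≠ 0 := by rw [show (1 - (p coin3 : ℝ) + p coin3 * 1) * e = e by ring]; exact q7.ne'
      refine ⟨⟨n1, ?_⟩, ⟨n0, ?_⟩, k2⟩
      · rw [eq_div_iff n1]
        linear_combination -k1
      · rw [eq_div_iff n0]
        linear_combination k2
  case s0c2b =>
    simp only [Conditions, IsRatio, hP, R0, R3, g5, g21, g10, g11, g4]
    simp only [h1 (by decide), h2 (by decide), h3' (by decide)] at hpos ⊢
    constructor
    · rintro ⟨⟨k0, k1⟩, -, k3⟩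
      rw [eq_div_iff k0] at k1
      exact ⟨k3, by linear_combination -k1⟩
    · rintro ⟨k1, k2⟩
      obtain ⟨q1, q2, q3, q4, q5, q6, q7⟩ := hpos ⟨k1, k2⟩
      have n0 : 1 * 1 * (c - c₁ - c₂) ≠ 0 := by intro h; linarith
      have n1 : (1 - (p coin4 : ℝ) + 1 * p coin4) * d ≠ 0 := by rw [show (1 - (p coin4 : ℝ) + 1 * p coin4) * d = d by ring]; exact q6.ne'
      refine ⟨⟨n1, ?_⟩, ⟨n0, ?_⟩, k1⟩
      · rw [eq_div_iff n1]
        linear_combination -k2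
      · rw [eq_div_iff n0]
        linear_combination -k1
  case s1c1 => simp only [Conditions, hP, R0, R1, R2, R3]
  case s1c2a =>
    simp only [Conditions, IsRatio, hP, R1, R2, g7, g13]
    simp only [h1 (by decide), h3' (by decide), h4 (by decide), h6 (by decide), TableCase.order, Set.Icc.coe_zero] at hpos ⊢
    constructor
    · rintro ⟨⟨k0, k1⟩, k2⟩
      rw [eq_div_iff k0] at k1
      exact ⟨by linear_combination k1, k2⟩
    · rintro ⟨k1, k2⟩
      obtain ⟨q1, q2, q3, q4, q5, q6, q7⟩ := hpos ⟨k1, k2⟩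
      have n0 : (1 - (p coin2 : ℝ) + 1 * p coin2) * (c - c₂) ≠ 0 := by rw [show (1 - (p coin2 : ℝ) + 1 * p coin2) * (c - c₂) = c - c₂ by ring]; intro h; linarith
      refine ⟨⟨n0, ?_⟩, k2⟩
      rw [eq_div_iff n0]
      linear_combination k1
  case s1c2b =>
    simp only [Conditions, IsRatio, hP, R0, R3, g2, g10]
    simp only [h1 (by decide), h2 (by decide), h3' (by decide), h6 (by decide), TableCase.order, Set.Icc.coe_zero] at hpos ⊢
    constructor
    · rintro ⟨⟨k0, k1⟩, k2⟩
      rw [eq_div_iff k0] at k1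
      exact ⟨k2, by linear_combination -k1⟩
    · rintro ⟨k1, k2⟩
      obtain ⟨q1, q2, q3, q4, q5, q6, q7⟩ := hpos ⟨k1, k2⟩
      have n0 : (1 - (p coin4 : ℝ) + 1 * p coin4) * d ≠ 0 := by rw [show (1 - (p coin4 : ℝ) + 1 * p coin4) * d = d by ring]; exact q6.ne'
      refine ⟨⟨n0, ?_⟩, k1⟩
      rw [eq_div_iff n0]
      linear_combination -k2
  case s1c2c =>
    simp only [Conditions, IsRatio, g17, g13, g12, g16]
    simp only [h1 (by decide), h3' (by decide), h6 (by decide), TableCase.order, Set.Icc.coe_zero] at hpos ⊢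
    constructor
    · rintro ⟨⟨k0, k1⟩, k2, k3⟩
      rw [eq_div_iff k0] at k1
      rw [eq_div_iff k2] at k3
      exact ⟨by linear_combination k1, by linear_combination -k3⟩
    · rintro ⟨k1, k2⟩
      obtain ⟨q1, q2, q3, q4, q5, q6, q7⟩ := hpos ⟨k1, k2⟩
      have n0 : (1 - (p coin2 : ℝ) + 1 * p coin2) * (c - c₂) ≠ 0 := by rw [show (1 - (p coin2 : ℝ) + 1 * p coin2) * (c - c₂) = c - c₂ by ring]; intro h; linarith
      have n1 : (1 - 1) * userMean ν θ μ₁ μ₂ p (Cr1 θ) + d ≠ 0 := by rw [sub_self, zero_mul, zero_add]; exact q6.ne'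
      refine ⟨⟨n0, ?_⟩, n1, ?_⟩
      · rw [eq_div_iff n0]
        linear_combination k1
      · rw [eq_div_iff n1]
        linear_combination -k2
  case s1c2cEq => exact absurd (Or.inl rfl) h3
  case s1c2d =>
    simp only [Conditions, IsRatio, hP, R1, R2, g4, g9]
    simp only [h1 (by decide), h2 (by decide), h4 (by decide), h6 (by decide), TableCase.order, Set.Icc.coe_zero] at hpos ⊢
    constructor
    · rintro ⟨⟨k0, k1⟩, k2⟩
      rw [eq_div_iff k0] at k1
      exact ⟨by linear_combination -k1, k2⟩
    · rintro ⟨k1, k2⟩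
      obtain ⟨q1, q2, q3, q4, q5, q6, q7⟩ := hpos ⟨k1, k2⟩
      have n0 : (1 - (p coin3 : ℝ) + p coin3 * 1) * e ≠ 0 := by rw [show (1 - (p coin3 : ℝ) + p coin3 * 1) * e = e by ring]; exact q7.ne'
      refine ⟨⟨n0, ?_⟩, k2⟩
      rw [eq_div_iff n0]
      linear_combination -k1
  case s2c1 => simp only [Conditions, hP, R0, R1, R2, R3]
  case s2c2a =>
    simp only [Conditions, IsRatio, hP, R0, R3, g6, g15]
    simp only [h2 (by decide), h3' (by decide), h4 (by decide), h6 (by decide), TableCase.order, Set.Icc.coe_one] at hpos ⊢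
    constructor
    · rintro ⟨⟨k0, k1⟩, k2⟩
      rw [eq_div_iff k0] at k1
      exact ⟨k2, by linear_combination k1⟩
    · rintro ⟨k1, k2⟩
      obtain ⟨q1, q2, q3, q4, q5, q6, q7⟩ := hpos ⟨k1, k2⟩
      have n0 : (1 - (p coin1 : ℝ) + p coin1 * 1) * (c - c₁) ≠ 0 := by rw [show (1 - (p coin1 : ℝ) + p coin1 * 1) * (c - c₁) = c - c₁ by ring]; intro h; linarith
      refine ⟨⟨n0, ?_⟩, k1⟩
      rw [eq_div_iff n0]
      linear_combination k2
  case s2c2b =>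
    simp only [Conditions, IsRatio, hP, R1, R2, g1, g9]
    simp only [h1 (by decide), h2 (by decide), h4 (by decide), h6 (by decide), TableCase.order, Set.Icc.coe_one] at hpos ⊢
    constructor
    · rintro ⟨⟨k0, k1⟩, k2⟩
      rw [eq_div_iff k0] at k1
      exact ⟨by linear_combination -k1, k2⟩
    · rintro ⟨k1, k2⟩
      obtain ⟨q1, q2, q3, q4, q5, q6, q7⟩ := hpos ⟨k1, k2⟩
      have n0 : (1 - (p coin3 : ℝ) + p coin3 * 1) * e ≠ 0 := by rw [show (1 - (p coin3 : ℝ) + p coin3 * 1) * e = e by ring]; exact q7.ne'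
      refine ⟨⟨n0, ?_⟩, k2⟩
      rw [eq_div_iff n0]
      linear_combination -k1
  case s2c2c =>
    simp only [Conditions, IsRatio, g18, g15, g14, g19]
    simp only [h2 (by decide), h4 (by decide), h6 (by decide), TableCase.order, Set.Icc.coe_one] at hpos ⊢
    constructor
    · rintro ⟨⟨k0, k1⟩, k2, k3⟩
      rw [eq_div_iff k0] at k1
      rw [eq_div_iff k2] at k3
      exact ⟨by linear_combination -k3, by linear_combination k1⟩
    · rintro ⟨k1, k2⟩
      obtain ⟨q1, q2, q3, q4, q5, q6, q7⟩ := hpos ⟨k1, k2⟩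
      have n0 : (1 - (p coin1 : ℝ) + p coin1 * 1) * (c - c₁) ≠ 0 := by rw [show (1 - (p coin1 : ℝ) + p coin1 * 1) * (c - c₁) = c - c₁ by ring]; intro h; linarith
      have n1 : (1 - 1) * userMean ν θ μ₁ μ₂ p (Cr2 θ) + e ≠ 0 := by rw [sub_self, zero_mul, zero_add]; exact q7.ne'
      refine ⟨⟨n0, ?_⟩, n1, ?_⟩
      · rw [eq_div_iff n0]
        linear_combination k2
      · rw [eq_div_iff n1]
        linear_combination -k1
  case s2c2cEq => exact absurd (Or.inr rfl) h3
  case s2c2d =>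
    simp only [Conditions, IsRatio, hP, R0, R3, g3, g10]
    simp only [h1 (by decide), h2 (by decide), h3' (by decide), h6 (by decide), TableCase.order, Set.Icc.coe_one] at hpos ⊢
    constructor
    · rintro ⟨⟨k0, k1⟩, k2⟩
      rw [eq_div_iff k0] at k1
      exact ⟨k2, by linear_combination -k1⟩
    · rintro ⟨k1, k2⟩
      obtain ⟨q1, q2, q3, q4, q5, q6, q7⟩ := hpos ⟨k1, k2⟩
      have n0 : (1 - (p coin4 : ℝ) + 1 * p coin4) * d ≠ 0 := by rw [show (1 - (p coin4 : ℝ) + 1 * p coin4) * d = d by ring]; exact q6.ne'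
      refine ⟨⟨n0, ?_⟩, k1⟩
      rw [eq_div_iff n0]
      linear_combination -k2

end Conditions

/-! ### Balance in the three-coin cases -/

section ThreeCoins

variable {ν : Measure (ℕ → State)} (hν : IsChannel ν) {θ : Params} (hθ : θ.Valid) {μ₁ μ₂ : ℝ}
  {X : TableCase} (hX : X.Weights θ μ₁ μ₂) {p : Fin 6 → I} (hp : X.ConstantEntries p)

lemma userAct_eq_of_usesCoin5 (h : UsesCoin5 θ μ₁ μ₂) (y : ℝ) (s : State) :
    userAct θ μ₁ μ₂ y s = y := by
  simp [userAct, userConst, userSlope, h]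

lemma userMean_of_usesCoin5 (h : UsesCoin5 θ μ₁ μ₂) (f : State → ℝ) :
    userMean ν θ μ₁ μ₂ p f = p coin5 * ∫ s, f s ∂(slotLaw ν) := by
  simp only [userMean, partMean, userAct_eq_of_usesCoin5 h, integral_const_mul]

lemma relayMean_of_usesCoin5 (h : UsesCoin5 θ μ₁ μ₂) (f : State → ℝ) :
    relayMean ν θ μ₁ μ₂ p f = (1 - p coin5) * ∫ s, f s ∂(slotLaw ν) := by
  simp only [relayMean, partMean, userAct_eq_of_usesCoin5 h, integral_const_mul]

/-- The bounds `ωl` and `ωu` lie strictly inside the unit interval, which keeps `p₅` away from 0 and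
1 and makes the quotients in the three-coin formulas meaningful. -/
lemma ratio_bounds {x A B D : ℝ} (hA : 0 < A) (hB : A < B) (hD : 0 < D) (h1 : A / B ≤ x)
    (h2 : x ≤ D / (D + A)) :
    x ≠ 0 ∧ 1 - x ≠ 0 ∧ A / B / (1 - A / B) = A / (B - A) ∧
      (1 - D / (D + A)) / (D / (D + A)) = A / D := by
  have hB' := hA.trans hB
  have h3 : 0 < x := (div_pos hA hB').trans_le h1
  have h4 : x < 1 := h2.trans_lt ((div_lt_one (by linarith)).2 (by linarith))
  have h5 : B - A ≠ 0 := by linarith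
  have h6 : D + A ≠ 0 := by linarith
  refine ⟨h3.ne', by linarith, ?_, ?_⟩
  · rw [show 1 - A / B = (B - A) / B by field_simp]
    field_simp
  · rw [show 1 - D / (D + A) = A / (D + A) by field_simp; ring]
    field_simp

include hν hθ hX hp

/-- With three coins, the conditions imply that the protocol is balanced. -/
lemma balanced_of_conditions_of_threeCoins (h3 : X.ThreeCoins)
    (h : Conditions ν θ μ₁ μ₂ p X) : Balanced (slotLaw ν) θ (protoPolicy θ μ₁ μ₂ p) := by
  have hm := isSlotLaw hν
  have := hm.prob
  have ha := hX.admissible hθ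
  have hc := (hX.constantEntries_iff hθ).1 hp
  have h5 := (hX.mem_flipped hθ).2.2.2.2.2.1.1 h3
  obtain ⟨r1, r2, rr, rr1, rr2⟩ := isRate_caps hθ hm
  obtain ⟨R0, R1, R2, R3⟩ := expRate_protoPolicy hν hθ μ₁ μ₂ p
  have h1 : IsActivity fun _ : State => (1 : ℝ) :=
    ⟨measurable_const, fun _ => zero_le_one, fun _ => le_rfl⟩
  have hone : ∀ f : State → ℝ, partMean (slotLaw ν) (fun _ => 1) f = ∫ s, f s ∂(slotLaw ν) :=
    fun f => by simp [partMean]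
  obtain ⟨q1, q2, q3, q4, -, q6, q7⟩ := partMean_rates_pos hθ hm h1 fun h0 => by
    obtain ⟨s, hs⟩ := h0.exists
    exact one_ne_zero hs
  simp only [hone] at q1 q2 q3 q4 q6 q7
  simp only [userMean_of_usesCoin5 h5, relayMean_of_usesCoin5 h5] at R0 R1 R2 R3
  have e1 := expect_state hν hθ ha hc rr
  have e2 := expect_state hν hθ ha hc rr1
  have e3 := expect_state hν hθ ha hc rr2
  have e4 := expect_state hν hθ ha hc (rr1.add r2)
  have e5 := expect_state hν hθ ha hc (rr2.add r1)
  rw [integral_add rr1.integrable r2.integrable] at e4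
  rw [integral_add rr2.integrable r1.integrable] at e5
  have k1 := hp.1 coin1 (by decide)
  have k2 := hp.1 coin2 (by decide)
  have k3 := hp.1 coin3 (by decide)
  have k4 := hp.1 coin4 (by decide)
  have k6 := hp.2
  have hw := hX.2.2.2.2
  unfold Balanced
  rw [R0, R1, R2, R3]
  rcases h3 with rfl | rfl
  · have hP : Cr2 θ = C2r θ := by funext s; unfold Cr2 C2r; rw [hw.2.2.2.2]
    simp only [Conditions] at h
    rw [e1, e2, e3, e4] at h
    rw [hP] at h ⊢
    obtain ⟨b1, b2, b3, b4⟩ := h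
    obtain ⟨n1, n2, n3, n4⟩ := ratio_bounds q2 q4 q6 b1 b2
    rw [n3] at b3
    rw [n4] at b4
    have n5 : (∫ s, Cr θ s ∂(slotLaw ν)) - ∫ s, C2r θ s ∂(slotLaw ν) ≠ 0 := by linarith
    have n6 := q6.ne'
    rw [k1 (by decide), k3 (by decide), k6 (by decide), b3, b4]
    simp only [Set.Icc.coe_one, TableCase.order, Set.Icc.coe_zero]
    constructor
    · field_simp
      ring
    · field_simp
      ring
  · have hP : Cr1 θ = C1r θ := by funext s; unfold Cr1 C1r; rw [hw.2.2.2.2]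
    simp only [Conditions] at h
    rw [e1, e2, e3, e5] at h
    rw [hP] at h ⊢
    obtain ⟨b1, b2, b3, b4⟩ := h
    obtain ⟨n1, n2, n3, n4⟩ := ratio_bounds q1 q3 q7 b1 b2
    rw [n3] at b3
    rw [n4] at b4
    have n5 : (∫ s, Cr θ s ∂(slotLaw ν)) - ∫ s, C1r θ s ∂(slotLaw ν) ≠ 0 := by linarith
    have n6 := q7.ne'
    rw [k2 (by decide), k4 (by decide), k6 (by decide), b3, b4]
    simp only [Set.Icc.coe_one, TableCase.order]
    constructor
    · field_simp
      ring
    · field_simp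
      ring

end ThreeCoins

/-! ### Uniqueness of the coin probabilities -/

section Uniqueness

variable {ν : Measure (ℕ → State)} (hν : IsChannel ν) {θ : Params} (hθ : θ.Valid) {μ₁ μ₂ : ℝ}
  {X : TableCase} {p p' : Fin 6 → I}

include hν hθ

lemma Accepts.balanced (h : Accepts ν θ μ₁ μ₂ p X) :
    Balanced (slotLaw ν) θ (protoPolicy θ μ₁ μ₂ p) := by
  by_cases h3 : X.ThreeCoins
  · exact balanced_of_conditions_of_threeCoins hν hθ h.1 h.2.1 h3 h.2.2
  · exact (conditions_iff_balanced hν hθ h.1 h.2.1 h3).1 h.2.2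

/-- The weights determine the probabilities of the coins. -/
lemma Accepts.coin_eq (h : Accepts ν θ μ₁ μ₂ p X) (h' : Accepts ν θ μ₁ μ₂ p' X)
    (h5 : X.ThreeCoins → p coin5 = p' coin5) {n : Fin 6} (hn : n ≠ coin5) : p n = p' n := by
  have ha := h.1.admissible hθ
  have hc := (h.1.constantEntries_iff hθ).1 h.2.1
  have hc' := (h.1.constantEntries_iff hθ).1 h'.2.1
  have f5 := (h.1.mem_flipped hθ).2.2.2.2.2.1
  -- The activity of the users depends on the coins only through the fifth one, and only with three
  -- coins; so both protocols have the same means.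
  have hact : userAct θ μ₁ μ₂ (p' coin5) = userAct θ μ₁ μ₂ (p coin5) := by
    by_cases h3 : X.ThreeCoins
    · rw [h5 h3]
    · funext s
      simp [userAct, userSlope, mt f5.2 h3]
  have hU : userMean ν θ μ₁ μ₂ p' = userMean ν θ μ₁ μ₂ p := by
    funext f; simp only [userMean, hact]
  have hV : relayMean ν θ μ₁ μ₂ p' = relayMean ν θ μ₁ μ₂ p := by
    funext f; simp only [relayMean, hact]
  have hb := h.balanced hν hθ
  have hb' := h'.balanced hν hθ
  obtain ⟨q1, q2, q3, q4, q5, q6, q7⟩ := means_pos_of_balanced hν hθ ha hc hb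
  obtain ⟨R0, R1, R2, R3⟩ := expRate_protoPolicy hν hθ μ₁ μ₂ p
  obtain ⟨R0', R1', R2', R3'⟩ := expRate_protoPolicy hν hθ μ₁ μ₂ p'
  unfold Balanced at hb hb'
  rw [R0, R1, R2, R3] at hb
  rw [R0', R1', R2', R3', hU, hV] at hb'
  generalize userMean ν θ μ₁ μ₂ p (C1r θ) = c₁ at *
  generalize userMean ν θ μ₁ μ₂ p (C2r θ) = c₂ at *
  generalize userMean ν θ μ₁ μ₂ p (Cr θ) = c at *
  generalize relayMean ν θ μ₁ μ₂ p (Cr1 θ) = d at *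
  generalize relayMean ν θ μ₁ μ₂ p (Cr2 θ) = e at *
  have n1 : c - c₁ ≠ 0 := by linarith
  have n2 : c - c₂ ≠ 0 := by linarith
  have n3 : c - c₁ - c₂ ≠ 0 := fun h => by linarith
  obtain ⟨hb1, hb2⟩ := hb
  obtain ⟨hb1', hb2'⟩ := hb'
  have hη₁ := hθ.η₁
  have hη₀ := hθ.η₀
  suffices hs : (p coin1 = p' coin1 ∧ p coin2 = p' coin2 ∧ p coin6 = p' coin6) ∧
      p coin3 = p' coin3 ∧ p coin4 = p' coin4 by
    obtain ⟨⟨e1, e2, e6⟩, e3, e4⟩ := hs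
    fin_cases n
    exacts [e1, e2, e3, e4, absurd rfl hn, e6]
  -- As coin 3 or coin 4 is constantly 1, the relay factors simplify to `p₃` and `p₄`. Each case
  -- then leaves two unknowns, one per group, in two linear equations. Eliminating the relay unknown
  -- leaves a nonzero coefficient.
  obtain ⟨z12, z34⟩ := ha.coins hc
  obtain ⟨z12', z34'⟩ := ha.coins hc'
  have g1 : (1 - (p coin1 : ℝ)) * c₁ + p coin1 * p coin2 *
      (c - c₂ + p coin6 * (c₁ + c₂ - c)) = p coin3 * e := by
    linear_combination hb1 + e * z34
  have g2 : (1 - (p coin2 : ℝ)) * c₂ + p coin1 * p coin2 *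
      (c₂ - p coin6 * (c₁ + c₂ - c)) = p coin4 * d := by
    linear_combination hb2 + d * z34
  have g1' : (1 - (p' coin1 : ℝ)) * c₁ + p' coin1 * p' coin2 *
      (c - c₂ + p' coin6 * (c₁ + c₂ - c)) = p' coin3 * e := by
    linear_combination hb1' + e * z34'
  have g2' : (1 - (p' coin2 : ℝ)) * c₂ + p' coin1 * p' coin2 *
      (c₂ - p' coin6 * (c₁ + c₂ - c)) = p' coin4 * d := by
    linear_combination hb2' + d * z34'
  by_cases m2 : μ₂ = 1 - θ.η
  · have m1 : μ₁ ≠ θ.η := fun m1 => ha.ne_top ⟨m1, m2⟩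
    have m0 : μ₂ ≠ 0 := by rw [m2]; linarith
    have m6 : 1 - θ.η - μ₂ < θ.η - μ₁ := by
      linarith [lt_of_le_of_ne ha.le₁ m1]
    rw [hc.two m1, hc.six₁ m6, hc.four m0] at *
    rw [hc'.two m1, hc'.six₁ m6, hc'.four m0] at *
    simp only [Set.Icc.coe_one] at g1 g2 g1' g2'
    refine ⟨⟨Subtype.ext (mul_right_cancel₀ n1 ?_), rfl, rfl⟩,
      Subtype.ext (mul_right_cancel₀ q7.ne' ?_), rfl⟩
    · linear_combination g2 - g2'
    · linear_combination g1' - g1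
  by_cases m1 : μ₁ = θ.η
  · have m0 : μ₁ ≠ 0 := by rw [m1]; exact hη₀.ne'
    have m6 : θ.η - μ₁ < 1 - θ.η - μ₂ := by
      linarith [lt_of_le_of_ne ha.le₂ m2]
    rw [hc.one m2, hc.six₀ m6, hc.three m0] at *
    rw [hc'.one m2, hc'.six₀ m6, hc'.three m0] at *
    simp only [Set.Icc.coe_one, Set.Icc.coe_zero] at g1 g2 g1' g2'
    refine ⟨⟨rfl, Subtype.ext (mul_right_cancel₀ n2 ?_), rfl⟩, rfl,
      Subtype.ext (mul_right_cancel₀ q6.ne' ?_)⟩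
    · linear_combination g1 - g1'
    · linear_combination g2' - g2
  rw [hc.one m2, hc.two m1] at *
  rw [hc'.one m2, hc'.two m1] at *
  simp only [Set.Icc.coe_one] at g1 g2 g1' g2'
  by_cases m0 : μ₁ = 0
  · have m4 : μ₂ ≠ 0 := fun m4 => ha.ne_zero ⟨m0, m4⟩
    rw [hc.four m4] at *
    rw [hc'.four m4] at *
    simp only [Set.Icc.coe_one] at g1 g2 g1' g2'
    refine ⟨⟨rfl, rfl, Subtype.ext (mul_right_cancel₀ n3 ?_)⟩,
      Subtype.ext (mul_right_cancel₀ q7.ne' ?_), rfl⟩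
    · linear_combination g2 - g2'
    · linear_combination g1' - g1 + g2' - g2
  · rw [hc.three m0] at *
    rw [hc'.three m0] at *
    simp only [Set.Icc.coe_one] at g1 g2 g1' g2'
    refine ⟨⟨rfl, rfl, Subtype.ext (mul_right_cancel₀ n3 ?_)⟩, rfl,
      Subtype.ext (mul_right_cancel₀ q6.ne' ?_)⟩
    · linear_combination g1' - g1
    · linear_combination g2' - g2 + g1' - g1

end Uniqueness

/-! ### Coins for balanced policies -/

lemma exists_unitInterval_mul_eq {a b : ℝ} (ha : 0 ≤ a) (hab : a ≤ b) (hb : 0 < b) :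
    ∃ x : I, (x : ℝ) * b = a :=
  ⟨⟨a / b, div_nonneg ha hb.le, (div_le_one hb).2 hab⟩, div_mul_cancel₀ a hb.ne'⟩

lemma userAct_eq_userConst {θ : Params} {μ₁ μ₂ : ℝ} (h : ¬UsesCoin5 θ μ₁ μ₂) (y : ℝ) :
    userAct θ μ₁ μ₂ y = userConst θ μ₁ μ₂ := by
  funext s
  simp [userAct, userSlope, h]

section Coins

variable {θ : Params} (hθ : θ.Valid) {m : Measure State} (hm : IsSlotLaw m) {μ₁ μ₂ : ℝ}
  {w : Opt → State → ℝ} (hw : IsPolicy w)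

include hθ hm hw in
lemma expRate_eq_sum_partMean (j : Fin 4) :
    expRate m θ w j = ∑ k, partMean m (w k) (optRate θ k j) :=
  integral_finsetSum _ fun k _ => (hw.isActivity k).integrable_mul (integrable_optRate hθ hm k j)

include hθ hm hw in
lemma expRate_eq_partMean :
    let W := fun k => partMean m (w k)
    expRate m θ w 0 = W 0 (C1r θ) + (W 2 (Cr θ) - W 2 (C2r θ)) + W 3 (C1r θ) ∧
    expRate m θ w 1 = W 1 (C2r θ) + W 2 (C2r θ) + (W 3 (Cr θ) - W 3 (C1r θ)) ∧
    expRate m θ w 2 = W 4 (Cr1 θ) + W 6 (Cr1 θ) ∧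
    expRate m θ w 3 = W 5 (Cr2 θ) + W 6 (Cr2 θ) := by
  intro W
  have e0 : W 2 (C12r θ 0) = W 2 (Cr θ) - W 2 (C2r θ) := by
    rw [← (hw.isActivity 2).partMean_sub (integrable_Cr hθ hm) (integrable_C2r hθ hm)]
    exact partMean_congr_right _ (hm.pos.mono fun s hs => C12r_zero hθ hs)
  have e1 : W 3 (C21r θ 1) = W 3 (Cr θ) - W 3 (C1r θ) := by
    rw [← (hw.isActivity 3).partMean_sub (integrable_Cr hθ hm) (integrable_C1r hθ hm)]
    exact partMean_congr_right _ (hm.pos.mono fun s hs => C21r_one hθ hs)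
  have h0 : ∀ k, W k (fun _ => 0) = 0 := fun k => partMean_zero m _
  have f1 := C12r_one_eq θ
  have f2 := C21r_zero_eq θ
  simp only [expRate_eq_sum_partMean hθ hm hw, sum_opt]
  refine ⟨?_, ?_, ?_, ?_⟩
  · change W 0 (C1r θ) + W 1 (fun _ => 0) + W 2 (C12r θ 0) + W 3 (C12r θ 1) +
      W 4 (fun _ => 0) + W 5 (fun _ => 0) + W 6 (fun _ => 0) = _
    simp only [h0, e0, f1]
    ring
  · change W 0 (fun _ => 0) + W 1 (C2r θ) + W 2 (C21r θ 0) + W 3 (C21r θ 1) +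
      W 4 (fun _ => 0) + W 5 (fun _ => 0) + W 6 (fun _ => 0) = _
    simp only [h0, e1, f2]
    ring
  · change W 0 (fun _ => 0) + W 1 (fun _ => 0) + W 2 (fun _ => 0) + W 3 (fun _ => 0) +
      W 4 (Cr1 θ) + W 5 (fun _ => 0) + W 6 (Cr1 θ) = _
    simp only [h0]
    ring
  · change W 0 (fun _ => 0) + W 1 (fun _ => 0) + W 2 (fun _ => 0) + W 3 (fun _ => 0) +
      W 4 (fun _ => 0) + W 5 (Cr2 θ) + W 6 (Cr2 θ) = _
    simp only [h0]
    ring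

variable (ha : Admissible θ μ₁ μ₂) (hmax : Maximizes m θ μ₁ μ₂ w)
include hθ hm hw ha hmax

lemma Maximizes.unused_of_not_allowed {k : Opt} (hk : ¬Allowed θ μ₁ μ₂ k) : Unused m w k := by
  filter_upwards [hmax, hm.pos] with s h1 hs
  by_contra hne
  exact hk ((optVal_eq_maxVal_iff hθ ha hs k).1
    (eq_maxVal_of_sum_eq (fun k => hw.nonneg k s) (hw.sum_eq s) h1 hne)).1

/-- Outside the null set of ties between the groups, a maximizing policy has no choice between users
and relay. -/
lemma Maximizes.sum_user_eq (h5 : ¬UsesCoin5 θ μ₁ μ₂) :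
    ∀ᵐ s ∂m, w 0 s + w 1 s + w 2 s + w 3 s = userConst θ μ₁ μ₂ s ∧
      w 4 s + w 5 s + w 6 s = 1 - userConst θ μ₁ μ₂ s := by
  filter_upwards [hmax, hm.pos, ae_ne_userBest hθ hm ha h5] with s h1 hs hne
  have h2 := fun k h => (optVal_eq_maxVal_iff hθ ha hs k).1
    (eq_maxVal_of_sum_eq (fun k => hw.nonneg k s) (hw.sum_eq s) h1 h)
  have h3 := hw.sum_eq s
  rw [sum_opt] at h3
  unfold userConst
  rw [if_neg h5]
  rcases lt_or_gt_of_ne hne with h | h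
  · have hz : ∀ k : Opt, 3 < k → w k s = 0 := fun k hk => by
      by_contra hn
      exact absurd ((h2 k hn).2.2 hk) (not_le.2 h)
    rw [if_pos h.le]
    rw [hz 4 (by decide), hz 5 (by decide), hz 6 (by decide)] at h3 ⊢
    constructor <;> linarith
  · have hz : ∀ k : Opt, k ≤ 3 → w k s = 0 := fun k hk => by
      by_contra hn
      exact absurd ((h2 k hn).2.1 hk) (not_le.2 h)
    rw [if_neg (not_le.2 h)]
    rw [hz 0 (by decide), hz 1 (by decide), hz 2 (by decide), hz 3 (by decide)] at h3 ⊢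
    constructor <;> linarith

/-- At most two user options are tied. Moving mass between them changes a single mean, which lies
between 0 and its value when one option takes all the mass. A state-independent coin with the right
ratio thus reproduces both user rates. -/
lemma exists_user_coins (h5 : ¬UsesCoin5 θ μ₁ μ₂)
    (hne : ¬(Unused m w 0 ∧ Unused m w 1 ∧ Unused m w 2 ∧ Unused m w 3)) :
    let U := partMean m (userConst θ μ₁ μ₂)
    ∃ x₁ x₂ x₆ : I, (μ₂ ≠ 1 - θ.η → x₁ = 1) ∧ (μ₁ ≠ θ.η → x₂ = 1) ∧
      (θ.η - μ₁ < 1 - θ.η - μ₂ → x₆ = 0) ∧ (1 - θ.η - μ₂ < θ.η - μ₁ → x₆ = 1) ∧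
      (1 - x₁) * U (C1r θ) + x₁ * x₂ * ((1 - x₆) * (U (Cr θ) - U (C2r θ)) + x₆ * U (C1r θ)) =
        expRate m θ w 0 ∧
      (1 - x₂) * U (C2r θ) + x₁ * x₂ * ((1 - x₆) * U (C2r θ) + x₆ * (U (Cr θ) - U (C1r θ))) =
        expRate m θ w 1 := by
  intro U
  have hact := hw.isActivity
  have hu : IsActivity (userConst θ μ₁ μ₂) := by
    have := isActivity_userAct (θ := θ) (μ₁ := μ₁) (μ₂ := μ₂) 0
    rwa [userAct_eq_userConst h5] at this
  have hsum := hmax.sum_user_eq hθ hm hw ha h5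
  obtain ⟨p1, p2, p3, p4, p5, -, -⟩ := partMean_rates_pos hθ hm hu fun h0 => hne (by
    refine ⟨?_, ?_, ?_, ?_⟩ <;> filter_upwards [h0, hsum] with s h1 h2 <;>
      linarith [hw.nonneg 0 s, hw.nonneg 1 s, hw.nonneg 2 s, hw.nonneg 3 s, h2.1])
  have hU : ∀ {f : State → ℝ}, Integrable f m → U f = partMean m (w 0) f + partMean m (w 1) f +
      partMean m (w 2) f + partMean m (w 3) f := fun {f} hf => by
    have i := fun k => (hact k).integrable_mul hf
    have i01 : Integrable (fun s => w 0 s * f s + w 1 s * f s) m := (i 0).add (i 1)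
    have i012 : Integrable (fun s => w 0 s * f s + w 1 s * f s + w 2 s * f s) m := i01.add (i 2)
    simp only [partMean]
    rw [← integral_add (i 0) (i 1), ← integral_add i01 (i 2), ← integral_add i012 (i 3)]
    refine integral_congr_ae (hsum.mono fun s hs => ?_)
    simp only [← hs.1]
    ring
  have i1 := integrable_C1r hθ hm
  have i2 := integrable_C2r hθ hm
  have ir := integrable_Cr hθ hm
  have U1 := hU i1
  have U2 := hU i2
  have Ur := hU ir
  obtain ⟨R0, R1, -, -⟩ := expRate_eq_partMean hθ hm hw
  beta_reduce at R0 R1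
  have hz : ∀ {k}, ¬Allowed θ μ₁ μ₂ k → ∀ f, partMean m (w k) f = 0 := fun hk f =>
    partMean_eq_zero (hmax.unused_of_not_allowed hθ hm hw ha hk) f
  have s1 : ∀ k, 0 ≤ partMean m (w k) (Cr θ) - partMean m (w k) (C1r θ) := fun k => by
    rw [← (hact k).partMean_sub ir i1]
    exact partMean_nonneg (hact k) (hm.pos.mono fun s hs => sub_pos.2 (C1r_lt_Cr hθ hs))
  have s2 : ∀ k, 0 ≤ partMean m (w k) (Cr θ) - partMean m (w k) (C2r θ) := fun k => by
    rw [← (hact k).partMean_sub ir i2]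
    exact partMean_nonneg (hact k) (hm.pos.mono fun s hs => sub_pos.2 (C2r_lt_Cr hθ hs))
  have s3 : ∀ k, 0 ≤ partMean m (w k) (C1r θ) + partMean m (w k) (C2r θ)
      - partMean m (w k) (Cr θ) := fun k => by
    rw [← (hact k).partMean_add i1 i2]
    refine le_of_le_of_eq ?_ ((hact k).partMean_sub (i1.add i2) ir)
    exact partMean_nonneg (hact k) (hm.pos.mono fun s hs => sub_pos.2 (Cr_lt hθ hs))
  by_cases m2 : μ₂ = 1 - θ.η
  · have m1 : μ₁ < θ.η := lt_of_le_of_ne ha.le₁ fun m1 => ha.ne_top ⟨m1, m2⟩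
    have z1 := hz (k := 1) m1.ne
    have z2 := hz (k := 2) (show ¬(θ.η - μ₁ ≤ 1 - θ.η - μ₂) by linarith)
    rw [z1, z2] at U1 U2 Ur
    -- Only options 0 and 3 remain: user 1 gets its full capacity in both, and the coin matches the
    -- rate of user 2, earned in option 3 alone.
    obtain ⟨x, hx⟩ := exists_unitInterval_mul_eq (s1 3)
      (b := U (Cr θ) - U (C1r θ)) (by linarith [s1 0]) (by linarith)
    refine ⟨x, 1, 1, fun h => absurd m2 h, fun _ => rfl, fun h => by linarith, fun _ => rfl, ?_, ?_⟩
    · rw [R0, z2, z2, U1]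
      simp only [Set.Icc.coe_one]
      ring
    · rw [R1, z1, z2, ← hx]
      simp only [Set.Icc.coe_one]
      ring
  by_cases m1 : μ₁ = θ.η
  · have m3 : μ₂ < 1 - θ.η := lt_of_le_of_ne ha.le₂ m2
    have z0 := hz (k := 0) m2
    have z3 := hz (k := 3) (show ¬(1 - θ.η - μ₂ ≤ θ.η - μ₁) by linarith)
    rw [z0, z3] at U1 U2 Ur
    obtain ⟨x, hx⟩ := exists_unitInterval_mul_eq (s2 2)
      (b := U (Cr θ) - U (C2r θ)) (by linarith [s2 1]) (by linarith)
    refine ⟨1, x, 0, fun _ => rfl, fun h => absurd m1 h, fun _ => rfl, fun h => by linarith, ?_, ?_⟩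
    · rw [R0, z0, z3, ← hx]
      simp only [Set.Icc.coe_one, Set.Icc.coe_zero]
      ring
    · rw [R1, z3, z3, U2]
      simp only [Set.Icc.coe_one, Set.Icc.coe_zero]
      ring
  · have z0 := hz (k := 0) m2
    have z1 := hz (k := 1) m1
    rw [z0, z1] at U1 U2 Ur
    have hpos : 0 < U (C1r θ) + U (C2r θ) - U (Cr θ) := sub_pos.2 p5
    obtain ⟨x, hx⟩ := exists_unitInterval_mul_eq (s3 3)
      (b := U (C1r θ) + U (C2r θ) - U (Cr θ)) (by linarith [s3 2]) hpos
    refine ⟨1, 1, x, fun _ => rfl, fun _ => rfl, fun h => ?_, fun h => ?_, ?_, ?_⟩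
    · have z3 := hz (k := 3) (not_le.2 h)
      simp only [z3, add_zero, sub_zero] at hx
      exact Subtype.ext ((mul_eq_zero.1 hx).resolve_right hpos.ne')
    · have z2 := hz (k := 2) (not_le.2 h)
      rw [z2] at U1 U2 Ur
      exact Subtype.ext (mul_right_cancel₀ hpos.ne' (by
        rw [hx, Set.Icc.coe_one]; linarith))
    · rw [R0, z0]
      simp only [Set.Icc.coe_one]
      linear_combination hx + Ur - U2
    · rw [R1, z1]
      simp only [Set.Icc.coe_one]
      linear_combination -hx + U2

/-- Mode 6 can only be tied with one of modes 4 and 5. The rate common to both tied modes is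
unaffected by the choice, and the coin matches the other one. -/
lemma exists_relay_coins (h5 : ¬UsesCoin5 θ μ₁ μ₂)
    (hne : ¬(Unused m w 4 ∧ Unused m w 5 ∧ Unused m w 6)) :
    let V := partMean m fun s => 1 - userConst θ μ₁ μ₂ s
    ∃ x₃ x₄ : I, (μ₁ ≠ 0 → x₃ = 1) ∧ (μ₂ ≠ 0 → x₄ = 1) ∧
      (1 - x₃ + x₃ * x₄) * V (Cr1 θ) = expRate m θ w 2 ∧
      (1 - x₄ + x₃ * x₄) * V (Cr2 θ) = expRate m θ w 3 := by
  intro V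
  have hact := hw.isActivity
  have hu : IsActivity fun s => 1 - userConst θ μ₁ μ₂ s := by
    have := (isActivity_userAct (θ := θ) (μ₁ := μ₁) (μ₂ := μ₂) 0).compl
    rwa [userAct_eq_userConst h5] at this
  have hsum := hmax.sum_user_eq hθ hm hw ha h5
  obtain ⟨-, -, -, -, -, p1, p2⟩ := partMean_rates_pos hθ hm hu fun h0 => hne (by
    refine ⟨?_, ?_, ?_⟩ <;> filter_upwards [h0, hsum] with s h1 h2 <;>
      linarith [hw.nonneg 4 s, hw.nonneg 5 s, hw.nonneg 6 s, h2.2])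
  have hV : ∀ {f : State → ℝ}, Integrable f m → V f = partMean m (w 4) f + partMean m (w 5) f +
      partMean m (w 6) f := fun {f} hf => by
    have i := fun k => (hact k).integrable_mul hf
    have i45 : Integrable (fun s => w 4 s * f s + w 5 s * f s) m := (i 4).add (i 5)
    simp only [partMean]
    rw [← integral_add (i 4) (i 5), ← integral_add i45 (i 6)]
    refine integral_congr_ae (hsum.mono fun s hs => ?_)
    simp only [← hs.2]
    ring
  have V1 := hV (integrable_Cr1 hθ hm)
  have V2 := hV (integrable_Cr2 hθ hm)
  have s1 := fun k => partMean_nonneg (h := Cr1 θ) (hact k) (hm.pos.mono fun s hs => Cr1_pos hθ hs)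
  have s2 := fun k => partMean_nonneg (h := Cr2 θ) (hact k) (hm.pos.mono fun s hs => Cr2_pos hθ hs)
  obtain ⟨-, -, R2, R3⟩ := expRate_eq_partMean hθ hm hw
  beta_reduce at R2 R3
  have hz : ∀ {k}, ¬Allowed θ μ₁ μ₂ k → ∀ f, partMean m (w k) f = 0 := fun hk f =>
    partMean_eq_zero (hmax.unused_of_not_allowed hθ hm hw ha hk) f
  by_cases m1 : μ₁ = 0
  · have z5 := hz (k := 5) fun m2 => ha.ne_zero ⟨m1, m2⟩
    rw [z5] at V1 V2
    obtain ⟨x, hx⟩ := exists_unitInterval_mul_eq (s2 6) (b := V (Cr2 θ)) (by linarith [s2 4]) p2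
    refine ⟨x, 1, fun h => absurd m1 h, fun _ => rfl, ?_, ?_⟩
    · rw [R2, V1, Set.Icc.coe_one]
      ring
    · rw [R3, z5, ← hx, Set.Icc.coe_one]
      ring
  have z4 := hz (k := 4) m1
  rw [z4] at V1 V2
  by_cases m2 : μ₂ = 0
  · obtain ⟨x, hx⟩ := exists_unitInterval_mul_eq (s1 6) (b := V (Cr1 θ)) (by linarith [s1 5]) p1
    refine ⟨1, x, fun _ => rfl, fun h => absurd m2 h, ?_, ?_⟩
    · rw [R2, z4, ← hx, Set.Icc.coe_one]
      ring
    · rw [R3, V2, Set.Icc.coe_one]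
      ring
  · have z5 := hz (k := 5) m2
    rw [z5] at V1 V2
    refine ⟨1, 1, fun _ => rfl, fun _ => rfl, ?_, ?_⟩
    · rw [R2, z4, V1, Set.Icc.coe_one]
      ring
    · rw [R3, z5, V2, Set.Icc.coe_one]
      ring

end Coins

/-- Balanced maximizing policies can be replaced by the protocol with suitable coins. -/
lemma exists_balanced_protoPolicy {ν : Measure (ℕ → State)} (hν : IsChannel ν) {θ : Params}
    (hθ : θ.Valid) {μ₁ μ₂ : ℝ} (ha : Admissible θ μ₁ μ₂) (h5 : ¬UsesCoin5 θ μ₁ μ₂)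
    {w : Opt → State → ℝ} (hw : IsPolicy w) (hb : Balanced (slotLaw ν) θ w)
    (hmax : Maximizes (slotLaw ν) θ μ₁ μ₂ w) :
    ∃ p : Fin 6 → I, ConstantCoins θ μ₁ μ₂ p ∧
      Balanced (slotLaw ν) θ (protoPolicy θ μ₁ μ₂ p) := by
  have hm := isSlotLaw hν
  have hn := hb.not_unused hθ hm hw
  obtain ⟨x₁, x₂, x₆, c1, c2, c6, c6', e0, e1⟩ := exists_user_coins hθ hm hw ha hmax h5 hn.1
  obtain ⟨x₃, x₄, c3, c4, e2, e3⟩ := exists_relay_coins hθ hm hw ha hmax h5 hn.2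
  -- The fifth coin has no influence here; its probability 0 is arbitrary.
  let p : Fin 6 → I := ![x₁, x₂, x₃, x₄, 0, x₆]
  have hu := userAct_eq_userConst h5 (p coin5)
  obtain ⟨R0, R1, R2, R3⟩ := expRate_protoPolicy hν hθ μ₁ μ₂ p
  refine ⟨p, ⟨c1, c2, c3, c4, c6, c6'⟩, ?_⟩
  unfold Balanced
  rw [R0, R1, R2, R3]
  simp only [userMean, relayMean, hu]
  exact ⟨e0.trans (hb.1.trans e3.symm), e1.trans (hb.2.trans e2.symm)⟩

/-! ### Comparison of cases -/

section Comparison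

variable {ν : Measure (ℕ → State)} (hν : IsChannel ν) {θ : Params} (hθ : θ.Valid)
  {μ₁ μ₂ μ₁' μ₂' : ℝ} {X X' : TableCase} {p p' : Fin 6 → I}

include hν hθ

/-- Options that are used by accepted coins are also allowed for other accepted weights. -/
lemma Accepts.allowed (h : Accepts ν θ μ₁ μ₂ p X) (h' : Accepts ν θ μ₁' μ₂' p' X') {k : Opt}
    (hk : coinShare (fun n => p n) k ≠ 0) : Allowed θ μ₁' μ₂' k := by
  have hm := isSlotLaw hν
  have ha := h.1.admissible hθ
  have hc := (h.1.constantEntries_iff hθ).1 h.2.1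
  have ha' := h'.1.admissible hθ
  have hc' := (h'.1.constantEntries_iff hθ).1 h'.2.1
  have hw := isPolicy_protoPolicy ha hc
  have hb := h.balanced hν hθ
  -- The policy of the first protocol also maximizes the Lagrangian of the other weights, so an
  -- option it uses with positive probability must be allowed there.
  have hmax := hb.maximizes hθ hm hw (isPolicy_protoPolicy ha' hc') (h'.balanced hν hθ)
    (maximizes_protoPolicy hθ hm ha hc) (maximizes_protoPolicy hθ hm ha' hc')
  by_contra hn
  have h0 := hmax.unused_of_not_allowed hθ hm hw ha' hn
  obtain ⟨q1, -, -, -, -, q6, -⟩ := means_pos_of_balanced hν hθ ha hc hb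
  have h1 : ∀ s, protoPolicy θ μ₁ μ₂ p k s = (if k ≤ 3 then userAct θ μ₁ μ₂ (p coin5) s
      else 1 - userAct θ μ₁ μ₂ (p coin5) s) * coinShare (fun n => p n) k := fun s => by
    fin_cases k <;> rfl
  have h2 := h0.mono fun s hs => (mul_eq_zero.1 ((h1 s).symm.trans hs)).resolve_right hk
  by_cases h3 : k ≤ 3
  · simp only [if_pos h3] at h2
    exact q1.ne' (partMean_eq_zero h2 _)
  · simp only [if_neg h3] at h2
    exact q6.ne' (partMean_eq_zero h2 _)

/-- A nondegenerate coin uses the options between which it decides. These are allowed for the other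
weights too, which puts the other weights on the boundary where that coin is flipped. -/
lemma Accepts.flipped_subset (h : Accepts ν θ μ₁ μ₂ p X) (hd : Nondegenerate p X)
    (h' : Accepts ν θ μ₁' μ₂' p' X') :
    (∀ n, n ≠ coin5 → n ∈ X.flipped → n ∈ X'.flipped) ∧ (X.order = 0 → X'.order = 0) := by
  have hA := fun {k} => h.allowed hν hθ h' (k := k)
  have hc := (h.1.constantEntries_iff hθ).1 h.2.1
  obtain ⟨f1, f2, f3, f4, f6, -, f7, -⟩ := h.1.mem_flipped hθ
  obtain ⟨f1', f2', f3', f4', f6', -, f7', -⟩ := h'.1.mem_flipped hθ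
  have lt : ∀ {n}, n ∈ X.flipped → 1 - (p n : ℝ) ≠ 0 := fun hn h0 => by
    have h1 : ((p _ : I) : ℝ) < 1 := (hd _ hn).2
    linarith
  have gt : ∀ {n}, n ∈ X.flipped → (p n : ℝ) ≠ 0 := fun hn => by
    have h1 : 0 < ((p _ : I) : ℝ) := (hd _ hn).1
    exact h1.ne'
  have x1 : (p coin1 : ℝ) ≠ 0 := by
    by_cases hn : coin1 ∈ X.flipped
    · exact gt hn
    · rw [hc.one (mt f1.2 hn)]; exact one_ne_zero
  have x2 : (p coin2 : ℝ) ≠ 0 := by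
    by_cases hn : coin2 ∈ X.flipped
    · exact gt hn
    · rw [hc.two (mt f2.2 hn)]; exact one_ne_zero
  have a2 : 1 - (p coin6 : ℝ) ≠ 0 → θ.η - μ₁' ≤ 1 - θ.η - μ₂' := fun hn =>
    hA (k := 2) (mul_ne_zero (mul_ne_zero x1 x2) hn)
  have a3 : (p coin6 : ℝ) ≠ 0 → 1 - θ.η - μ₂' ≤ θ.η - μ₁' := fun hn =>
    hA (k := 3) (mul_ne_zero (mul_ne_zero x1 x2) hn)
  constructor
  · intro n hn hf
    fin_cases n
    exacts [f1'.2 (hA (k := 0) (lt hf)), f2'.2 (hA (k := 1) (lt hf)),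
      f3'.2 (hA (k := 4) (lt hf)), f4'.2 (hA (k := 5) (lt hf)), absurd rfl hn,
      f6'.2 (le_antisymm (a2 (lt hf)) (a3 (gt hf)))]
  · intro ho
    rw [f7']
    rcases (f7.1 ho).lt_or_eq with h0 | h0
    · refine a2 ?_
      rw [hc.six₀ h0]
      simp
    · exact a2 (lt (f6.2 h0))

/-- Cases that accept nondegenerate coins coincide. -/
lemma Accepts.case_eq (h : Accepts ν θ μ₁ μ₂ p X) (hd : Nondegenerate p X)
    (h' : Accepts ν θ μ₁' μ₂' p' X') (hd' : Nondegenerate p' X') : X = X' := by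
  obtain ⟨e1, e2⟩ := h.flipped_subset hν hθ hd h'
  obtain ⟨e1', e2'⟩ := h'.flipped_subset hν hθ hd' h
  exact TableCase.eq_of_flipped_eq h.1 h'.1
    (TableCase.flipped_erase_eq fun n hn => ⟨e1 n hn, e1' n hn⟩) ⟨e2, e2'⟩

end Comparison

end BidirectionalRelay

end

theorem proposition2 (ν : MeasureTheory.Measure (ℕ → BidirectionalRelay.State))
    (θ : BidirectionalRelay.Params)
    (hν : BidirectionalRelay.IsChannel ν)
    (hP₁ : 0 < θ.P₁) (hP₂ : 0 < θ.P₂) (hPᵣ : 0 < θ.Pᵣ) (hη₀ : 0 < θ.η) (hη₁ : θ.η < 1) :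
    -- optimal weights exist
    (∃ μ₁ μ₂ : ℝ, BidirectionalRelay.OptimalWeights ν θ μ₁ μ₂) ∧
    -- they lie in the search rectangle, and belong to exactly one case
    (∀ μ₁ μ₂ : ℝ, BidirectionalRelay.OptimalWeights ν θ μ₁ μ₂ →
      μ₁ ∈ Set.Icc 0 θ.η ∧ μ₂ ∈ Set.Icc 0 (1 - θ.η) ∧
      ∃! X : BidirectionalRelay.TableCase, X.Weights θ μ₁ μ₂) ∧
    -- in each case the stated metrics coincide
    (∀ (X : BidirectionalRelay.TableCase) (μ₁ μ₂ : ℝ), X.Weights θ μ₁ μ₂ → X.Ties θ μ₁ μ₂) ∧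
    -- weights and coin flip probabilities that meet the conditions of a case are optimal
    (∀ (X : BidirectionalRelay.TableCase) (μ₁ μ₂ : ℝ) (p : Fin 6 → unitInterval),
      BidirectionalRelay.Accepts ν θ μ₁ μ₂ p X →
      BidirectionalRelay.OptimalWeights ν θ μ₁ μ₂ ∧
      BidirectionalRelay.ProtocolOptimal ν θ μ₁ μ₂ p) ∧
    -- optimal weights meet the conditions of their case
    (∀ (X : BidirectionalRelay.TableCase) (μ₁ μ₂ : ℝ), ¬ X.ThreeCoins →
      X.Weights θ μ₁ μ₂ → BidirectionalRelay.OptimalWeights ν θ μ₁ μ₂ →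
      ∃ p : Fin 6 → unitInterval, BidirectionalRelay.Accepts ν θ μ₁ μ₂ p X) ∧
    -- the weights determine the coin flip probabilities (of the first four coins and the sixth one;
    -- with three coins, given that of the fifth one)
    (∀ (X : BidirectionalRelay.TableCase) (μ₁ μ₂ : ℝ) (p p' : Fin 6 → unitInterval),
      BidirectionalRelay.Accepts ν θ μ₁ μ₂ p X → BidirectionalRelay.Accepts ν θ μ₁ μ₂ p' X →
      (X.ThreeCoins → p BidirectionalRelay.coin5 = p' BidirectionalRelay.coin5) →
      ∀ n, n ≠ BidirectionalRelay.coin5 → p n = p' n) ∧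
    -- only one case applies, if no coin is degenerate
    (∀ (X X' : BidirectionalRelay.TableCase) (μ₁ μ₂ μ₁' μ₂' : ℝ) (p p' : Fin 6 → unitInterval),
      BidirectionalRelay.Accepts ν θ μ₁ μ₂ p X → BidirectionalRelay.Nondegenerate p X →
      BidirectionalRelay.Accepts ν θ μ₁' μ₂' p' X' → BidirectionalRelay.Nondegenerate p' X' →
      X = X') := by
  have hθ : θ.Valid := ⟨hP₁, hP₂, hPᵣ, hη₀, hη₁⟩
  have hm := BidirectionalRelay.isSlotLaw hν
  refine ⟨?_, ?_, fun X μ₁ μ₂ hX => hX.ties, ?_, ?_, ?_, ?_⟩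
  · obtain ⟨μ₁, μ₂, w, hw, hb, hmax⟩ := BidirectionalRelay.exists_balanced_maximizes hθ hm
    exact ⟨μ₁, μ₂, BidirectionalRelay.optimalWeights_of_balanced hν hθ hw hb hmax⟩
  · intro μ₁ μ₂ h
    obtain ⟨w, hw, hb, hmax⟩ := BidirectionalRelay.exists_balanced_of_optimalWeights hν hθ h
    have ha := BidirectionalRelay.admissible_of_maximizes hθ hm hw hb hmax
    exact ⟨⟨ha.nonneg₁, ha.le₁⟩, ⟨ha.nonneg₂, ha.le₂⟩,
      BidirectionalRelay.TableCase.existsUnique_weights hθ ha⟩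
  · intro X μ₁ μ₂ p h
    have ha := h.1.admissible hθ
    have hc := (h.1.constantEntries_iff hθ).1 h.2.1
    have hb := h.balanced hν hθ
    exact ⟨BidirectionalRelay.optimalWeights_of_balanced hν hθ
        (BidirectionalRelay.isPolicy_protoPolicy ha hc) hb
        (BidirectionalRelay.maximizes_protoPolicy hθ hm ha hc),
      BidirectionalRelay.protocolOptimal_of_balanced hν hθ ha hc hb⟩
  · intro X μ₁ μ₂ h3 hX h
    obtain ⟨w, hw, hb, hmax⟩ := BidirectionalRelay.exists_balanced_of_optimalWeights hν hθ h
    have h5 := mt (hX.mem_flipped hθ).2.2.2.2.2.1.2 h3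
    obtain ⟨p, hp, hbp⟩ := BidirectionalRelay.exists_balanced_protoPolicy hν hθ
      (hX.admissible hθ) h5 hw hb hmax
    have hc := (hX.constantEntries_iff hθ).2 hp
    exact ⟨p, hX, hc, (BidirectionalRelay.conditions_iff_balanced hν hθ hX hc h3).2 hbp⟩
  · intro X μ₁ μ₂ p p' h h' h5 n hn
    exact h.coin_eq hν hθ h' h5 hn
  · intro X X' μ₁ μ₂ μ₁' μ₂' p p' h hd h' hd'
    exact h.case_eq hν hθ hd h' hd'
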